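/- **Notation.** Let $n\ge 1$, $\alpha\in[-\infty,+\infty]$, $u\in\mathbb{R}^n$ with $\|u\|=1$, $H=u^\perp$, $R_u(x)=x-2\langle x,u\rangle u$. For a function $f$ put $R_uf=f\circ R_u$; for a set $K$ put $\tau_uK=\frac12K+\frac12R_uK$. For $f:\mathbb{R}^n\to[0,\infty)$ put $\mathrm{supp} f=\{f>0\}$, $\mathrm{lev}_{\ge t}f=\{f\ge t\}$, $J(f)=\int_{\mathbb{R}^n} f\in[0,\infty]$ and $\mathrm{proj}_Hf(x)=\sup_{t\in\mathbb{R}}f(x+tu)$ for $x\in H$. For $a,b>0$ let $M_\alpha^{(s,t)}(a,b)=(sa^\alpha+tb^\alpha)^{1/\alpha}$, read as $a^sb^t$, $\min\{a,b\}$, $\max\{a,b\}$ for $\alpha=0,-\infty,+\infty$. $\mathcal{C}_\alpha$ is the set of all $f:\mathbb{R}^n\to[0,\infty)$, $f\not\equiv0$, that are upper semicontinuous, tend to $0$ as $\|x\|\to\infty$, and have a convex support of dimension $n$ with $f(\lambda x+(1-\lambda)y)\ge M_\alpha^{(\lambda,1-\lambda)}(f(x),f(y))$ for all $x,y\in\mathrm{supp}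 f$, $\lambda\in[0,1]$. $\mathrm{LC}_c$ is defined like $\mathcal{C}_0$ but without the condition on the dimension of the support. For real $\alpha\ne0$ let $\mathrm{base}_\alpha f=(1-f^\alpha)/\alpha$ on the closure of $\mathrm{supp} f$ and $+\infty$ elsewhere (with $0^\alpha=+\infty$ if $\alpha<0$), and let $\mathrm{base}_0f=-\log f$; conversely a base function $\psi$ determines the function $(1-\alpha\psi)_+^{1/\alpha}$ (for $\alpha=0$: $e^{-\psi}$). For real $\alpha$, the functions $f\star_\alpha g$ and $\lambda\cdot_\alpha f$ ($\lambda>0$) are those with base functions $x\mapsto\inf_{y+z=x}(\mathrm{base}_\alpha f(y)+\mathrm{base}_\alpha g(z))$ and $x\mapsto\lambda\,\mathrm{base}_\alpha f(x/\lambda)$. The $\alpha$-Minkowski symmetral is $\tau_u^\alpha f=\frac12\cdot_\alpha f\star_\alpha\frac12\cdot_\alpha R_uf$ for real $\alpha$, and $$\tau_u^{-\infty}f(x)=\sup_{y+z=x}\min\{f(2y),R_uf(2z)\},\qquad \tau_u^{+\infty}f(x)=\sup_{y+z=x,\ f(2y)>0,\ R_uf(2z)>0}\max\{f(2y),R_uf(2z)\}.$$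 For real $\alpha$ let $h_f^{(\alpha)}(x)=\sup_y(\langle x,y\rangle-\mathrm{base}_\alpha f(y))$. The $\alpha$-mean width is $$w_\alpha(f)=\begin{cases}\int_{\mathbb{R}^n}h_f^{(\alpha)}(x)\,\bigl(1-\tfrac{\alpha\|x\|^2}{2}\bigr)_+^{(1-\alpha)/\alpha}\,dx,&\alpha\in\mathbb{R}\setminus\{0\},\\ \frac2n\int_{\mathbb{R}^n}h_f^{(0)}\,d\gamma_n,&\alpha=0,\\ \int_0^\infty w(\mathrm{lev}_{\ge t}f)\,dt,&\alpha=-\infty,\end{cases}$$ where the weight is $0$ where $1-\alpha\|x\|^2/2\le0$, $\gamma_n$ is the standard Gaussian measure, and $w(K)=2\int_{\mathbb{S}^{n-1}}\sup_{x\in K}\langle x,v\rangle\,d\sigma(v)$ with $\sigma$ the normalized surface measure ($w(\varnothing)=0$). Values in $[-\infty,+\infty]$ are allowed; the integral of an extended real function is $\int h^+-\int h^-$, with $\infty-\infty=+\infty$. **Proposition.** Let $f,g\in\mathcal{C}_\alpha$. (i) If $\alpha<+\infty$, then $w_\alpha(\tau_u^\alpha f)=w_\alpha(f)$. (ii) If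 $f\le g$, then $\tau_u^\alpha f\le\tau_u^\alpha g$. (iii) $R_u(\tau_u^\alpha f)=\tau_u^\alpha f$. (iv) $\tau_u^\alpha(\tau_u^\alpha f)=\tau_u^\alpha f$. (v) If $f_H\in\mathcal{C}_\alpha$ satisfies $R_uf_H=f_H$, then $\tau_u^\alpha f_H=f_H$. (vi) $\mathrm{proj}_H\tau_u^\alpha f=\mathrm{proj}_Hf$. (vii) If $\alpha\ge-1/n$, then $J(\tau_u^\alpha\varphi)\ge J(\varphi)$ for every $\varphi\in\mathcal{C}_\alpha$ and, if moreover $\alpha\le0$, also for every $\varphi\in\mathrm{LC}_c$. If $\alpha=0$, then $J(\tau_u^0f)=J(f)$ if and only if there is $x_0\in\mathbb{R}^n$ with $f(x)=R_uf(x-x_0)$ for all $x\in\mathbb{R}^n$. (viii) For every $t>0$, $\mathrm{lev}_{\ge t}\tau_u^{-\infty}f=\tau_u\,\mathrm{lev}_{\ge t}f$. -/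

import Mathlib

open MeasureTheory Topology Filter Set
open scoped ENNReal NNReal Pointwise

noncomputable section

namespace MinkSymm

/-- `ℝⁿ` with its Euclidean structure. -/
abbrev E (n : ℕ) := EuclideanSpace ℝ (Fin n)

variable {n : ℕ}

/-! ### The classes of functions

Functions `ℝⁿ → [0,∞)` are modelled as `[0,∞]`-valued functions that are finite everywhere
(finiteness is a clause of the classes below). -/

/-- The support `{f > 0}` (no closure is taken). -/
def supp (f : E n → ℝ≥0∞) : Set (E n) := {x | 0 < f x}

/-- The `α`-mean `M_α^{(s,t)}(a,b)` of positive numbers `a, b`, for `α ∈ [-∞,+∞]`. -/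
def alphaMean (α : EReal) (s t : ℝ≥0) (a b : ℝ≥0∞) : ℝ≥0∞ :=
  if α = ⊥ then min a b
  else if α = ⊤ then max a b
  else if α = 0 then a ^ (s : ℝ) * b ^ (t : ℝ)
  else (s * a ^ α.toReal + t * b ^ α.toReal) ^ (1 / α.toReal)

/-- `α`-concavity: the support is convex and `f(λx + (1-λ)y) ≥ M_α^{(λ,1-λ)}(f(x), f(y))`
for all `x, y` in the support and all `λ ∈ [0,1]`. -/
def AlphaConcave (α : EReal) (f : E n → ℝ≥0∞) : Prop :=
  Convex ℝ (supp f) ∧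
    ∀ x ∈ supp f, ∀ y ∈ supp f, ∀ s t : ℝ≥0, s + t = 1 →
      alphaMean α s t (f x) (f y) ≤ f ((s : ℝ) • x + (t : ℝ) • y)

/-- The class `C_α(ℝⁿ)`: finite, `α`-concave, not identically zero, upper semicontinuous, with
support of full dimension, and tending to `0` at infinity. -/
structure MemC (α : EReal) (f : E n → ℝ≥0∞) : Prop where
  finite : ∀ x, f x < ∞
  alphaConcave : AlphaConcave α f
  proper : (supp f).Nonempty
  usc : UpperSemicontinuous f
  full_dim : affineSpan ℝ (supp f) = ⊤
  tendsto_zero : Tendsto f (cocompact (E n)) (𝓝 0)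

/-- The class `LC_c(ℝⁿ)` of functions `e^{-ψ}` with `ψ` convex, coercive, proper and lower
semicontinuous; in terms of `f = e^{-ψ}`: finite, log-concave, not identically zero, upper
semicontinuous and tending to `0` at infinity (the support may have lower dimension). -/
structure MemLCc (f : E n → ℝ≥0∞) : Prop where
  finite : ∀ x, f x < ∞
  logConcave : AlphaConcave 0 f
  proper : (supp f).Nonempty
  usc : UpperSemicontinuous f
  tendsto_zero : Tendsto f (cocompact (E n)) (𝓝 0)

/-! ### Base functions and the operations `⋆_α`, `·_α` for real `α` -/

/-- The base function `base_α f`, with values in `(-∞,+∞]`: for `α ≠ 0` it is `(1 - f^α)/α` on the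
closure of the support and `+∞` elsewhere; for `α = 0` it is `-log f`.

For `α ≤ 0` the formulas give `+∞` wherever `f = 0`. For `α > 0` the value `+∞` off the
closed support has to be prescribed: it makes the base function of the characteristic function of
a convex body `K` the indicator function `I_K^∞`, and the base function of every function
of the class `C_α` convex and lower semicontinuous. -/
def base (α : ℝ) (f : E n → ℝ≥0∞) (x : E n) : EReal :=
  open Classical in
  if α = 0 then -ENNReal.log (f x)
  else if x ∈ closure (supp f) then (1 - ((f x ^ α : ℝ≥0∞) : EReal)) / (α : EReal)
  else ⊤

/-- The function with a given base function: `(1 - αψ)_+^{1/α}`, and `e^{-ψ}` if `α = 0`. -/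
def ofBase (α : ℝ) (ψ : E n → EReal) (x : E n) : ℝ≥0∞ :=
  if α = 0 then EReal.exp (-ψ x)
  else (1 - (α : EReal) * ψ x).toENNReal ^ (1 / α)

/-- Infimal convolution `(φ □ ψ)(x) = inf_{y+z=x} (φ(y) + ψ(z))`. -/
def infConv (φ ψ : E n → EReal) (x : E n) : EReal := ⨅ y : E n, φ y + ψ (x - y)

/-- Epi-multiplication `x ↦ c ψ(x/c)`. -/
def epiMul (c : ℝ) (ψ : E n → EReal) (x : E n) : EReal := (c : EReal) * ψ (c⁻¹ • x)

/-- The `α`-Asplund sum `f ⋆_α g`. -/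
def asplund (α : ℝ) (f g : E n → ℝ≥0∞) : E n → ℝ≥0∞ :=
  ofBase α (infConv (base α f) (base α g))

/-- The `(α,c)`-homothety `c ·_α f`. -/
def homothety (α : ℝ) (c : ℝ) (f : E n → ℝ≥0∞) : E n → ℝ≥0∞ :=
  ofBase α (epiMul c (base α f))

/-! ### The operations `⊕_α`, `×_α` for `α = ±∞` -/

/-- `f ⊕_{-∞} g`. -/
def oplusBot (f g : E n → ℝ≥0∞) (x : E n) : ℝ≥0∞ := ⨆ y : E n, min (f y) (g (x - y))

/-- `f ⊕_{+∞} g`; as always for `α`-means, only pairs of points at which both functions are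
positive compete. -/
def oplusTop (f g : E n → ℝ≥0∞) (x : E n) : ℝ≥0∞ :=
  ⨆ (y : E n) (_ : y ∈ supp f) (_ : x - y ∈ supp g), max (f y) (g (x - y))

/-- `c ×_{±∞} f`, i.e. `x ↦ f(x/c)`. -/
def timesInf (c : ℝ) (f : E n → ℝ≥0∞) (x : E n) : ℝ≥0∞ := f (c⁻¹ • x)

/-! ### Reflections, projections, Minkowski symmetrals -/

/-- The reflection `R_u(x) = x - 2⟨x,u⟩u`. -/
def reflPt (u x : E n) : E n := x - (2 * inner ℝ x u) • u

/-- The reflection `R_u f = f ∘ R_u` of a function. -/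
def refl (u : E n) (f : E n → ℝ≥0∞) (x : E n) : ℝ≥0∞ := f (reflPt u x)

/-- The `α`-Minkowski symmetral `τ_u^α f`, for `α ∈ [-∞,+∞]`. -/
def symm (α : EReal) (u : E n) (f : E n → ℝ≥0∞) : E n → ℝ≥0∞ :=
  if α = ⊥ then oplusBot (timesInf (1 / 2) f) (timesInf (1 / 2) (refl u f))
  else if α = ⊤ then oplusTop (timesInf (1 / 2) f) (timesInf (1 / 2) (refl u f))
  else asplund α.toReal (homothety α.toReal (1 / 2) f) (homothety α.toReal (1 / 2) (refl u f))

/-- The Minkowski symmetral `τ_u K = ½K + ½R_u K` of a set. -/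
def symmSet (u : E n) (K : Set (E n)) : Set (E n) :=
  (1 / 2 : ℝ) • K + (1 / 2 : ℝ) • (reflPt u '' K)

/-- The superlevel set `{f ≥ t}`. -/
def superlevel (t : ℝ) (f : E n → ℝ≥0∞) : Set (E n) := {x | ENNReal.ofReal t ≤ f x}

/-- The projection of `f` into `H = u^⊥`, as a function on `H`. -/
def proj (u : E n) (f : E n → ℝ≥0∞) (x : ((Submodule.span ℝ {u})ᗮ : Submodule ℝ (E n))) : ℝ≥0∞ :=
  ⨆ t : ℝ, f ((x : E n) + t • u)

/-- The total mass. -/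
def mass (f : E n → ℝ≥0∞) : ℝ≥0∞ := ∫⁻ x, f x

/-! ### Mean widths -/

/-- The Legendre–Fenchel conjugate. -/
def legendre (ψ : E n → EReal) (x : E n) : EReal :=
  ⨆ y : E n, ((inner ℝ x y : ℝ) : EReal) - ψ y

/-- The `α`-support function `h_f^{(α)}`. -/
def alphaSupport (α : ℝ) (f : E n → ℝ≥0∞) : E n → EReal := legendre (base α f)

/-- The integral of an extended-real-valued function, `∫ h⁺ - ∫ h⁻`, with `∞ - ∞ = +∞`. -/
def extIntegral (μ : Measure (E n)) (h : E n → EReal) : EReal :=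
  if ∫⁻ x, (h x).toENNReal ∂μ = ∞ then ⊤
  else ((∫⁻ x, (h x).toENNReal ∂μ : ℝ≥0∞) : EReal) - ((∫⁻ x, (-h x).toENNReal ∂μ : ℝ≥0∞) : EReal)

/-- The weight `(1 - α‖x‖²/2)_+^{(1-α)/α}`, understood as `0` where `1 - α‖x‖²/2 ≤ 0`. -/
def weight (α : ℝ) (x : E n) : ℝ≥0∞ :=
  if 0 < 1 - α * ‖x‖ ^ 2 / 2 then ENNReal.ofReal ((1 - α * ‖x‖ ^ 2 / 2) ^ ((1 - α) / α)) else 0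

/-- The standard Gaussian measure on `ℝⁿ`. -/
def gaussian (n : ℕ) : Measure (E n) :=
  volume.withDensity fun x =>
    ENNReal.ofReal ((2 * Real.pi) ^ (-(n : ℝ) / 2) * Real.exp (-‖x‖ ^ 2 / 2))

/-- The support function of a set. -/
def suppFun (K : Set (E n)) (v : E n) : ℝ := sSup ((fun x => inner ℝ x v) '' K)

/-- The mean width `w(K) = 2 ∫ h_K dσ`, with `σ` the normalized surface measure of the unit sphere
(so the integral is an average). The empty set gets mean width `0`. -/
def meanWidth (K : Set (E n)) : ℝ :=
  2 * ⨍ v : Metric.sphere (0 : E n) 1, suppFun K v ∂((volume : Measure (E n)).toSphere)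

/-- The `α`-mean width, for `α ∈ [-∞,+∞)`; at `α = +∞`, where the notion is not defined, the
value is irrelevant. -/
def alphaMeanWidth (α : EReal) (f : E n → ℝ≥0∞) : EReal :=
  if α = ⊥ then ((∫⁻ t in Ioi (0 : ℝ), ENNReal.ofReal (meanWidth (superlevel t f)) : ℝ≥0∞) : EReal)
  else if α = ⊤ then 0
  else if α = 0 then ((2 / n : ℝ) : EReal) * extIntegral (gaussian n) (alphaSupport 0 f)
  else extIntegral (volume.withDensity (weight α.toReal)) (alphaSupport α.toReal f)

end MinkSymm

end

/-!
The value `τ_u^α f x` is the supremum, attained when positive, of the `α`-means of `f y` and `f z`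
over the pairs with `x = ½ (y + R_u z)`. Monotonicity, symmetry and the statements on projections
and superlevel sets are read off from this formula, and `α`-concavity makes symmetric functions
fixed points. The `α`-support function of the symmetral is the average of `h_f` and `h_f ∘ R_u`, so
the mean width is preserved because its weight is rotation invariant.

The mass inequality is the Borell–Brascamp–Lieb inequality for `f`, `f ∘ R_u` and `τ_u^α f`. In the
equality case `α = 0`, equality in the Prékopa–Leindler inequality passes to the marginals in every
direction, where comparing quantile functions shows that the marginals of `f` and `f ∘ R_u` are
translates of each other. Comparing barycenters, the translations depend linearly on the direction,
so `f` and `f ∘ R_u` are translates almost everywhere, hence everywhere, since semicontinuous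
log-concave functions with full-dimensional support are determined almost everywhere.
-/

noncomputable section

namespace MinkSymm

local notation:max "midMean" α:max => alphaMean α 2⁻¹ 2⁻¹

variable {n : ℕ}

/-! ### Properties of `α`-means -/

section Means

variable {α β : EReal} {s t : ℝ≥0} {a b c d : ℝ≥0∞}

@[simp] lemma alphaMean_bot (s t : ℝ≥0) (a b : ℝ≥0∞) : alphaMean ⊥ s t a b = min a b := by
  simp [alphaMean]

@[simp] lemma alphaMean_top (s t : ℝ≥0) (a b : ℝ≥0∞) : alphaMean ⊤ s t a b = max a b := by
  simp [alphaMean]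

lemma alphaMean_zero (s t : ℝ≥0) (a b : ℝ≥0∞) :
    alphaMean 0 s t a b = a ^ (s : ℝ) * b ^ (t : ℝ) := by
  simp [alphaMean]

lemma alphaMean_coe {p : ℝ} (hp : p ≠ 0) (s t : ℝ≥0) (a b : ℝ≥0∞) :
    alphaMean p s t a b = (s * a ^ p + t * b ^ p) ^ p⁻¹ := by
  simp [alphaMean, hp]

lemma exponent_cases {P : EReal → Prop} (α : EReal) (hbot : P ⊥) (htop : P ⊤) (hzero : P 0)
    (hcoe : ∀ p : ℝ, p ≠ 0 → P p) : P α := by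
  induction α with
  | bot => exact hbot
  | top => exact htop
  | coe p =>
    rcases eq_or_ne p 0 with rfl | hp
    · exact hzero
    · exact hcoe p hp

lemma alphaMean_comm (α : EReal) (s t : ℝ≥0) (a b : ℝ≥0∞) :
    alphaMean α s t a b = alphaMean α t s b a := by
  induction α using exponent_cases with
  | hbot => simp [min_comm]
  | htop => simp [max_comm]
  | hzero => simp [alphaMean_zero, mul_comm]
  | hcoe p hp => simp [alphaMean_coe hp, add_comm]

lemma alphaMean_self (α : EReal) (hst : s + t = 1) (a : ℝ≥0∞) : alphaMean α s t a a = a := by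
  induction α using exponent_cases with
  | hbot => simp
  | htop => simp
  | hzero =>
    rw [alphaMean_zero, ← ENNReal.rpow_add_of_nonneg _ _ s.coe_nonneg t.coe_nonneg,
      ← NNReal.coe_add, hst, NNReal.coe_one, ENNReal.rpow_one]
  | hcoe p hp =>
    rw [alphaMean_coe hp, ← add_mul, ← ENNReal.coe_add, hst, ENNReal.coe_one, one_mul,
      ENNReal.rpow_rpow_inv hp]

lemma rpow_le_rpow_of_exponent_nonpos {p : ℝ} (hp : p ≤ 0) (h : a ≤ b) : b ^ p ≤ a ^ p := by
  rw [← neg_neg p, ENNReal.rpow_neg _ (-p), ENNReal.rpow_neg _ (-p), ENNReal.inv_le_inv]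
  exact ENNReal.rpow_le_rpow h (neg_nonneg.2 hp)

lemma alphaMean_mono (α : EReal) (s t : ℝ≥0) (hac : a ≤ c) (hbd : b ≤ d) :
    alphaMean α s t a b ≤ alphaMean α s t c d := by
  induction α using exponent_cases with
  | hbot => simpa using ⟨.inl hac, .inr hbd⟩
  | htop => simpa only [alphaMean_top] using max_le_max hac hbd
  | hzero => rw [alphaMean_zero, alphaMean_zero]; gcongr
  | hcoe p hp =>
    rw [alphaMean_coe hp, alphaMean_coe hp]
    rcases lt_or_gt_of_ne hp with h | h
    · refine rpow_le_rpow_of_exponent_nonpos (inv_nonpos.2 h.le) ?_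
      exact add_le_add (mul_le_mul_right (rpow_le_rpow_of_exponent_nonpos h.le hac) _)
        (mul_le_mul_right (rpow_le_rpow_of_exponent_nonpos h.le hbd) _)
    · gcongr

lemma alphaMean_medial (α : EReal) (s t : ℝ≥0) (a b c d : ℝ≥0∞) :
    alphaMean α s t (alphaMean α s t a b) (alphaMean α s t c d) =
      alphaMean α s t (alphaMean α s t a c) (alphaMean α s t b d) := by
  induction α using exponent_cases with
  | hbot => simp only [alphaMean_bot]; exact min_min_min_comm ..
  | htop => simp only [alphaMean_top]; exact max_max_max_comm ..
  | hzero =>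
    simp only [alphaMean_zero, ENNReal.mul_rpow_of_nonneg _ _ s.coe_nonneg,
      ENNReal.mul_rpow_of_nonneg _ _ t.coe_nonneg, ← ENNReal.rpow_mul, mul_comm (t : ℝ) s]
    ring
  | hcoe p hp =>
    simp only [alphaMean_coe hp, ENNReal.rpow_inv_rpow hp]
    congr 1
    ring

lemma le_alphaMean (α : EReal) (hst : s + t = 1) (ha : c ≤ a) (hb : c ≤ b) :
    c ≤ alphaMean α s t a b :=
  (alphaMean_self α hst c).symm.trans_le (alphaMean_mono α s t ha hb)

lemma alphaMean_le (α : EReal) (hst : s + t = 1) (ha : a ≤ c) (hb : b ≤ c) :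
    alphaMean α s t a b ≤ c :=
  (alphaMean_mono α s t ha hb).trans_eq (alphaMean_self α hst c)

lemma alphaMean_pos (α : EReal) (hst : s + t = 1) (ha : 0 < a) (hb : 0 < b) :
    0 < alphaMean α s t a b :=
  (lt_min ha hb).trans_le (le_alphaMean α hst (min_le_left _ _) (min_le_right _ _))

lemma alphaMean_lt_top (α : EReal) (hst : s + t = 1) (ha : a < ∞) (hb : b < ∞) :
    alphaMean α s t a b < ∞ :=
  (alphaMean_le α hst (le_max_left _ _) (le_max_right _ _)).trans_lt (max_lt ha hb)

lemma continuousAt_alphaMean (α : EReal) (s t : ℝ≥0) (ha : a ≠ 0 ∨ b ≠ ∞)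
    (hb : b ≠ 0 ∨ a ≠ ∞) :
    ContinuousAt (fun q : ℝ≥0∞ × ℝ≥0∞ => alphaMean α s t q.1 q.2) (a, b) := by
  have hfst (r : ℝ) : Continuous fun q : ℝ≥0∞ × ℝ≥0∞ => q.1 ^ r :=
    ENNReal.continuous_rpow_const.comp continuous_fst
  have hsnd (r : ℝ) : Continuous fun q : ℝ≥0∞ × ℝ≥0∞ => q.2 ^ r :=
    ENNReal.continuous_rpow_const.comp continuous_snd
  induction α using exponent_cases with
  | hbot => simp only [alphaMean_bot]; fun_prop
  | htop => simp only [alphaMean_top]; fun_prop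
  | hzero =>
    have hzero {c : ℝ≥0∞} (r : ℝ≥0) (hc : c ≠ 0) : c ^ (r : ℝ) ≠ 0 := by
      simp [ENNReal.rpow_eq_zero_iff, hc]
    have htop {c : ℝ≥0∞} (r : ℝ≥0) (hc : c ≠ ∞) : c ^ (r : ℝ) ≠ ∞ :=
      ENNReal.rpow_ne_top_of_nonneg r.coe_nonneg hc
    simp only [alphaMean_zero]
    exact ENNReal.Tendsto.mul (hfst s).continuousAt (ha.imp (hzero s) (htop t))
      (hsnd t).continuousAt (hb.imp (hzero t) (htop s))
  | hcoe p hp =>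
    simp only [alphaMean_coe hp]
    exact (ENNReal.continuous_rpow_const.comp
      (((ENNReal.continuous_const_mul ENNReal.coe_ne_top).comp (hfst p)).add
        ((ENNReal.continuous_const_mul ENNReal.coe_ne_top).comp (hsnd p)))).continuousAt

lemma alphaMean_mul (α : EReal) (hst : s + t = 1) {r : ℝ≥0∞} (hr : r ≠ ∞) (a b : ℝ≥0∞) :
    alphaMean α s t (r * a) (r * b) = r * alphaMean α s t a b := by
  rcases eq_or_ne r 0 with rfl | hr0
  · simp [alphaMean_self α hst]
  have hmul {r : ℝ≥0∞} (hr0 : r ≠ 0) (hr : r ≠ ∞) (c : ℝ≥0∞) (p : ℝ) :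
      (r * c) ^ p = r ^ p * c ^ p := by
    simp [ENNReal.mul_rpow_eq_ite, hr0, hr]
  induction α using exponent_cases with
  | hbot => simp [mul_min]
  | htop => simp [mul_max]
  | hzero =>
    have hsum : r ^ (s : ℝ) * r ^ (t : ℝ) = r := by
      rw [← alphaMean_zero, alphaMean_self 0 hst]
    rw [alphaMean_zero, alphaMean_zero, hmul hr0 hr, hmul hr0 hr, mul_mul_mul_comm, hsum]
  | hcoe p hp =>
    rw [alphaMean_coe hp, alphaMean_coe hp, hmul hr0 hr, hmul hr0 hr, mul_left_comm,
      mul_left_comm (t : ℝ≥0∞), ← mul_add, hmul (by simp [hr0, hr]) (by simp [hr0, hr]),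
      ENNReal.rpow_rpow_inv hp]

lemma alphaMean_zero_left (hα : α ≤ 0) (hs : s ≠ 0) (t : ℝ≥0) (b : ℝ≥0∞) :
    alphaMean α s t 0 b = 0 := by
  induction α using exponent_cases with
  | hbot => simp
  | htop => simp at hα
  | hzero => simp [alphaMean_zero, pos_iff_ne_zero.2 hs]
  | hcoe p hp =>
    have hp' : p < 0 := lt_of_le_of_ne (EReal.coe_nonpos.1 hα) hp
    rw [alphaMean_coe hp, ENNReal.zero_rpow_of_neg hp', ENNReal.mul_top (by simpa using hs),
      top_add, ENNReal.top_rpow_of_neg (inv_lt_zero.2 hp')]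

lemma alphaMean_zero_right (hα : α ≤ 0) (ht : t ≠ 0) (s : ℝ≥0) (a : ℝ≥0∞) :
    alphaMean α s t a 0 = 0 := by
  rw [alphaMean_comm, alphaMean_zero_left hα ht]

lemma alphaMean_pos_left (hα : 0 < α) (hs : s ≠ 0) (t : ℝ≥0) (ha : 0 < a) (ha' : a ≠ ∞) :
    0 < alphaMean α s t a 0 := by
  induction α using exponent_cases with
  | hbot => simp at hα
  | htop => simpa using ha
  | hzero => simp at hα
  | hcoe p hp =>
    have hp' : 0 < p := EReal.coe_pos.1 hα
    rw [alphaMean_coe hp, ENNReal.zero_rpow_of_pos hp', mul_zero, add_zero]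
    refine ENNReal.rpow_pos ?_ (by finiteness)
    exact ENNReal.mul_pos (by simpa using hs) (ENNReal.rpow_pos ha ha').ne'

lemma exists_le_of_le_alphaMean (hα : α ≤ 0) (hs : s ≠ 0) (ht : t ≠ 0) {C r : ℝ≥0∞}
    (hC : C ≠ ∞) (hr : 0 < r) :
    ∃ δ > 0, ∀ a b, a ≤ C → b ≤ C → r ≤ alphaMean α s t a b → δ ≤ a ∧ δ ≤ b := by
  have hleft : ∀ᶠ a in 𝓝 (0 : ℝ≥0∞), alphaMean α s t a C < r := by
    have hcont : ContinuousAt (fun a : ℝ≥0∞ => alphaMean α s t a C) 0 :=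
      (continuousAt_alphaMean α s t (.inr hC) (.inr ENNReal.zero_ne_top)).comp
        (f := fun a : ℝ≥0∞ => (a, C)) (by fun_prop)
    exact hcont.eventually_lt continuousAt_const (by rwa [alphaMean_zero_left hα hs])
  have hright : ∀ᶠ b in 𝓝 (0 : ℝ≥0∞), alphaMean α s t C b < r := by
    have hcont : ContinuousAt (fun b : ℝ≥0∞ => alphaMean α s t C b) 0 :=
      (continuousAt_alphaMean α s t (.inr ENNReal.zero_ne_top) (.inr hC)).comp
        (f := fun b : ℝ≥0∞ => (C, b)) (by fun_prop)
    exact hcont.eventually_lt continuousAt_const (by rwa [alphaMean_zero_right hα ht])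
  obtain ⟨δ, hδ, hlt⟩ := (ENNReal.nhds_zero_basis.eventually_iff).1 (hleft.and hright)
  refine ⟨δ, hδ, fun a b ha hb h => ⟨?_, ?_⟩⟩ <;> by_contra! hδ'
  · exact (h.trans (alphaMean_mono α s t le_rfl hb)).not_gt (hlt hδ').1
  · exact (h.trans (alphaMean_mono α s t ha le_rfl)).not_gt (hlt hδ').2

lemma geom_mean_le_arith_mean (hst : s + t = 1) (a b : ℝ≥0∞) :
    a ^ (s : ℝ) * b ^ (t : ℝ) ≤ s * a + t * b := by
  rcases eq_or_ne s 0 with rfl | hs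
  · simp_all
  rcases eq_or_ne t 0 with rfl | ht
  · simp_all
  induction a with
  | top => simp [ENNReal.mul_top, hs]
  | coe a =>
    induction b with
    | top => simp [ENNReal.mul_top, ht]
    | coe b =>
      simpa [← ENNReal.coe_rpow_of_nonneg] using
        ENNReal.coe_le_coe.2 (NNReal.geom_mean_le_arith_mean2_weighted s t a b hst)

lemma alphaMean_iSup_le (hα : α ≤ 0) (hs : s ≠ 0) (ht : t ≠ 0) {A B : ℕ → ℝ≥0∞}
    (hA : Monotone A) (hB : Monotone B) :
    alphaMean α s t (⨆ k, A k) (⨆ k, B k) ≤ ⨆ k, alphaMean α s t (A k) (B k) := by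
  rcases eq_or_ne (⨆ k, A k) 0 with hA0 | hA0
  · simp [hA0, alphaMean_zero_left hα hs]
  rcases eq_or_ne (⨆ k, B k) 0 with hB0 | hB0
  · simp [hB0, alphaMean_zero_right hα ht]
  have hlim := (continuousAt_alphaMean α s t (.inl hA0) (.inl hB0)).tendsto.comp
    ((tendsto_atTop_iSup hA).prodMk_nhds (tendsto_atTop_iSup hB))
  exact le_of_tendsto' hlim fun k => le_iSup (fun k => alphaMean α s t (A k) (B k)) k

/-! The means increase with the exponent: for exponents `≥ 0` this is Jensen's inequality, and
inverting the arguments exchanges the signs of the exponents. -/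

lemma alphaMean_mono_exponent_of_nonneg (hα : 0 ≤ α) (hαβ : α ≤ β) (hst : s + t = 1)
    (a b : ℝ≥0∞) : alphaMean α s t a b ≤ alphaMean β s t a b := by
  induction β using exponent_cases with
  | hbot => simp [le_bot_iff.1 hαβ]
  | htop => exact alphaMean_le α hst (by simp) (by simp)
  | hzero => rw [le_antisymm hαβ hα]
  | hcoe q hq =>
    have hq' : 0 < q := lt_of_le_of_ne (EReal.coe_nonneg.1 (hα.trans hαβ)) hq.symm
    rw [alphaMean_coe hq, ENNReal.le_rpow_inv_iff hq']
    induction α using exponent_cases with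
    | hbot => simp at hα
    | htop => simp at hαβ
    | hzero =>
      rw [alphaMean_zero, ENNReal.mul_rpow_of_nonneg _ _ hq'.le]
      simpa only [← ENNReal.rpow_mul, mul_comm q] using
        geom_mean_le_arith_mean hst (a ^ q) (b ^ q)
    | hcoe p hp =>
      have hp' : 0 < p := lt_of_le_of_ne (EReal.coe_nonneg.1 hα) hp.symm
      have h := ENNReal.rpow_arith_mean_le_arith_mean2_rpow s t (a ^ p) (b ^ p)
        (mod_cast hst) ((one_le_div hp').2 (EReal.coe_le_coe_iff.1 hαβ))
      rw [alphaMean_coe hp, ← ENNReal.rpow_mul, inv_mul_eq_div]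
      simpa only [← ENNReal.rpow_mul, mul_div_cancel₀ q hp] using h

lemma alphaMean_neg (α : EReal) (s t : ℝ≥0) (ha : a ≠ ∞) (hb : b ≠ ∞) :
    alphaMean (-α) s t a b = (alphaMean α s t a⁻¹ b⁻¹)⁻¹ := by
  induction α using exponent_cases with
  | hbot => rcases le_total a b with h | h <;> simp [h, ENNReal.inv_le_inv.2 h]
  | htop => rcases le_total a b with h | h <;> simp [h, ENNReal.inv_le_inv.2 h]
  | hzero =>
    rw [neg_zero, alphaMean_zero, alphaMean_zero, ENNReal.inv_rpow, ENNReal.inv_rpow,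
      ENNReal.mul_inv, inv_inv, inv_inv]
    · exact .inl (ENNReal.inv_ne_zero.2 (ENNReal.rpow_ne_top_of_nonneg s.coe_nonneg ha))
    · exact .inr (ENNReal.inv_ne_zero.2 (ENNReal.rpow_ne_top_of_nonneg t.coe_nonneg hb))
  | hcoe p hp =>
    rw [← EReal.coe_neg, alphaMean_coe (neg_ne_zero.2 hp), alphaMean_coe hp, inv_neg,
      ENNReal.rpow_neg]
    simp only [ENNReal.inv_rpow, ENNReal.rpow_neg]

lemma alphaMean_mono_exponent (hαβ : α ≤ β) (hst : s + t = 1) (ha : a ≠ ∞) (hb : b ≠ ∞) :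
    alphaMean α s t a b ≤ alphaMean β s t a b := by
  have of_nonpos {α β : EReal} (hβ : β ≤ 0) (hαβ : α ≤ β) :
      alphaMean α s t a b ≤ alphaMean β s t a b := by
    rw [← neg_neg α, ← neg_neg β, alphaMean_neg _ _ _ ha hb, alphaMean_neg _ _ _ ha hb,
      ENNReal.inv_le_inv]
    exact alphaMean_mono_exponent_of_nonneg (EReal.neg_nonneg.2 hβ) (EReal.neg_le_neg_iff.2 hαβ)
      hst _ _
  rcases le_total 0 α with hα | hα
  · exact alphaMean_mono_exponent_of_nonneg hα hαβ hst a b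
  rcases le_total 0 β with hβ | hβ
  · exact (of_nonpos le_rfl hα).trans (alphaMean_mono_exponent_of_nonneg le_rfl hβ hst a b)
  · exact of_nonpos hβ hαβ

end Means

/-! ### The Brunn–Minkowski and Borell–Brascamp–Lieb inequalities -/

section BrunnMinkowski

lemma volume_vadd_smul (c : ℝ) (s : ℝ≥0) (A : Set ℝ) :
    volume (c +ᵥ (s : ℝ) • A) = s * volume A := by
  simp [measure_vadd, Measure.addHaar_smul]

lemma brunn_minkowski_of_isCompact (s t : ℝ≥0) {A B : Set ℝ} (hA : IsCompact A)
    (hB : IsCompact B) (hA0 : A.Nonempty) (hB0 : B.Nonempty) :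
    s * volume A + t * volume B ≤ volume ((s : ℝ) • A + (t : ℝ) • B) := by
  obtain ⟨a₀, ha₀, ha⟩ := hA.exists_isGreatest hA0
  obtain ⟨b₀, hb₀, hb⟩ := hB.exists_isLeast hB0
  rw [← volume_vadd_smul (t * b₀) s A, ← volume_vadd_smul (s * a₀) t B]
  have hdisj : AEDisjoint volume ((t * b₀) +ᵥ (s : ℝ) • A) ((s * a₀) +ᵥ (t : ℝ) • B) := by
    refine measure_mono_null (t := {s * a₀ + t * b₀}) ?_ (by simp)
    rintro _ ⟨⟨_, ⟨a, haA, rfl⟩, rfl⟩, ⟨_, ⟨b, hbB, rfl⟩, hab⟩⟩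
    simp only [vadd_eq_add, smul_eq_mul, mem_singleton_iff] at hab ⊢
    have h1 := mul_le_mul_of_nonneg_left (ha haA) s.coe_nonneg
    have h2 := mul_le_mul_of_nonneg_left (hb hbB) t.coe_nonneg
    linarith
  have hmeas : MeasurableSet ((s * a₀) +ᵥ (t : ℝ) • B) :=
    ((hB.smul (t : ℝ)).vadd (s * a₀)).isClosed.measurableSet
  rw [← measure_union₀ hmeas.nullMeasurableSet hdisj]
  refine measure_mono (union_subset ?_ ?_)
  · rintro _ ⟨_, hx, rfl⟩
    simpa [add_comm] using add_mem_add hx (smul_mem_smul_set (a := (t : ℝ)) hb₀)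
  · rintro _ ⟨_, hx, rfl⟩
    exact add_mem_add (smul_mem_smul_set ha₀) hx

lemma mul_measure_add_le_of_isCompact {A : Set ℝ} (hA : MeasurableSet A) (hA0 : A.Nonempty)
    {c d e : ℝ≥0∞} (h : ∀ K ⊆ A, IsCompact K → K.Nonempty → c * volume K + d ≤ e) :
    c * volume A + d ≤ e := by
  obtain ⟨a, ha⟩ := hA0
  rw [hA.measure_eq_iSup_isCompact, ENNReal.mul_iSup, ENNReal.iSup_add]
  refine iSup_le fun K => ?_
  by_cases hK : K ⊆ A ∧ IsCompact K
  · rw [iSup_pos hK.1, iSup_pos hK.2]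
    refine le_trans ?_
      (h (insert a K) (insert_subset ha hK.1) (hK.2.insert a) (insert_nonempty a K))
    gcongr
    exact subset_insert a K
  · have hzero : (⨆ (_ : K ⊆ A) (_ : IsCompact K), volume K) = 0 := by
      simp only [← bot_eq_zero, iSup_eq_bot]
      exact fun hKA hKc => absurd ⟨hKA, hKc⟩ hK
    rw [hzero]
    refine le_trans ?_ (h {a} (by simpa) isCompact_singleton (singleton_nonempty a))
    gcongr
    exact zero_le

lemma brunn_minkowski (s t : ℝ≥0) {A B : Set ℝ} (hA : MeasurableSet A) (hB : MeasurableSet B)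
    (hA0 : A.Nonempty) (hB0 : B.Nonempty) :
    s * volume A + t * volume B ≤ volume ((s : ℝ) • A + (t : ℝ) • B) := by
  refine mul_measure_add_le_of_isCompact hA hA0 fun K hKA hK hK0 => ?_
  rw [add_comm]
  refine mul_measure_add_le_of_isCompact hB hB0 fun L hLB hL hL0 => ?_
  rw [add_comm]
  exact (brunn_minkowski_of_isCompact s t hK hL hK0 hL0).trans
    (measure_mono (add_subset_add (smul_set_mono hKA) (smul_set_mono hLB)))

end BrunnMinkowski

lemma lintegral_eq_setLIntegral_Ioo_meas_lt {X : Type*} [MeasurableSpace X] (μ : Measure X)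
    {f : X → ℝ≥0∞} (hf : Measurable f) (hf1 : ∀ x, f x ≤ 1) :
    ∫⁻ x, f x ∂μ = ∫⁻ τ in Ioo (0 : ℝ) 1, μ {x | ENNReal.ofReal τ < f x} := by
  have hfin (x : X) : f x ≠ ∞ := ((hf1 x).trans_lt ENNReal.one_lt_top).ne
  calc ∫⁻ x, f x ∂μ = ∫⁻ x, ENNReal.ofReal (f x).toReal ∂μ := by
        simp only [ENNReal.ofReal_toReal (hfin _)]
    _ = ∫⁻ τ in Ioi (0 : ℝ), μ {x | τ < (f x).toReal} :=
        lintegral_eq_lintegral_meas_lt μ (ae_of_all _ fun x => ENNReal.toReal_nonneg)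
          hf.ennreal_toReal.aemeasurable
    _ = ∫⁻ τ in Ioi (0 : ℝ), μ {x | ENNReal.ofReal τ < f x} := by
        refine setLIntegral_congr_fun measurableSet_Ioi fun τ hτ => ?_
        simp only [ENNReal.ofReal_lt_iff_lt_toReal (le_of_lt hτ) (hfin _)]
    _ = ∫⁻ τ in Ioo (0 : ℝ) 1, μ {x | ENNReal.ofReal τ < f x} := by
        rw [← Iio_inter_Ioi, ← Measure.restrict_restrict measurableSet_Iio]
        refine (setLIntegral_eq_of_support_subset fun τ hτ => ?_).symm
        obtain ⟨x, hx⟩ := nonempty_of_measure_ne_zero hτ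
        exact ENNReal.ofReal_lt_one.1 (lt_of_lt_of_le hx (hf1 x))

section Line

variable {s t : ℝ≥0} {f g h : ℝ → ℝ≥0∞}

lemma lintegral_le_of_min_le_of_iSup_eq_one (hf : Measurable f) (hg : Measurable g)
    (hh : Measurable h) (hf1 : ⨆ x, f x = 1) (hg1 : ⨆ x, g x = 1)
    (hle : ∀ x y, min (f x) (g y) ≤ h ((s : ℝ) • x + (t : ℝ) • y)) :
    s * (∫⁻ x, f x) + t * (∫⁻ x, g x) ≤ ∫⁻ x, h x := by
  have hmeas (F : ℝ → ℝ≥0∞) : Measurable fun τ : ℝ => volume {x | ENNReal.ofReal τ < F x} :=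
    Antitone.measurable fun σ τ hστ =>
      measure_mono fun x hx => (ENNReal.ofReal_le_ofReal hστ).trans_lt hx
  have hne {F : ℝ → ℝ≥0∞} (hF : ⨆ x, F x = 1) {τ : ℝ} (hτ : τ < 1) :
      {x | ENNReal.ofReal τ < F x}.Nonempty :=
    nonempty_def.2 (lt_iSup_iff.1 (by rwa [hF, ENNReal.ofReal_lt_one]))
  have hf1' (x : ℝ) : f x ≤ 1 := hf1 ▸ le_iSup f x
  calc s * (∫⁻ x, f x) + t * (∫⁻ x, g x)
      = ∫⁻ τ in Ioo (0 : ℝ) 1, (s * volume {x | ENNReal.ofReal τ < f x} +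
        t * volume {x | ENNReal.ofReal τ < g x}) := by
        rw [lintegral_add_left ((hmeas f).const_mul _), lintegral_const_mul _ (hmeas f),
          lintegral_const_mul _ (hmeas g), lintegral_eq_setLIntegral_Ioo_meas_lt _ hf hf1',
          lintegral_eq_setLIntegral_Ioo_meas_lt _ hg fun x => hg1 ▸ le_iSup g x]
    _ ≤ ∫⁻ τ in Ioo (0 : ℝ) 1, volume {x | ENNReal.ofReal τ < min (h x) 1} := by
        refine setLIntegral_mono' measurableSet_Ioo fun τ hτ => ?_
        refine (brunn_minkowski s t (measurableSet_lt measurable_const hf)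
          (measurableSet_lt measurable_const hg) (hne hf1 hτ.2) (hne hg1 hτ.2)).trans
          (measure_mono ?_)
        rintro _ ⟨_, ⟨x, hx, rfl⟩, _, ⟨y, hy, rfl⟩, rfl⟩
        exact (lt_min hx hy).trans_le (le_min (hle x y) ((min_le_left _ _).trans (hf1' x)))
    _ = ∫⁻ x, min (h x) 1 :=
        (lintegral_eq_setLIntegral_Ioo_meas_lt _ (by fun_prop) fun x => min_le_right _ _).symm
    _ ≤ ∫⁻ x, h x := lintegral_mono fun x => min_le_left _ _

lemma mul_lintegral_le_of_mul_min_le (hf : Measurable f) (hg : Measurable g) (hh : Measurable h)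
    {m : ℝ≥0∞} (hm : m ≠ ∞) (hf0 : ⨆ x, f x ≠ 0) (hf' : ⨆ x, f x ≠ ∞) (hg0 : ⨆ x, g x ≠ 0)
    (hg' : ⨆ x, g x ≠ ∞)
    (hle : ∀ x y, m * min (f x / ⨆ z, f z) (g y / ⨆ z, g z) ≤ h ((s : ℝ) • x + (t : ℝ) • y)) :
    m * (s * ((∫⁻ x, f x) / ⨆ z, f z) + t * ((∫⁻ x, g x) / ⨆ z, g z)) ≤ ∫⁻ x, h x := by
  rcases eq_or_ne m 0 with rfl | hm0
  · simp
  have hnorm := lintegral_le_of_min_le_of_iSup_eq_one (f := fun x => f x / ⨆ z, f z)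
    (g := fun x => g x / ⨆ z, g z) (h := fun x => h x / m)
    (by fun_prop) (by fun_prop) (by fun_prop)
    (by rw [← ENNReal.iSup_div, ENNReal.div_self hf0 hf'])
    (by rw [← ENNReal.iSup_div, ENNReal.div_self hg0 hg'])
    (fun x y => by
      rw [ENNReal.le_div_iff_mul_le (.inl hm0) (.inl hm), mul_comm]
      exact hle x y)
  simp only [div_eq_mul_inv] at hnorm ⊢
  rwa [lintegral_mul_const _ hf, lintegral_mul_const _ hg, lintegral_mul_const _ hh,
    ← div_eq_mul_inv (∫⁻ x, h x), ENNReal.le_div_iff_mul_le (.inl hm0) (.inl hm), mul_comm] at hnorm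

end Line

/-- The exponent `p / (1 + n p)` of the mean satisfied by the marginals, over `n` variables, of a
`p`-concave function, read as `-∞` at `p = -1/n`. -/
def marginalExponent (n : ℕ) (p : ℝ) : EReal :=
  if 1 + n * p = 0 then ⊥ else ((p / (1 + n * p) : ℝ) : EReal)

lemma marginalExponent_nonpos {p : ℝ} (hp : p ≤ 0) (hnp : 0 ≤ 1 + n * p) :
    marginalExponent n p ≤ 0 := by
  rw [marginalExponent]
  split_ifs
  · exact bot_le
  · exact EReal.coe_nonpos.2 (div_nonpos_of_nonpos_of_nonneg hp hnp)

lemma marginalExponent_one_div {p : ℝ} (hnp : 1 + n * p ≠ 0) :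
    marginalExponent 1 (p / (1 + n * p)) = marginalExponent (n + 1) p := by
  have hadd : 1 + p / (1 + n * p) = (1 + (n + 1) * p) / (1 + n * p) := by
    rw [eq_div_iff hnp, add_mul, div_mul_cancel₀ _ hnp]
    ring
  simp only [marginalExponent, Nat.cast_one, one_mul, hadd, div_eq_zero_iff, hnp, or_false,
    Nat.cast_add]
  rw [div_div_div_cancel_right₀ hnp]

section Holder

variable {p : ℝ} {s t : ℝ≥0}

lemma coe_mul_rpow {c : ℝ≥0} (hc : c ≠ 0) (q : ℝ) (Z : ℝ≥0∞) :
    (c * Z) ^ q = (c ^ q : ℝ≥0) * Z ^ q := by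
  simp [ENNReal.mul_rpow_eq_ite, hc, ENNReal.coe_rpow_of_ne_zero]

lemma alphaMean_mul_weights (hp0 : p ≠ 0) {c : ℝ≥0} (hc : c ≠ 0) (a b : ℝ≥0∞) :
    alphaMean p (c * s) (c * t) a b = (c ^ p⁻¹ : ℝ≥0) * alphaMean p s t a b := by
  rw [alphaMean_coe hp0, alphaMean_coe hp0, ENNReal.coe_mul, ENNReal.coe_mul, mul_assoc, mul_assoc,
    ← mul_add, coe_mul_rpow hc]

lemma alphaMean_le_rpow_mul_add (hp0 : p ≠ 0) (hp1 : p ≤ 1) (hst : s + t ≠ 0) {a b : ℝ≥0∞}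
    (ha : a ≠ ∞) (hb : b ≠ ∞) :
    alphaMean p s t a b ≤ ((s + t) ^ (p⁻¹ - 1) : ℝ≥0) * (s * a + t * b) := by
  have hweights : s / (s + t) + t / (s + t) = 1 := by rw [← add_div, div_self hst]
  have hnormalize (q : ℝ) (hq : q ≠ 0) : alphaMean q s t a b =
      ((s + t) ^ q⁻¹ : ℝ≥0) * alphaMean q (s / (s + t)) (t / (s + t)) a b := by
    rw [← alphaMean_mul_weights hq hst, mul_div_cancel₀ _ hst, mul_div_cancel₀ _ hst]
  calc alphaMean p s t a b
      ≤ ((s + t) ^ p⁻¹ : ℝ≥0) * alphaMean (1 : ℝ) (s / (s + t)) (t / (s + t)) a b := by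
        rw [hnormalize p hp0]
        gcongr
        exact alphaMean_mono_exponent (mod_cast hp1) hweights ha hb
    _ = ((s + t) ^ (p⁻¹ - 1) : ℝ≥0) * alphaMean (1 : ℝ) s t a b := by
        rw [hnormalize 1 one_ne_zero, ← mul_assoc, ← ENNReal.coe_mul, inv_one,
          ← NNReal.rpow_add hst, sub_add_cancel]
    _ = ((s + t) ^ (p⁻¹ - 1) : ℝ≥0) * (s * a + t * b) := by
        rw [alphaMean_coe one_ne_zero, inv_one]
        simp only [ENNReal.rpow_one]

-- With `q = p / (1 + p)` and the weights `σ = s a ^ p`, `τ = t b ^ p`, the left-hand side is the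
-- mean of exponent `q ≤ 1` of `a ^ (-p) X` and `b ^ (-p) Y`, and `alphaMean p s t a b` is
-- `(σ + τ) ^ (q⁻¹ - 1)`.
lemma alphaMean_div_one_add_mul_le (hp : -1 < p) (hp0 : p ≠ 0) (hst : s + t = 1)
    {a b : ℝ≥0} (ha : a ≠ 0) (hb : b ≠ 0) {X Y : ℝ≥0∞} (hX : X ≠ ∞) (hY : Y ≠ ∞) :
    alphaMean (p / (1 + p) : ℝ) s t (a * X) (b * Y) ≤
      alphaMean p s t a b * (s * X + t * Y) := by
  have hp1 : 1 + p ≠ 0 := by linarith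
  set q : ℝ := p / (1 + p) with hq
  have hq0 : q ≠ 0 := div_ne_zero hp0 hp1
  have hqle : q ≤ 1 := (div_le_one (by linarith)).2 (by linarith)
  have hpq : p + -p * q = q := by rw [hq]; field_simp; ring
  have hqp : q⁻¹ - 1 = p⁻¹ := by rw [hq]; field_simp; ring
  have hweights : s * a ^ p + t * b ^ p ≠ 0 := by
    have hst0 : ¬(s = 0 ∧ t = 0) := fun h => by simp [h] at hst
    rcases not_and_or.1 hst0 with h | h <;> simp [h, ha, hb]
  have hpow (r : ℝ≥0) {c : ℝ≥0} (hc : c ≠ 0) (Z : ℝ≥0∞) :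
      (r * c ^ p : ℝ≥0) * ((c ^ (-p) : ℝ≥0) * Z) ^ q = r * (c * Z) ^ q := by
    rw [coe_mul_rpow (by simp [hc]), coe_mul_rpow hc, ← mul_assoc, ← mul_assoc, ← ENNReal.coe_mul,
      ← ENNReal.coe_mul, mul_assoc r, ← NNReal.rpow_mul, ← NNReal.rpow_add hc, hpq]
  have hlin (r : ℝ≥0) {c : ℝ≥0} (hc : c ≠ 0) (Z : ℝ≥0∞) :
      (r * c ^ p : ℝ≥0) * ((c ^ (-p) : ℝ≥0) * Z) = r * Z := by
    rw [← mul_assoc, ← ENNReal.coe_mul, mul_assoc r, ← NNReal.rpow_add hc, add_neg_cancel,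
      NNReal.rpow_zero, mul_one]
  have hM : alphaMean p s t a b = ((s * a ^ p + t * b ^ p) ^ p⁻¹ : ℝ≥0) := by
    rw [alphaMean_coe hp0, ENNReal.coe_rpow_of_ne_zero hweights, ENNReal.coe_add, ENNReal.coe_mul,
      ENNReal.coe_mul, ENNReal.coe_rpow_of_ne_zero ha, ENNReal.coe_rpow_of_ne_zero hb]
  have hmean := alphaMean_le_rpow_mul_add hq0 hqle hweights
    (a := (a ^ (-p) : ℝ≥0) * X) (b := (b ^ (-p) : ℝ≥0) * Y) (by finiteness) (by finiteness)
  rwa [hlin s ha, hlin t hb, hqp, ← hM, alphaMean_coe hq0, hpow s ha, hpow t hb,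
    ← alphaMean_coe hq0] at hmean

lemma min_mul_le_harmonicMean_mul (hs : s ≠ 0) {a b : ℝ≥0} (ha : a ≠ 0) (hb : b ≠ 0)
    (X Y : ℝ≥0∞) :
    min (a * X) (b * Y) ≤ alphaMean (-1 : ℝ) s t a b * (s * X + t * Y) := by
  have hmean : alphaMean (-1 : ℝ) s t a b = (s * (a : ℝ≥0∞)⁻¹ + t * (b : ℝ≥0∞)⁻¹)⁻¹ := by
    rw [alphaMean_coe (by norm_num)]
    simp only [inv_neg, inv_one, ENNReal.rpow_neg_one]
  have hne : s * (a : ℝ≥0∞)⁻¹ + t * (b : ℝ≥0∞)⁻¹ ≠ 0 := by simp [hs]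
  have htop : s * (a : ℝ≥0∞)⁻¹ + t * (b : ℝ≥0∞)⁻¹ ≠ ∞ := by finiteness
  have hdiv {c : ℝ≥0} {Z : ℝ≥0∞} (hle : min (a * X) (b * Y) ≤ c * Z) :
      min (a * X) (b * Y) * (c : ℝ≥0∞)⁻¹ ≤ Z :=
    ENNReal.div_le_of_le_mul' hle
  rw [hmean, mul_comm _ (s * X + t * Y), ← div_eq_mul_inv,
    ENNReal.le_div_iff_mul_le (.inl hne) (.inl htop), mul_add, mul_left_comm,
    mul_left_comm _ (t : ℝ≥0∞)]
  exact add_le_add (mul_le_mul_right (hdiv (min_le_left _ _)) _)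
    (mul_le_mul_right (hdiv (min_le_right _ _)) _)

lemma alphaMean_marginalExponent_mul_le (hp : -1 ≤ p) (hst : s + t = 1)
    (hs : s ≠ 0) (ht : t ≠ 0) {a b : ℝ≥0∞} (ha0 : a ≠ 0) (ha : a ≠ ∞) (hb0 : b ≠ 0) (hb : b ≠ ∞)
    (X Y : ℝ≥0∞) :
    alphaMean (marginalExponent 1 p) s t (a * X) (b * Y) ≤
      alphaMean p s t a b * (s * X + t * Y) := by
  have hM : alphaMean p s t a b ≠ 0 :=
    (alphaMean_pos p hst (pos_iff_ne_zero.2 ha0) (pos_iff_ne_zero.2 hb0)).ne'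
  rcases eq_or_ne X ∞ with rfl | hX
  · simp [ENNReal.mul_top, hM, hs]
  rcases eq_or_ne Y ∞ with rfl | hY
  · simp [ENNReal.mul_top, hM, ht]
  lift a to ℝ≥0 using ha
  lift b to ℝ≥0 using hb
  simp only [ne_eq, ENNReal.coe_eq_zero] at ha0 hb0
  rcases hp.eq_or_lt with rfl | hp
  · have hexp : marginalExponent 1 (-1) = ⊥ := if_pos (by norm_num)
    rw [hexp, alphaMean_bot]
    exact min_mul_le_harmonicMean_mul hs ha0 hb0 X Y
  have hexp : marginalExponent 1 p = (p / (1 + p) : ℝ) := by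
    rw [marginalExponent, if_neg (by push_cast; linarith), Nat.cast_one, one_mul]
  rcases eq_or_ne p 0 with rfl | hp0
  · rw [hexp, add_zero, div_one, EReal.coe_zero, alphaMean_zero, alphaMean_zero, coe_mul_rpow ha0,
      coe_mul_rpow hb0, mul_mul_mul_comm, ENNReal.coe_rpow_of_ne_zero ha0,
      ENNReal.coe_rpow_of_ne_zero hb0]
    gcongr
    exact geom_mean_le_arith_mean hst X Y
  · rw [hexp]
    exact alphaMean_div_one_add_mul_le hp hp0 hst ha0 hb0 hX hY

end Holder

section BorellBrascampLieb

variable {p : ℝ} {s t : ℝ≥0}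

lemma lintegral_eq_iSup_lintegral_min_natCast {X : Type*} [MeasurableSpace X] (μ : Measure X)
    {f : X → ℝ≥0∞} (hf : Measurable f) :
    ∫⁻ x, f x ∂μ = ⨆ k : ℕ, ∫⁻ x, min (f x) k ∂μ := by
  rw [← lintegral_iSup (f := fun (k : ℕ) x => min (f x) k) (fun k => by fun_prop)
    fun i j hij x => min_le_min le_rfl (mod_cast hij)]
  simp only [← inf_iSup_eq, ENNReal.iSup_natCast, inf_top_eq]

lemma borell_brascamp_lieb_line_of_bounded (hp : -1 ≤ p) (hp0 : p ≤ 0) (hs : s ≠ 0) (ht : t ≠ 0)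
    (hst : s + t = 1) {f g h : ℝ → ℝ≥0∞} (hf : Measurable f) (hg : Measurable g)
    (hh : Measurable h) {C : ℝ≥0∞} (hC : C ≠ ∞) (hfC : ∀ x, f x ≤ C) (hgC : ∀ x, g x ≤ C)
    (hle : ∀ x y, alphaMean p s t (f x) (g y) ≤ h ((s : ℝ) • x + (t : ℝ) • y)) :
    alphaMean (marginalExponent 1 p) s t (∫⁻ x, f x) (∫⁻ x, g x) ≤ ∫⁻ x, h x := by
  have hexp : marginalExponent 1 p ≤ 0 := marginalExponent_nonpos hp0 (by norm_num; linarith)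
  have ha : ⨆ x, f x ≠ ∞ := ((iSup_le hfC).trans_lt hC.lt_top).ne
  have hb : ⨆ x, g x ≠ ∞ := ((iSup_le hgC).trans_lt hC.lt_top).ne
  by_cases ha0 : ⨆ x, f x = 0
  · simp [ENNReal.iSup_eq_zero.1 ha0, alphaMean_zero_left hexp hs]
  by_cases hb0 : ⨆ x, g x = 0
  · simp [ENNReal.iSup_eq_zero.1 hb0, alphaMean_zero_right hexp ht]
  have hholder := alphaMean_marginalExponent_mul_le hp hst hs ht ha0 ha hb0 hb
    ((∫⁻ x, f x) / ⨆ x, f x) ((∫⁻ x, g x) / ⨆ x, g x)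
  rw [ENNReal.mul_div_cancel ha0 ha, ENNReal.mul_div_cancel hb0 hb] at hholder
  refine hholder.trans (mul_lintegral_le_of_mul_min_le hf hg hh
    (alphaMean_lt_top p hst ha.lt_top hb.lt_top).ne ha0 ha hb0 hb fun x y => ?_)
  have hmin : min (f x / ⨆ z, f z) (g y / ⨆ z, g z) ≠ ∞ :=
    ((min_le_left _ _).trans_lt (ENNReal.div_lt_top ((hfC x).trans_lt hC.lt_top).ne ha0)).ne
  rw [mul_comm, ← alphaMean_mul p hst hmin]
  refine (alphaMean_mono p s t ?_ ?_).trans (hle x y)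
  · exact (mul_le_mul_left (min_le_left _ _) _).trans_eq (ENNReal.div_mul_cancel ha0 ha)
  · exact (mul_le_mul_left (min_le_right _ _) _).trans_eq (ENNReal.div_mul_cancel hb0 hb)

lemma borell_brascamp_lieb_line (hp : -1 ≤ p) (hp0 : p ≤ 0) (hs : s ≠ 0) (ht : t ≠ 0)
    (hst : s + t = 1) {f g h : ℝ → ℝ≥0∞} (hf : Measurable f) (hg : Measurable g)
    (hh : Measurable h)
    (hle : ∀ x y, alphaMean p s t (f x) (g y) ≤ h ((s : ℝ) • x + (t : ℝ) • y)) :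
    alphaMean (marginalExponent 1 p) s t (∫⁻ x, f x) (∫⁻ x, g x) ≤ ∫⁻ x, h x := by
  have hmono (F : ℝ → ℝ≥0∞) : Monotone fun k : ℕ => ∫⁻ x, min (F x) k := fun i j hij =>
    lintegral_mono fun x => min_le_min le_rfl (mod_cast hij)
  rw [lintegral_eq_iSup_lintegral_min_natCast _ hf, lintegral_eq_iSup_lintegral_min_natCast _ hg]
  refine (alphaMean_iSup_le (marginalExponent_nonpos hp0 (by norm_num; linarith)) hs ht
    (hmono f) (hmono g)).trans (iSup_le fun k => ?_)
  exact borell_brascamp_lieb_line_of_bounded hp hp0 hs ht hst (by fun_prop) (by fun_prop) hh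
    (ENNReal.natCast_ne_top k) (fun x => min_le_right _ _) (fun x => min_le_right _ _)
    fun x y => (alphaMean_mono p s t (min_le_left _ _) (min_le_left _ _)).trans (hle x y)

lemma lintegral_fin_succ {f : (Fin (n + 1) → ℝ) → ℝ≥0∞} (hf : Measurable f) :
    ∫⁻ x, f x = ∫⁻ r : ℝ, ∫⁻ y : Fin n → ℝ, f (Fin.cons r y) := by
  have hmp := (volume_preserving_piFinSuccAbove (fun _ : Fin (n + 1) => ℝ) 0).symm
  rw [← hmp.lintegral_comp hf, Measure.volume_eq_prod, lintegral_prod _ (by fun_prop)]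
  simp [MeasurableEquiv.piFinSuccAbove, Fin.insertNthEquiv]

lemma measurable_cons :
    Measurable fun q : ℝ × (Fin n → ℝ) => (Fin.cons q.1 q.2 : Fin (n + 1) → ℝ) := by
  refine measurable_pi_lambda _ (Fin.cases ?_ fun i => ?_)
  · simpa using measurable_fst
  · simpa [Function.comp_def] using (measurable_pi_apply i).comp measurable_snd

theorem borell_brascamp_lieb (hp0 : p ≤ 0) (hnp : 0 ≤ 1 + n * p) (hs : s ≠ 0) (ht : t ≠ 0)
    (hst : s + t = 1) {f g h : (Fin n → ℝ) → ℝ≥0∞} (hf : Measurable f) (hg : Measurable g)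
    (hh : Measurable h)
    (hle : ∀ x y, alphaMean p s t (f x) (g y) ≤ h ((s : ℝ) • x + (t : ℝ) • y)) :
    alphaMean (marginalExponent n p) s t (∫⁻ x, f x) (∫⁻ x, g x) ≤ ∫⁻ x, h x := by
  induction n with
  | zero =>
    simp only [lintegral_unique, volume_pi, Measure.pi_univ, Finset.univ_eq_empty,
      Finset.prod_empty, mul_one, marginalExponent, Nat.cast_zero, zero_mul, add_zero,
      one_ne_zero, if_false, div_one]
    convert hle default default
  | succ n ih =>
    push_cast at hnp
    have hn : 0 < 1 + n * p := by
      rcases hp0.eq_or_lt with rfl | hp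
      · simp
      · linarith
    have hexp : marginalExponent n p = (p / (1 + n * p) : ℝ) := if_neg hn.ne'
    rw [lintegral_fin_succ hf, lintegral_fin_succ hg, lintegral_fin_succ hh,
      ← marginalExponent_one_div hn.ne']
    have hmeas {F : (Fin (n + 1) → ℝ) → ℝ≥0∞} (hF : Measurable F) :
        Measurable fun r : ℝ => ∫⁻ y : Fin n → ℝ, F (Fin.cons r y) :=
      Measurable.lintegral_prod_right' (hF.comp measurable_cons)
    have hsec {F : (Fin (n + 1) → ℝ) → ℝ≥0∞} (hF : Measurable F) (r : ℝ) :
        Measurable fun y : Fin n → ℝ => F (Fin.cons r y) :=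
      hF.comp (measurable_cons.comp measurable_prodMk_left)
    refine borell_brascamp_lieb_line ?_ (div_nonpos_of_nonpos_of_nonneg hp0 hn.le) hs ht hst
      (hmeas hf) (hmeas hg) (hmeas hh) fun x y => ?_
    · rw [le_div_iff₀ hn]
      linarith
    rw [← hexp]
    refine ih hn.le (hsec hf _) (hsec hg _) (hsec hh _) fun x' y' => ?_
    have hcons : (s : ℝ) • (Fin.cons x x' : Fin (n + 1) → ℝ) + (t : ℝ) • Fin.cons y y' =
        Fin.cons ((s : ℝ) • x + (t : ℝ) • y) ((s : ℝ) • x' + (t : ℝ) • y') := by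
      refine funext (Fin.cases ?_ fun i => ?_) <;> simp
    rw [← hcons]
    exact hle _ _

end BorellBrascampLieb

/-! ### The symmetral as a supremum of means -/

section Reflection

/-- The reflection `R_u` in the hyperplane orthogonal to `u`, as a linear isometry. -/
def reflIso (u : E n) : E n ≃ₗᵢ[ℝ] E n := (Submodule.span ℝ {u})ᗮ.reflection

lemma reflPt_eq {u : E n} (hu : ‖u‖ = 1) : reflPt u = reflIso u := by
  funext x
  rw [reflIso, Submodule.reflection_orthogonal_apply, Submodule.reflection_singleton_apply,
    reflPt, hu, real_inner_comm]
  simp only [RCLike.ofReal_real_eq_id, id, one_pow, div_one, neg_sub, mul_smul,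
    ← ofNat_smul_eq_nsmul ℝ]

@[simp] lemma reflIso_reflIso (u x : E n) : reflIso u (reflIso u x) = x := by
  simp [reflIso]

lemma refl_eq {u : E n} (hu : ‖u‖ = 1) (f : E n → ℝ≥0∞) : refl u f = f ∘ reflIso u := by
  funext x
  simp [refl, reflPt_eq hu]

end Reflection

section Domain

variable {α : EReal} {f g : E n → ℝ≥0∞} {x : E n}

/-- The effective domain of the base function: points off it do not compete in the supremum that
defines the symmetral. -/
def dom (α : EReal) (f : E n → ℝ≥0∞) : Set (E n) := if 0 < α then closure (supp f) else supp f

lemma dom_of_pos (hα : 0 < α) (f : E n → ℝ≥0∞) : dom α f = closure (supp f) := if_pos hα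

lemma dom_of_nonpos (hα : α ≤ 0) (f : E n → ℝ≥0∞) : dom α f = supp f := if_neg hα.not_gt

lemma supp_subset_dom (α : EReal) (f : E n → ℝ≥0∞) : supp f ⊆ dom α f := by
  unfold dom
  split_ifs
  exacts [subset_closure, subset_rfl]

lemma dom_subset_closure (α : EReal) (f : E n → ℝ≥0∞) : dom α f ⊆ closure (supp f) := by
  unfold dom
  split_ifs
  exacts [subset_rfl, subset_closure]

lemma eq_zero_of_notMem_dom (hx : x ∉ dom α f) : f x = 0 := by
  by_contra h
  exact hx (supp_subset_dom α f (pos_iff_ne_zero.2 h))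

lemma dom_mono (α : EReal) (h : f ≤ g) : dom α f ⊆ dom α g := by
  have hsupp : supp f ⊆ supp g := fun x hx => lt_of_lt_of_le hx (h x)
  unfold dom
  split_ifs
  exacts [closure_mono hsupp, hsupp]

lemma mem_dom_comp_iff (α : EReal) (f : E n → ℝ≥0∞) (e : E n ≃ₜ E n) (x : E n) :
    x ∈ dom α (f ∘ e) ↔ e x ∈ dom α f := by
  have hsupp : supp (f ∘ e) = e ⁻¹' supp f := rfl
  unfold dom
  split_ifs
  · rw [hsupp, ← e.preimage_closure, mem_preimage]
  · rw [hsupp, mem_preimage]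

lemma mem_dom_refl {u : E n} (hu : ‖u‖ = 1) : x ∈ dom α (refl u f) ↔ reflIso u x ∈ dom α f := by
  rw [refl_eq hu]
  exact mem_dom_comp_iff α f (reflIso u).toHomeomorph x

open Classical in
/-- The mean of `f y` and `g z` if both points lie in the effective domains, and zero otherwise. -/
def pairMean (α : EReal) (s t : ℝ≥0) (f g : E n → ℝ≥0∞) (y z : E n) : ℝ≥0∞ :=
  if y ∈ dom α f ∧ z ∈ dom α g then alphaMean α s t (f y) (g z) else 0

lemma pairMean_of_mem {s t : ℝ≥0} {y z : E n} (hy : y ∈ dom α f) (hz : z ∈ dom α g) :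
    pairMean α s t f g y z = alphaMean α s t (f y) (g z) := if_pos ⟨hy, hz⟩

lemma pairMean_of_notMem {s t : ℝ≥0} {y z : E n} (h : ¬(y ∈ dom α f ∧ z ∈ dom α g)) :
    pairMean α s t f g y z = 0 := if_neg h

end Domain

section Values

variable {p : ℝ} {s t : ℝ≥0} {a b : ℝ≥0∞}

/-- The base function as a function of the value, real-valued: its value is meaningful where the
base function is finite. -/
def baseVal (p : ℝ) (a : ℝ≥0∞) : ℝ :=
  if p = 0 then -Real.log a.toReal else (1 - a.toReal ^ p) / p

/-- The value of a function at a point where its base function is `r`. -/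
def valOfBase (p : ℝ) (r : EReal) : ℝ≥0∞ :=
  if p = 0 then EReal.exp (-r) else (1 - (p : EReal) * r).toENNReal ^ (1 / p)

lemma valOfBase_top (p : ℝ) : valOfBase p ⊤ = 0 := by
  unfold valOfBase
  split_ifs with hp
  · simp
  rcases lt_or_gt_of_ne hp with hp | hp
  · rw [EReal.coe_mul_top_of_neg hp, EReal.sub_bot (by decide)]
    simp [hp]
  · rw [EReal.coe_mul_top_of_pos hp, EReal.sub_top]
    simp [hp]

lemma valOfBase_coe (hp : p ≠ 0) (r : ℝ) :
    valOfBase p r = ENNReal.ofReal (1 - p * r) ^ (1 / p) := by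
  rw [valOfBase, if_neg hp]
  norm_cast

lemma valOfBase_zero_coe (r : ℝ) : valOfBase 0 r = ENNReal.ofReal (Real.exp (-r)) := by
  rw [valOfBase, if_pos rfl]
  norm_cast

lemma continuous_one_sub_coe_mul (hp : p ≠ 0) :
    Continuous fun r : EReal => 1 - (p : EReal) * r := by
  have hp' : (p : EReal) ≠ 0 := mod_cast hp
  have hmul (r : EReal) : ContinuousAt (fun r : EReal => (p : EReal) * r) r :=
    ContinuousAt.comp (f := fun r : EReal => ((p : EReal), r)) (x := r)
      (EReal.continuousAt_mul (.inl hp') (.inl hp') (.inl (EReal.coe_ne_bot p))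
        (.inl (EReal.coe_ne_top p))) (by fun_prop)
  have hsub (r : EReal) : ContinuousAt (fun r : EReal => 1 + -r) r :=
    ContinuousAt.comp (f := fun r : EReal => ((1 : EReal), -r)) (x := r)
      (EReal.continuousAt_add (.inl (EReal.coe_ne_top 1)) (.inl (EReal.coe_ne_bot 1)))
      (by fun_prop)
  exact (continuous_iff_continuousAt.2 hsub).comp (continuous_iff_continuousAt.2 hmul)

lemma continuous_valOfBase (p : ℝ) : Continuous (valOfBase p) := by
  unfold valOfBase
  split_ifs with hp
  · exact ENNReal.continuous_exp.comp continuous_neg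
  · exact ENNReal.continuous_rpow_const.comp
      (EReal.continuous_toENNReal.comp (continuous_one_sub_coe_mul hp))

lemma valOfBase_antitone (p : ℝ) : Antitone (valOfBase p) := by
  intro r r' hr
  unfold valOfBase
  split_ifs with hp
  · exact EReal.exp_monotone (EReal.neg_le_neg_iff.2 hr)
  rcases lt_or_gt_of_ne hp with hp | hp
  · refine rpow_le_rpow_of_exponent_nonpos (one_div_neg.2 hp).le (EReal.toENNReal_le_toENNReal ?_)
    rw [mul_comm, mul_comm (p : EReal)]
    exact EReal.sub_le_sub le_rfl (EReal.mul_le_mul_of_nonpos_right hr (mod_cast hp.le))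
  · refine ENNReal.rpow_le_rpow (EReal.toENNReal_le_toENNReal ?_) (by positivity)
    exact EReal.sub_le_sub le_rfl (mul_le_mul_of_nonneg_left hr (mod_cast hp.le))

lemma valOfBase_iInf (p : ℝ) {ι : Type*} [Nonempty ι] (r : ι → EReal) :
    valOfBase p (⨅ i, r i) = ⨆ i, valOfBase p (r i) :=
  (valOfBase_antitone p).map_iInf_of_continuousAt (continuous_valOfBase p).continuousAt
    (valOfBase_top p)

/-- A value at which the base function is finite. -/
def Admissible (p : ℝ) (a : ℝ≥0∞) : Prop := a ≠ ∞ ∧ (p ≤ 0 → a ≠ 0)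

lemma Admissible.rpow_ne_top (ha : Admissible p a) : a ^ p ≠ ∞ := by
  rcases le_or_gt p 0 with hp | hp
  · exact ENNReal.rpow_ne_top_of_ne_zero (ha.2 hp) ha.1
  · exact ENNReal.rpow_ne_top_of_nonneg hp.le ha.1

lemma Admissible.ofReal_toReal_rpow (ha : Admissible p a) :
    ENNReal.ofReal (a.toReal ^ p) = a ^ p := by
  rw [ENNReal.toReal_rpow, ENNReal.ofReal_toReal ha.rpow_ne_top]

lemma valOfBase_combo (hst : s + t = 1) (ha : Admissible p a) (hb : Admissible p b) :
    valOfBase p ((s * baseVal p a + t * baseVal p b : ℝ) : EReal) = alphaMean p s t a b := by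
  rcases eq_or_ne p 0 with rfl | hp
  · have ha0 := ENNReal.toReal_pos (ha.2 le_rfl) ha.1
    have hb0 := ENNReal.toReal_pos (hb.2 le_rfl) hb.1
    have hexp : Real.exp (-(s * -Real.log a.toReal + t * -Real.log b.toReal)) =
        a.toReal ^ (s : ℝ) * b.toReal ^ (t : ℝ) := by
      rw [Real.rpow_def_of_pos ha0, Real.rpow_def_of_pos hb0, ← Real.exp_add]
      ring_nf
    simp only [baseVal, if_true]
    rw [valOfBase_zero_coe, hexp, EReal.coe_zero, alphaMean_zero,
      ENNReal.ofReal_mul (by positivity), ← ENNReal.ofReal_rpow_of_pos ha0,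
      ← ENNReal.ofReal_rpow_of_pos hb0, ENNReal.ofReal_toReal ha.1, ENNReal.ofReal_toReal hb.1]
  · have hst' : (s : ℝ) = 1 - t := eq_sub_of_add_eq (mod_cast hst)
    have hcombo : 1 - p * (s * ((1 - a.toReal ^ p) / p) + t * ((1 - b.toReal ^ p) / p)) =
        s * a.toReal ^ p + t * b.toReal ^ p := by
      rw [hst']
      field_simp
      ring
    simp only [baseVal, if_neg hp]
    rw [valOfBase_coe hp, hcombo, alphaMean_coe hp, one_div,
      ENNReal.ofReal_add (by positivity) (by positivity), ENNReal.ofReal_mul s.coe_nonneg,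
      ENNReal.ofReal_mul t.coe_nonneg, ha.ofReal_toReal_rpow, hb.ofReal_toReal_rpow,
      ENNReal.ofReal_coe_nnreal, ENNReal.ofReal_coe_nnreal]

lemma one_sub_mul_mul_baseVal_pos (hp : p ≠ 0) {c : ℝ} (hc : c ∈ Ioo (0 : ℝ) 1) (a : ℝ≥0∞) :
    0 < 1 - p * (c * baseVal p a) := by
  have heq : 1 - p * (c * baseVal p a) = (1 - c) + c * a.toReal ^ p := by
    rw [baseVal, if_neg hp]
    field_simp
    ring
  have hpow : 0 ≤ c * a.toReal ^ p := mul_nonneg hc.1.le (by positivity)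
  linarith [hc.2]

lemma valOfBase_mul_baseVal_pos {c : ℝ} (hc : c ∈ Ioo (0 : ℝ) 1) :
    0 < valOfBase p ((c * baseVal p a : ℝ) : EReal) := by
  rcases eq_or_ne p 0 with rfl | hp
  · rw [valOfBase_zero_coe]
    exact ENNReal.ofReal_pos.2 (Real.exp_pos _)
  · have hpos := one_sub_mul_mul_baseVal_pos hp hc a
    rw [valOfBase_coe hp, ENNReal.ofReal_rpow_of_pos hpos]
    exact ENNReal.ofReal_pos.2 (Real.rpow_pos_of_pos hpos _)

lemma valOfBase_mul_baseVal_lt_top {c : ℝ} (hc : c ∈ Ioo (0 : ℝ) 1) :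
    valOfBase p ((c * baseVal p a : ℝ) : EReal) < ∞ := by
  rcases eq_or_ne p 0 with rfl | hp
  · rw [valOfBase_zero_coe]
    exact ENNReal.ofReal_lt_top
  · rw [valOfBase_coe hp, ENNReal.ofReal_rpow_of_pos (one_sub_mul_mul_baseVal_pos hp hc a)]
    exact ENNReal.ofReal_lt_top

lemma baseVal_valOfBase_mul_baseVal {c : ℝ} (hc : c ∈ Ioo (0 : ℝ) 1) :
    baseVal p (valOfBase p ((c * baseVal p a : ℝ) : EReal)) = c * baseVal p a := by
  rcases eq_or_ne p 0 with rfl | hp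
  · rw [valOfBase_zero_coe, baseVal, if_pos rfl, ENNReal.toReal_ofReal (Real.exp_pos _).le,
      Real.log_exp, neg_neg]
  · have hpos := one_sub_mul_mul_baseVal_pos hp hc a
    rw [valOfBase_coe hp, ENNReal.ofReal_rpow_of_pos hpos, baseVal, if_neg hp,
      ENNReal.toReal_ofReal (by positivity), one_div, Real.rpow_inv_rpow hpos.le hp]
    field_simp
    ring

end Values

section Homothety

variable {p c : ℝ} {s t : ℝ≥0} {f g : E n → ℝ≥0∞} {x : E n}

lemma admissible_of_mem_dom (hf : ∀ x, f x < ∞) (hx : x ∈ dom p f) : Admissible p (f x) := by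
  refine ⟨(hf x).ne, fun hp => ?_⟩
  rw [dom_of_nonpos (mod_cast hp)] at hx
  exact pos_iff_ne_zero.1 hx

lemma base_of_mem_dom (hf : ∀ x, f x < ∞) (hx : x ∈ dom p f) :
    base p f x = baseVal p (f x) := by
  have hadm := admissible_of_mem_dom hf hx
  rcases eq_or_ne p 0 with rfl | hp
  · rw [base, if_pos rfl, baseVal, if_pos rfl, ENNReal.log_pos_real (hadm.2 le_rfl) hadm.1]
    simp
  · rw [base, if_neg hp, if_pos (dom_subset_closure _ _ hx), baseVal, if_neg hp,
      ← EReal.coe_ennreal_toReal hadm.rpow_ne_top, ← ENNReal.toReal_rpow]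
    norm_cast

lemma base_of_notMem_dom (hx : x ∉ dom p f) : base p f x = ⊤ := by
  have hfx := eq_zero_of_notMem_dom hx
  rcases eq_or_ne p 0 with rfl | hp
  · simp [base, hfx]
  rw [base, if_neg hp]
  split_ifs with hcl
  · have hp' : p < 0 := by
      refine hp.lt_of_le (not_lt.1 fun hpos => hx ?_)
      rwa [dom_of_pos (mod_cast hpos)]
    rw [hfx, ENNReal.zero_rpow_of_neg hp', EReal.coe_ennreal_top, EReal.sub_top]
    exact EReal.bot_div_of_neg_ne_bot (mod_cast hp') (EReal.coe_ne_bot p)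
  · rfl

lemma homothety_of_mem (hf : ∀ x, f x < ∞) (hx : c⁻¹ • x ∈ dom p f) :
    homothety p c f x = valOfBase p ((c * baseVal p (f (c⁻¹ • x)) : ℝ) : EReal) := by
  change valOfBase p (epiMul c (base p f) x) = _
  rw [epiMul, base_of_mem_dom hf hx, EReal.coe_mul]

lemma homothety_of_notMem (hc : 0 < c) (hx : c⁻¹ • x ∉ dom p f) : homothety p c f x = 0 := by
  change valOfBase p (epiMul c (base p f) x) = _
  rw [epiMul, base_of_notMem_dom hx, EReal.coe_mul_top_of_pos hc, valOfBase_top]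

lemma homothety_lt_top (hf : ∀ x, f x < ∞) (hc : c ∈ Ioo (0 : ℝ) 1) (x : E n) :
    homothety p c f x < ∞ := by
  by_cases hx : c⁻¹ • x ∈ dom p f
  · rw [homothety_of_mem hf hx]
    exact valOfBase_mul_baseVal_lt_top hc
  · rw [homothety_of_notMem hc.1 hx]
    exact ENNReal.zero_lt_top

lemma supp_homothety (hf : ∀ x, f x < ∞) (hc : c ∈ Ioo (0 : ℝ) 1) :
    supp (homothety p c f) = (fun x => c⁻¹ • x) ⁻¹' dom p f := by
  ext x
  by_cases hx : c⁻¹ • x ∈ dom p f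
  · simp only [hx, iff_true, supp, mem_ofPred_eq, homothety_of_mem hf hx, mem_preimage]
    exact valOfBase_mul_baseVal_pos hc
  · simp only [hx, supp, mem_ofPred_eq, homothety_of_notMem hc.1 hx, lt_irrefl, mem_preimage]

lemma mem_dom_homothety (hf : ∀ x, f x < ∞) (hc : c ∈ Ioo (0 : ℝ) 1) :
    x ∈ dom p (homothety p c f) ↔ c⁻¹ • x ∈ dom p f := by
  rcases lt_or_ge (0 : EReal) p with hp | hp
  · have hclosed : IsClosed (dom p f) := by
      rw [dom_of_pos hp]
      exact isClosed_closure
    rw [dom_of_pos hp, supp_homothety hf hc, (hclosed.preimage (by fun_prop)).closure_eq,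
      mem_preimage]
  · rw [dom_of_nonpos hp, supp_homothety hf hc, mem_preimage]

lemma base_homothety_of_mem (hf : ∀ x, f x < ∞) (hc : c ∈ Ioo (0 : ℝ) 1)
    (hx : c⁻¹ • x ∈ dom p f) :
    base p (homothety p c f) x = ((c * baseVal p (f (c⁻¹ • x)) : ℝ) : EReal) := by
  rw [base_of_mem_dom (homothety_lt_top hf hc) ((mem_dom_homothety hf hc).2 hx),
    homothety_of_mem hf hx, baseVal_valOfBase_mul_baseVal hc]

lemma base_homothety_of_notMem (hf : ∀ x, f x < ∞) (hc : c ∈ Ioo (0 : ℝ) 1)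
    (hx : c⁻¹ • x ∉ dom p f) : base p (homothety p c f) x = ⊤ :=
  base_of_notMem_dom (by rwa [mem_dom_homothety hf hc])

lemma asplund_homothety_apply (hf : ∀ x, f x < ∞) (hg : ∀ x, g x < ∞) (hs : s ≠ 0) (ht : t ≠ 0)
    (hst : s + t = 1) (x : E n) :
    asplund p (homothety p s f) (homothety p t g) x =
      ⨆ y, pairMean p s t f g ((s : ℝ)⁻¹ • y) ((t : ℝ)⁻¹ • (x - y)) := by
  have hs' : 0 < (s : ℝ) := mod_cast pos_iff_ne_zero.2 hs
  have ht' : 0 < (t : ℝ) := mod_cast pos_iff_ne_zero.2 ht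
  have hsum : (s : ℝ) + t = 1 := mod_cast hst
  have hs1 : (s : ℝ) ∈ Ioo (0 : ℝ) 1 := ⟨hs', by linarith [hsum]⟩
  have ht1 : (t : ℝ) ∈ Ioo (0 : ℝ) 1 := ⟨ht', by linarith [hsum]⟩
  change valOfBase p (infConv _ _ x) = _
  rw [infConv, valOfBase_iInf]
  refine iSup_congr fun y => ?_
  by_cases hy : (s : ℝ)⁻¹ • y ∈ dom p f <;> by_cases hz : (t : ℝ)⁻¹ • (x - y) ∈ dom p g
  · rw [pairMean_of_mem hy hz, base_homothety_of_mem hf hs1 hy, base_homothety_of_mem hg ht1 hz,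
      ← EReal.coe_add, valOfBase_combo hst (admissible_of_mem_dom hf hy)
      (admissible_of_mem_dom hg hz)]
  · rw [pairMean_of_notMem (fun h => hz h.2), base_homothety_of_mem hf hs1 hy,
      base_homothety_of_notMem hg ht1 hz, EReal.coe_add_top, valOfBase_top]
  · rw [pairMean_of_notMem (fun h => hy h.1), base_homothety_of_notMem hf hs1 hy,
      base_homothety_of_mem hg ht1 hz, EReal.top_add_coe, valOfBase_top]
  · rw [pairMean_of_notMem (fun h => hy h.1), base_homothety_of_notMem hf hs1 hy,
      base_homothety_of_notMem hg ht1 hz, EReal.top_add_top, valOfBase_top]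

lemma pairMean_bot (s t : ℝ≥0) (f g : E n → ℝ≥0∞) (y z : E n) :
    pairMean ⊥ s t f g y z = min (f y) (g z) := by
  by_cases h : y ∈ dom ⊥ f ∧ z ∈ dom ⊥ g
  · rw [pairMean_of_mem h.1 h.2, alphaMean_bot]
  · rw [pairMean_of_notMem h]
    rcases not_and_or.1 h with h | h <;> simp [eq_zero_of_notMem_dom h]

lemma pairMean_top (hf : IsClosed (supp f)) (hg : IsClosed (supp g)) (s t : ℝ≥0) (y z : E n) :
    pairMean ⊤ s t f g y z = ⨆ (_ : y ∈ supp f) (_ : z ∈ supp g), max (f y) (g z) := by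
  have hdom {h : E n → ℝ≥0∞} (hh : IsClosed (supp h)) : dom ⊤ h = supp h := by
    rw [dom_of_pos (by simp), hh.closure_eq]
  by_cases h : y ∈ dom ⊤ f ∧ z ∈ dom ⊤ g
  · rw [pairMean_of_mem h.1 h.2, alphaMean_top]
    rw [hdom hf, hdom hg] at h
    simp [h]
  · rw [pairMean_of_notMem h]
    rw [hdom hf, hdom hg] at h
    simp_all

end Homothety

section Symmetral

variable {α : EReal} {u : E n} {f : E n → ℝ≥0∞}

lemma pairMean_refl (hu : ‖u‖ = 1) (α : EReal) (s t : ℝ≥0) (f g : E n → ℝ≥0∞) (y z : E n) :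
    pairMean α s t f (refl u g) y z = pairMean α s t f g y (reflIso u z) := by
  by_cases h : y ∈ dom α f ∧ z ∈ dom α (refl u g)
  · rw [pairMean_of_mem h.1 h.2, pairMean_of_mem h.1 ((mem_dom_refl hu).1 h.2), refl_eq hu,
      Function.comp_apply]
  · rw [pairMean_of_notMem h, pairMean_of_notMem fun h' => h ⟨h'.1, (mem_dom_refl hu).2 h'.2⟩]

lemma half_add_half : (2⁻¹ : ℝ≥0) + 2⁻¹ = 1 := by
  rw [← two_mul, mul_inv_cancel₀ two_ne_zero]

lemma symm_eq_iSup_pairMean_refl (hu : ‖u‖ = 1) (hf : ∀ x, f x < ∞)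
    (hcl : α = ⊤ → IsClosed (supp f)) (x : E n) :
    symm α u f x = ⨆ y, pairMean α 2⁻¹ 2⁻¹ f (refl u f)
      ((2 : ℝ) • y) ((2 : ℝ) • (x - y)) := by
  have htwo : (1 / 2 : ℝ)⁻¹ = 2 := by norm_num
  rw [← htwo]
  induction α with
  | bot =>
    rw [symm, if_pos rfl]
    exact iSup_congr fun y => (pairMean_bot ..).symm
  | top =>
    have hcl' : IsClosed (supp (refl u f)) := by
      rw [refl_eq hu]
      exact (hcl rfl).preimage (reflIso u).continuous
    rw [symm, if_neg (by decide), if_pos rfl]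
    exact iSup_congr fun y => (pairMean_top (hcl rfl) hcl' ..).symm
  | coe p =>
    rw [symm, if_neg (EReal.coe_ne_bot p), if_neg (EReal.coe_ne_top p), EReal.toReal_coe]
    have hhalf : ((2⁻¹ : ℝ≥0) : ℝ) = 1 / 2 := by norm_num
    simpa only [hhalf] using asplund_homothety_apply (p := p) (g := refl u f) hf (fun x => hf _)
      (inv_ne_zero two_ne_zero) (inv_ne_zero two_ne_zero) half_add_half x

lemma symm_apply (hu : ‖u‖ = 1) (hf : ∀ x, f x < ∞) (hcl : α = ⊤ → IsClosed (supp f)) (x : E n) :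
    symm α u f x = ⨆ y, pairMean α 2⁻¹ 2⁻¹ f f y (reflIso u ((2 : ℝ) • x - y)) := by
  have hsurj : Function.Surjective fun y : E n => (2 : ℝ) • y :=
    fun y => ⟨(2⁻¹ : ℝ) • y, by simp⟩
  rw [symm_eq_iSup_pairMean_refl hu hf hcl, ← hsurj.iSup_comp
    (g := fun y => pairMean α 2⁻¹ 2⁻¹ f f y (reflIso u ((2 : ℝ) • x - y)))]
  refine iSup_congr fun y => ?_
  rw [pairMean_refl hu, smul_sub]

end Symmetral

lemma isCompact_le_of_tendsto_zero {X : Type*} [TopologicalSpace X] {f : X → ℝ≥0∞}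
    (husc : UpperSemicontinuous f) (h0 : Tendsto f (cocompact X) (𝓝 0)) {t : ℝ≥0∞} (ht : 0 < t) :
    IsCompact {x | t ≤ f x} := by
  obtain ⟨K, hK, hsub⟩ := mem_cocompact.1 (h0.eventually_lt_const ht)
  refine hK.of_isClosed_subset (husc.isClosed_preimage t) fun x hx => ?_
  by_contra hxK
  have hlt : f x < t := hsub hxK
  exact hlt.not_ge hx

lemma exists_forall_le_of_tendsto_zero {X : Type*} [TopologicalSpace X] {f : X → ℝ≥0∞}
    (hfin : ∀ x, f x < ∞) (husc : UpperSemicontinuous f)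
    (h0 : Tendsto f (cocompact X) (𝓝 0)) : ∃ C < ∞, ∀ x, f x ≤ C := by
  rcases {x | 1 ≤ f x}.eq_empty_or_nonempty with h | h
  · exact ⟨1, ENNReal.one_lt_top, fun x => (not_le.1 (eq_empty_iff_forall_notMem.1 h x)).le⟩
  · obtain ⟨x₀, hx₀, hmax⟩ := (husc.upperSemicontinuousOn _).exists_isMaxOn h
      (isCompact_le_of_tendsto_zero husc h0 one_pos)
    refine ⟨f x₀, hfin x₀, fun x => ?_⟩
    by_cases hx : 1 ≤ f x
    · exact hmax hx
    · exact (not_le.1 hx).le.trans hx₀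

lemma upperSemicontinuous_alphaMean {X : Type*} [TopologicalSpace X] (α : EReal) (s t : ℝ≥0)
    {f g : X → ℝ≥0∞} (hf : ∀ x, f x < ∞) (hg : ∀ x, g x < ∞) (hfu : UpperSemicontinuous f)
    (hgu : UpperSemicontinuous g) : UpperSemicontinuous fun x => alphaMean α s t (f x) (g x) := by
  intro x c hc
  have h := (continuousAt_alphaMean α s t (.inr (hg x).ne) (.inr (hf x).ne)).eventually_lt_const hc
  rw [nhds_prod_eq] at h
  have : (𝓝[>] (f x)).NeBot := nhdsGT_neBot_of_exists_gt ⟨∞, hf x⟩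
  have : (𝓝[>] (g x)).NeBot := nhdsGT_neBot_of_exists_gt ⟨∞, hg x⟩
  have hlt : ∀ᶠ p in 𝓝[>] (f x) ×ˢ 𝓝[>] (g x), alphaMean α s t p.1 p.2 < c :=
    h.filter_mono (Filter.prod_mono nhdsWithin_le_nhds nhdsWithin_le_nhds)
  have hgt : ∀ᶠ p in 𝓝[>] (f x) ×ˢ 𝓝[>] (g x), f x < p.1 ∧ g x < p.2 :=
    (eventually_mem_nhdsWithin (a := f x) (s := Ioi (f x))).prod_mk
      (eventually_mem_nhdsWithin (a := g x) (s := Ioi (g x)))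
  obtain ⟨⟨a, b⟩, hab, ha, hb⟩ := (hlt.and hgt).exists
  filter_upwards [hfu x a ha, hgu x b hb] with y hy₁ hy₂
  exact (alphaMean_mono α s t hy₁.le hy₂.le).trans_lt hab

/-- The regularity of a function that makes the supremum in its `α`-symmetral a maximum. -/
structure Tame (α : EReal) (f : E n → ℝ≥0∞) : Prop where
  finite : ∀ x, f x < ∞
  usc : UpperSemicontinuous f
  tendsto_zero : Tendsto f (cocompact (E n)) (𝓝 0)
  isBounded_supp : 0 < α → Bornology.IsBounded (supp f)
  isClosed_supp : α = ⊤ → IsClosed (supp f)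

/-- The pairs of points of the effective domain at which the mean of the values of `f` is at
least `t`. -/
def pairSet (α : EReal) (f : E n → ℝ≥0∞) (t : ℝ≥0∞) : Set (E n × E n) :=
  dom α f ×ˢ dom α f ∩ {q | t ≤ midMean α (f q.1) (f q.2)}

/-- The midpoint of `y` and the mirror image of `z`: the value of the symmetral at `x` is the
supremum of the means of `f y` and `f z` over the pairs `(y, z)` with `mixPt u (y, z) = x`. -/
def mixPt (u : E n) (q : E n × E n) : E n := (2⁻¹ : ℝ) • (q.1 + reflIso u q.2)

lemma continuous_mixPt (u : E n) : Continuous (mixPt u) := by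
  unfold mixPt; fun_prop

lemma mixPt_reflIso_sub (u x y : E n) : mixPt u (y, reflIso u ((2 : ℝ) • x - y)) = x := by
  simp [mixPt]

lemma mixPt_reflIso (u x : E n) : mixPt u (x, reflIso u x) = x := by
  rw [mixPt, reflIso_reflIso]; module

lemma reflIso_two_smul_mixPt_sub (u y z : E n) :
    reflIso u ((2 : ℝ) • mixPt u (y, z) - y) = z := by
  simp [mixPt]

lemma reflIso_mixPt (u y z : E n) : reflIso u (mixPt u (y, z)) = mixPt u (z, y) := by
  simp [mixPt, add_comm]

lemma mixPt_eq_sub {u : E n} (hu : ‖u‖ = 1) (y z : E n) :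
    mixPt u (y, z) = (2⁻¹ : ℝ) • (y + z) - inner ℝ z u • u := by
  rw [mixPt, ← reflPt_eq hu, reflPt]; module

namespace Tame

variable {α : EReal} {u : E n} {f : E n → ℝ≥0∞}

lemma upperSemicontinuous_midMean (hf : Tame α f) :
    UpperSemicontinuous fun q : E n × E n => midMean α (f q.1) (f q.2) :=
  upperSemicontinuous_alphaMean α _ _ (fun q => hf.finite q.1) (fun q => hf.finite q.2)
    (hf.usc.comp continuous_fst) (hf.usc.comp continuous_snd)

lemma isCompact_pairSet (hf : Tame α f) {t : ℝ≥0∞} (ht : 0 < t ∨ 0 < α) :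
    IsCompact (pairSet α f t) := by
  have hcl : IsClosed {q : E n × E n | t ≤ midMean α (f q.1) (f q.2)} :=
    hf.upperSemicontinuous_midMean.isClosed_preimage t
  rcases lt_or_ge 0 α with hα | hα
  · have hK : IsCompact (dom α f) := by
      simpa only [dom_of_pos hα] using (hf.isBounded_supp hα).isCompact_closure
    exact (hK.prod hK).inter_right hcl
  · have ht : 0 < t := ht.resolve_right hα.not_gt
    obtain ⟨C, hC, hfC⟩ := exists_forall_le_of_tendsto_zero hf.finite hf.usc hf.tendsto_zero
    obtain ⟨δ, hδ, h⟩ := exists_le_of_le_alphaMean hα (s := 2⁻¹) (t := 2⁻¹)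
      (inv_ne_zero two_ne_zero) (inv_ne_zero two_ne_zero) hC.ne ht
    have hpair : pairSet α f t =
        {x | δ ≤ f x} ×ˢ {x | δ ≤ f x} ∩ {q | t ≤ midMean α (f q.1) (f q.2)} := by
      rw [pairSet, dom_of_nonpos hα]
      ext q
      refine ⟨fun hq => ⟨h _ _ (hfC _) (hfC _) hq.2, hq.2⟩, fun hq => ⟨⟨?_, ?_⟩, hq.2⟩⟩
      exacts [hδ.trans_le hq.1.1, hδ.trans_le hq.1.2]
    have hK := isCompact_le_of_tendsto_zero hf.usc hf.tendsto_zero hδ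
    rw [hpair]
    exact (hK.prod hK).inter_right hcl

lemma midMean_le_symm (hu : ‖u‖ = 1) (hf : Tame α f) {y z : E n} (hy : y ∈ dom α f)
    (hz : z ∈ dom α f) : midMean α (f y) (f z) ≤ symm α u f (mixPt u (y, z)) := by
  rw [symm_apply hu hf.finite hf.isClosed_supp]
  refine le_iSup_of_le y ?_
  rw [reflIso_two_smul_mixPt_sub, pairMean_of_mem hy hz]

lemma symm_le (hu : ‖u‖ = 1) (hf : Tame α f) {x : E n} {c : ℝ≥0∞}
    (h : ∀ y ∈ dom α f, ∀ z ∈ dom α f, mixPt u (y, z) = x → midMean α (f y) (f z) ≤ c) :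
    symm α u f x ≤ c := by
  rw [symm_apply hu hf.finite hf.isClosed_supp]
  refine iSup_le fun y => ?_
  unfold pairMean
  split_ifs with hm
  · exact h _ hm.1 _ hm.2 (mixPt_reflIso_sub u x y)
  · exact zero_le

lemma exists_eq_of_mem_image (hu : ‖u‖ = 1) (hf : Tame α f) {t : ℝ≥0∞} (ht : 0 < t ∨ 0 < α)
    {x : E n} (hx : x ∈ mixPt u '' pairSet α f t) :
    ∃ y ∈ dom α f, ∃ z ∈ dom α f, mixPt u (y, z) = x ∧ symm α u f x = midMean α (f y) (f z) := by
  have hcomp : IsCompact (pairSet α f t ∩ mixPt u ⁻¹' {x}) :=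
    (hf.isCompact_pairSet ht).inter_right (isClosed_singleton.preimage (continuous_mixPt u))
  obtain ⟨⟨y, z⟩, ⟨⟨⟨hy, hz⟩, hyz⟩, hmix : mixPt u (y, z) = x⟩, hmax⟩ :=
    (hf.upperSemicontinuous_midMean.upperSemicontinuousOn _).exists_isMaxOn hx hcomp
  refine ⟨y, hy, z, hz, hmix, (hf.symm_le hu fun y' hy' z' hz' hmix' => ?_).antisymm ?_⟩
  · by_cases hle : t ≤ midMean α (f y') (f z')
    · exact hmax (⟨⟨⟨hy', hz'⟩, hle⟩, hmix'⟩ : (y', z') ∈ pairSet α f t ∩ mixPt u ⁻¹' {x})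
    · exact (not_le.1 hle).le.trans hyz
  · rw [← hmix]
    exact hf.midMean_le_symm hu hy hz

lemma mem_image_pairSet_of_pos (hu : ‖u‖ = 1) (hf : Tame α f) {x : E n} (hx : 0 < symm α u f x) :
    ∃ t > 0, x ∈ mixPt u '' pairSet α f t := by
  contrapose! hx
  refine hf.symm_le hu fun y hy z hz hmix => ?_
  by_contra! hpos
  exact hx _ hpos ⟨(y, z), ⟨⟨hy, hz⟩, le_refl (midMean α (f y) (f z))⟩, hmix⟩

lemma supp_symm_subset (hu : ‖u‖ = 1) (hf : Tame α f) :
    supp (symm α u f) ⊆ mixPt u '' pairSet α f 0 := by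
  intro x hx
  obtain ⟨t, -, ht⟩ := hf.mem_image_pairSet_of_pos hu hx
  have hsub : pairSet α f t ⊆ pairSet α f 0 :=
    fun q hq => ⟨hq.1, zero_le (a := midMean α (f q.1) (f q.2))⟩
  exact image_mono hsub ht

lemma exists_eq (hu : ‖u‖ = 1) (hf : Tame α f) {x : E n} (hx : x ∈ dom α (symm α u f)) :
    ∃ y ∈ dom α f, ∃ z ∈ dom α f, mixPt u (y, z) = x ∧ symm α u f x = midMean α (f y) (f z) := by
  rcases lt_or_ge 0 α with hα | hα
  · have hcl : IsClosed (mixPt u '' pairSet α f 0) :=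
      ((hf.isCompact_pairSet (.inr hα)).image (continuous_mixPt u)).isClosed
    rw [dom_of_pos hα] at hx
    exact hf.exists_eq_of_mem_image hu (.inr hα)
      (hcl.closure_subset_iff.2 (hf.supp_symm_subset hu) hx)
  · rw [dom_of_nonpos hα] at hx
    obtain ⟨t, ht, hxt⟩ := hf.mem_image_pairSet_of_pos hu hx
    exact hf.exists_eq_of_mem_image hu (.inl ht) hxt

lemma mixPt_mem_dom_symm (hu : ‖u‖ = 1) (hf : Tame α f) {y z : E n} (hy : y ∈ dom α f)
    (hz : z ∈ dom α f) : mixPt u (y, z) ∈ dom α (symm α u f) := by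
  have key : ∀ y ∈ supp f, ∀ z ∈ supp f, mixPt u (y, z) ∈ supp (symm α u f) := fun y hy z hz =>
    (alphaMean_pos α half_add_half hy hz).trans_le
      (hf.midMean_le_symm hu (supp_subset_dom α f hy) (supp_subset_dom α f hz))
  rcases lt_or_ge 0 α with hα | hα
  · rw [dom_of_pos hα] at *
    exact map_mem_closure₂ (f := fun y z => mixPt u (y, z)) (continuous_mixPt u) hy hz key
  · rw [dom_of_nonpos hα] at *
    exact key y hy z hz

lemma le_symm_eq_image (hu : ‖u‖ = 1) (hf : Tame α f) {t : ℝ≥0∞} (ht : 0 < t) :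
    {x | t ≤ symm α u f x} = mixPt u '' pairSet α f t := by
  refine Subset.antisymm (fun x hx => ?_) ?_
  · have hpos : x ∈ supp (symm α u f) := ht.trans_le hx
    obtain ⟨y, hy, z, hz, hmix, hmean⟩ := hf.exists_eq hu (supp_subset_dom α _ hpos)
    exact ⟨(y, z), ⟨⟨hy, hz⟩, hx.trans_eq hmean⟩, hmix⟩
  · rintro _ ⟨⟨y, z⟩, ⟨⟨hy, hz⟩, h⟩, rfl⟩
    exact h.trans (hf.midMean_le_symm hu hy hz)

lemma isCompact_le_symm (hu : ‖u‖ = 1) (hf : Tame α f) {t : ℝ≥0∞} (ht : 0 < t) :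
    IsCompact {x | t ≤ symm α u f x} := by
  rw [hf.le_symm_eq_image hu ht]
  exact (hf.isCompact_pairSet (.inl ht)).image (continuous_mixPt u)

lemma tame_symm (hu : ‖u‖ = 1) (hf : Tame α f) : Tame α (symm α u f) where
  finite x := by
    obtain ⟨C, hC, h⟩ := exists_forall_le_of_tendsto_zero hf.finite hf.usc hf.tendsto_zero
    exact (hf.symm_le hu fun y _ z _ _ => alphaMean_le α half_add_half (h y) (h z)).trans_lt hC
  usc := upperSemicontinuous_iff_isClosed_preimage.2 fun t => by
    rcases eq_zero_or_pos t with rfl | ht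
    · simp
    · exact (hf.isCompact_le_symm hu ht).isClosed
  tendsto_zero := ENNReal.tendsto_nhds_zero.2 fun t ht =>
    mem_of_superset (hf.isCompact_le_symm hu ht).compl_mem_cocompact 
      fun x (hx : ¬t ≤ symm α u f x) => (not_le.1 hx).le
  isBounded_supp hα :=
    ((hf.isCompact_pairSet (.inr hα)).image (continuous_mixPt u)).isBounded.subset
      (hf.supp_symm_subset hu)
  isClosed_supp := by
    rintro rfl
    refine isClosed_of_closure_subset fun x hx => ?_
    rw [← dom_of_pos EReal.zero_lt_top] at hx
    obtain ⟨y, hy, z, hz, -, h⟩ := hf.exists_eq hu hx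
    rw [dom_of_pos EReal.zero_lt_top, (hf.isClosed_supp rfl).closure_eq] at hy hz
    exact (alphaMean_pos ⊤ half_add_half hy hz).trans_eq h.symm

end Tame

/-- Midpoint `α`-concavity on the effective domain. -/
def MidConcave (α : EReal) (f : E n → ℝ≥0∞) : Prop :=
  ∀ y ∈ dom α f, ∀ z ∈ dom α f, (2⁻¹ : ℝ) • (y + z) ∈ dom α f ∧
    midMean α (f y) (f z) ≤ f ((2⁻¹ : ℝ) • (y + z))

section SymmetralProperties

variable {α : EReal} {u : E n} {f g : E n → ℝ≥0∞}

lemma symm_mono (hu : ‖u‖ = 1) (hf : Tame α f) (hg : Tame α g) (h : f ≤ g) :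
    symm α u f ≤ symm α u g := by
  refine fun x => hf.symm_le hu fun y hy z hz hx => ?_
  rw [← hx]
  exact (alphaMean_mono α _ _ (h y) (h z)).trans
    (hg.midMean_le_symm hu (dom_mono α h hy) (dom_mono α h hz))

lemma refl_symm (hu : ‖u‖ = 1) (hf : Tame α f) : refl u (symm α u f) = symm α u f := by
  have key (x : E n) : symm α u f (reflIso u x) ≤ symm α u f x := by
    refine hf.symm_le hu fun y hy z hz h => ?_
    have hx : x = mixPt u (z, y) := by rw [← reflIso_mixPt, h, reflIso_reflIso]
    rw [hx, alphaMean_comm]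
    exact hf.midMean_le_symm hu hz hy
  rw [refl_eq hu]
  exact funext fun x => (key x).antisymm (by simpa using key (reflIso u x))

lemma symm_eq_self (hu : ‖u‖ = 1) (hf : Tame α f) (hmid : MidConcave α f) (hR : refl u f = f) :
    symm α u f = f := by
  have hfR (x : E n) : f (reflIso u x) = f x := by
    rw [← congrFun hR x, refl_eq hu, Function.comp_apply]
  have hdom {x : E n} (hx : x ∈ dom α f) : reflIso u x ∈ dom α f := by
    rwa [← mem_dom_refl hu, hR]
  funext x
  refine le_antisymm (hf.symm_le hu fun y hy z hz h => ?_) ?_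
  · rw [← hfR z, ← h]
    exact (hmid y hy _ (hdom hz)).2
  · by_cases hx : x ∈ dom α f
    · simpa only [mixPt_reflIso, hfR, alphaMean_self α half_add_half] using
        hf.midMean_le_symm hu hx (hdom hx)
    · exact (eq_zero_of_notMem_dom hx).trans_le zero_le

lemma midConcave_symm (hu : ‖u‖ = 1) (hf : Tame α f) (hmid : MidConcave α f) :
    MidConcave α (symm α u f) := by
  intro x₁ h₁ x₂ h₂
  obtain ⟨y₁, hy₁, z₁, hz₁, rfl, e₁⟩ := hf.exists_eq hu h₁
  obtain ⟨y₂, hy₂, z₂, hz₂, rfl, e₂⟩ := hf.exists_eq hu h₂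
  obtain ⟨hy, hy'⟩ := hmid y₁ hy₁ y₂ hy₂
  obtain ⟨hz, hz'⟩ := hmid z₁ hz₁ z₂ hz₂
  have hx : (2⁻¹ : ℝ) • (mixPt u (y₁, z₁) + mixPt u (y₂, z₂)) =
      mixPt u ((2⁻¹ : ℝ) • (y₁ + y₂), (2⁻¹ : ℝ) • (z₁ + z₂)) := by
    simp only [mixPt, map_smul, map_add]; module
  rw [hx, e₁, e₂, alphaMean_medial]
  exact ⟨hf.mixPt_mem_dom_symm hu hy hz,
    (alphaMean_mono α _ _ hy' hz').trans (hf.midMean_le_symm hu hy hz)⟩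

lemma symm_symm (hu : ‖u‖ = 1) (hf : Tame α f) (hmid : MidConcave α f) :
    symm α u (symm α u f) = symm α u f :=
  symm_eq_self hu (hf.tame_symm hu) (midConcave_symm hu hf hmid) (refl_symm hu hf)

lemma proj_symm (hu : ‖u‖ = 1) (hf : Tame α f) (hmid : MidConcave α f) :
    proj u (symm α u f) = proj u f := by
  funext x
  refine le_antisymm (iSup_le fun t => ?_) (iSup_le fun t => ?_)
  · refine hf.symm_le hu fun y hy z hz h => ?_
    have hline : (2⁻¹ : ℝ) • (y + z) = x + (t + inner ℝ z u) • u := by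
      rw [add_smul, ← add_assoc, ← h, mixPt_eq_sub hu, sub_add_cancel]
    exact (hmid y hy z hz).2.trans (hline ▸ le_iSup (fun r : ℝ => f (x + r • u)) _)
  · set p : E n := (x : E n) + t • u with hp
    by_cases hx : p ∈ dom α f
    · have hline : mixPt u (p, p) = x + (t - inner ℝ p u) • u := by
        rw [mixPt_eq_sub hu, hp]; module
      calc f p = midMean α (f p) (f p) := (alphaMean_self α half_add_half _).symm
        _ ≤ symm α u f (mixPt u (p, p)) := hf.midMean_le_symm hu hx hx
        _ ≤ proj u (symm α u f) x := hline ▸ le_iSup (fun r : ℝ => symm α u f (x + r • u)) _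
    · exact (eq_zero_of_notMem_dom hx).trans_le zero_le

lemma superlevel_symm_bot (hu : ‖u‖ = 1) (hf : Tame ⊥ f) {t : ℝ} (ht : 0 < t) :
    superlevel t (symm ⊥ u f) = symmSet u (superlevel t f) := by
  have ht' : 0 < ENNReal.ofReal t := by simpa using ht
  rw [superlevel, hf.le_symm_eq_image hu ht', symmSet, reflPt_eq hu]
  ext x
  simp only [mem_image, Set.mem_add, mem_smul_set, superlevel, mem_ofPred_eq, pairSet,
    alphaMean_bot, mem_inter_iff, mem_prod, le_min_iff, dom_of_nonpos bot_le, Prod.exists, mixPt,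
    one_div]
  constructor
  · rintro ⟨y, z, ⟨-, hy, hz⟩, rfl⟩
    exact ⟨_, ⟨y, hy, rfl⟩, _, ⟨_, ⟨z, hz, rfl⟩, rfl⟩, by module⟩
  · rintro ⟨_, ⟨y, hy, rfl⟩, _, ⟨_, ⟨z, hz, rfl⟩, rfl⟩, rfl⟩
    exact ⟨y, z, ⟨⟨ht'.trans_le hy, ht'.trans_le hz⟩, hy, hz⟩, by module⟩

end SymmetralProperties

lemma half_smul_add_mem {F : Type*} [AddCommGroup F] [Module ℝ F] {s : Set F} (hs : Convex ℝ s)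
    {y z : F} (hy : y ∈ s) (hz : z ∈ s) : (2⁻¹ : ℝ) • (y + z) ∈ s := by
  rw [smul_add]
  exact hs hy hz (by norm_num) (by norm_num) (by norm_num)

lemma AlphaConcave.midMean_le {α : EReal} {f : E n → ℝ≥0∞} (hf : AlphaConcave α f) {y z : E n}
    (hy : y ∈ supp f) (hz : z ∈ supp f) : midMean α (f y) (f z) ≤ f ((2⁻¹ : ℝ) • (y + z)) := by
  simpa [smul_add] using hf.2 y hy z hz 2⁻¹ 2⁻¹ half_add_half

lemma Tame.of_nonpos {α : EReal} (hα : α ≤ 0) {f : E n → ℝ≥0∞} (hfin : ∀ x, f x < ∞)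
    (husc : UpperSemicontinuous f) (h0 : Tendsto f (cocompact (E n)) (𝓝 0)) : Tame α f where
  finite := hfin
  usc := husc
  tendsto_zero := h0
  isBounded_supp h := absurd h hα.not_gt
  isClosed_supp h := by simp [h] at hα

namespace MemC

variable {α : EReal} {f : E n → ℝ≥0∞}

lemma isBounded_supp (hf : MemC α f) (hα : 0 < α) : Bornology.IsBounded (supp f) := by
  obtain ⟨x₀, hx₀⟩ := hf.proper
  have hpos : 0 < midMean α (f x₀) 0 :=
    alphaMean_pos_left hα (inv_ne_zero two_ne_zero) _ hx₀ (hf.finite x₀).ne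
  have hK := isCompact_le_of_tendsto_zero hf.usc hf.tendsto_zero hpos
  refine (hK.image (f := fun w => (2 : ℝ) • w - x₀) (by fun_prop)).isBounded.subset fun x hx => ?_
  refine ⟨(2⁻¹ : ℝ) • (x₀ + x), ?_, by simp⟩
  exact (alphaMean_mono α _ _ le_rfl zero_le).trans (hf.alphaConcave.midMean_le hx₀ hx)

lemma isClosed_supp (hf : MemC ⊤ f) : IsClosed (supp f) := by
  obtain ⟨x₀, hx₀⟩ := hf.proper
  have hsupp : supp f = {x | f x₀ ≤ f x} := by
    ext x
    refine ⟨fun hx => ?_, fun (hx : f x₀ ≤ f x) => hx₀.trans_le hx⟩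
    simpa using hf.alphaConcave.2 x₀ hx₀ x hx 0 1 (by simp)
  rw [hsupp]
  exact hf.usc.isClosed_preimage (f x₀)

lemma tame (hf : MemC α f) : Tame α f where
  finite := hf.finite
  usc := hf.usc
  tendsto_zero := hf.tendsto_zero
  isBounded_supp := hf.isBounded_supp
  isClosed_supp := by rintro rfl; exact hf.isClosed_supp

lemma midConcave (hf : MemC α f) : MidConcave α f := by
  intro y hy z hz
  rcases lt_or_ge 0 α with hα | hα
  · rw [dom_of_pos hα] at *
    refine ⟨half_smul_add_mem hf.alphaConcave.1.closure hy hz, ?_⟩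
    by_contra! hlt
    have hmid : Continuous fun q : E n × E n => (2⁻¹ : ℝ) • (q.1 + q.2) := by fun_prop
    have hev : ∀ᶠ q in 𝓝 y ×ˢ 𝓝 z, f ((2⁻¹ : ℝ) • (q.1 + q.2)) < midMean α (f y) (f z) :=
      nhds_prod_eq (x := y) (y := z) ▸ (hmid.tendsto (y, z)).eventually (hf.usc _ _ hlt)
    have happrox : ∀ w ∈ closure (supp f), ∃ᶠ w' in 𝓝 w, w' ∈ supp f ∧ f w ≤ f w' := by
      intro w hw
      by_cases h0 : f w = 0
      · exact (mem_closure_iff_frequently.1 hw).mono fun w' hw' => ⟨hw', h0 ▸ zero_le⟩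
      · exact fun hcon => hcon.self_of_nhds ⟨pos_iff_ne_zero.2 h0, le_rfl⟩
    obtain ⟨P, hP, Q, hQ, hPQ⟩ := eventually_prod_iff.1 hev
    obtain ⟨y', ⟨hy', hyy'⟩, hPy⟩ := ((happrox y hy).and_eventually hP).exists
    obtain ⟨z', ⟨hz', hzz'⟩, hQz⟩ := ((happrox z hz).and_eventually hQ).exists
    exact (hPQ hPy hQz).not_ge
      ((alphaMean_mono α _ _ hyy' hzz').trans (hf.alphaConcave.midMean_le hy' hz'))
  · rw [dom_of_nonpos hα] at *
    exact ⟨half_smul_add_mem hf.alphaConcave.1 hy hz, hf.alphaConcave.midMean_le hy hz⟩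

end MemC

/-! ### Preservation of the mean width -/

section SupportFunction

variable {p : ℝ} {a b : ℝ≥0∞} {u : E n} {f : E n → ℝ≥0∞}

lemma baseVal_alphaMean {s t : ℝ≥0} (hst : s + t = 1) (ha : Admissible p a) (hb : Admissible p b) :
    baseVal p (alphaMean p s t a b) = s * baseVal p a + t * baseVal p b := by
  rcases eq_or_ne p 0 with rfl | hp
  · have ha0 := ENNReal.toReal_pos (ha.2 le_rfl) ha.1
    have hb0 := ENNReal.toReal_pos (hb.2 le_rfl) hb.1
    simp only [baseVal, if_true, EReal.coe_zero, alphaMean_zero, ENNReal.toReal_mul,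
      ← ENNReal.toReal_rpow]
    rw [Real.log_mul (by positivity) (by positivity), Real.log_rpow ha0, Real.log_rpow hb0]
    ring
  · have hst' : (s : ℝ) = 1 - t := eq_sub_of_add_eq (mod_cast hst)
    simp only [baseVal, if_neg hp]
    rw [ENNReal.toReal_rpow, alphaMean_coe hp, ENNReal.rpow_inv_rpow hp,
      ENNReal.toReal_add (ENNReal.mul_ne_top ENNReal.coe_ne_top ha.rpow_ne_top)
        (ENNReal.mul_ne_top ENNReal.coe_ne_top hb.rpow_ne_top),
      ENNReal.toReal_mul, ENNReal.toReal_mul, ← ENNReal.toReal_rpow, ← ENNReal.toReal_rpow,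
      ENNReal.coe_toReal, ENNReal.coe_toReal, hst']
    field_simp
    ring

lemma baseVal_anti (ha : Admissible p a) (hb : b ≠ ∞) (hab : a ≤ b) :
    baseVal p b ≤ baseVal p a := by
  have h := ENNReal.toReal_mono hb hab
  unfold baseVal
  split_ifs with hp
  · subst hp
    exact neg_le_neg (Real.log_le_log (ENNReal.toReal_pos (ha.2 le_rfl) ha.1) h)
  · rcases lt_or_gt_of_ne hp with hp | hp
    · exact div_le_div_of_nonpos_of_le hp.le (sub_le_sub_left
        (Real.rpow_le_rpow_of_nonpos (ENNReal.toReal_pos (ha.2 hp.le) ha.1) h hp.le) 1)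
    · gcongr

lemma le_alphaSupport (hf : ∀ x, f x < ∞) {y : E n} (hy : y ∈ dom p f) (ξ : E n) :
    ((inner ℝ ξ y - baseVal p (f y) : ℝ) : EReal) ≤ alphaSupport p f ξ := by
  refine le_iSup_of_le y ?_
  rw [base_of_mem_dom hf hy, EReal.coe_sub]

lemma alphaSupport_le (hf : ∀ x, f x < ∞) {ξ : E n} {c : EReal}
    (h : ∀ y ∈ dom p f, ((inner ℝ ξ y - baseVal p (f y) : ℝ) : EReal) ≤ c) :
    alphaSupport p f ξ ≤ c := by
  refine iSup_le fun y => ?_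
  by_cases hy : y ∈ dom p f
  · rw [base_of_mem_dom hf hy, ← EReal.coe_sub]
    exact h y hy
  · rw [base_of_notMem_dom hy, EReal.sub_top]
    exact bot_le

lemma continuous_coe_mul {c : ℝ} (hc : c ≠ 0) : Continuous fun t : EReal => (c : EReal) * t := by
  rw [continuous_iff_continuousAt]
  intro t
  have hc' : (c : EReal) ≠ 0 := mod_cast hc
  exact ContinuousAt.comp (f := fun t : EReal => ((c : EReal), t)) (x := t)
    (EReal.continuousAt_mul (.inl hc') (.inl hc') (.inl (EReal.coe_ne_bot _))
      (.inl (EReal.coe_ne_top _))) (by fun_prop)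

lemma monotone_coe_mul {c : ℝ} (hc : 0 ≤ c) : Monotone fun t : EReal => (c : EReal) * t :=
  fun _ _ h => mul_le_mul_of_nonneg_left h (mod_cast hc)

lemma exists_lt_of_lt_coe_mul_alphaSupport (hf : ∀ x, f x < ∞) {c : ℝ} (hc : 0 < c) {ξ : E n}
    {r : EReal} (hr : r < (c : EReal) * alphaSupport p f ξ) :
    ∃ y ∈ dom p f, r < ((c * (inner ℝ ξ y - baseVal p (f y)) : ℝ) : EReal) := by
  rw [alphaSupport, legendre, (monotone_coe_mul hc.le).map_iSup_of_continuousAt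
    (continuous_coe_mul hc.ne').continuousAt (EReal.coe_mul_bot_of_pos hc)] at hr
  obtain ⟨y, hy⟩ := lt_iSup_iff.1 hr
  by_cases hd : y ∈ dom p f
  · refine ⟨y, hd, ?_⟩
    simp only [base_of_mem_dom hf hd] at hy
    exact mod_cast hy
  · simp only [base_of_notMem_dom hd, EReal.sub_top, EReal.coe_mul_bot_of_pos hc] at hy
    exact absurd hy not_lt_bot

lemma inner_mixPt (u ξ y z : E n) : inner ℝ ξ (mixPt u (y, z)) =
    2⁻¹ * inner ℝ ξ y + 2⁻¹ * inner ℝ (reflIso u ξ) z := by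
  have hz : inner ℝ ξ (reflIso u z) = inner ℝ (reflIso u ξ) z := by
    rw [← (reflIso u).inner_map_map ξ, reflIso_reflIso]
  change inner ℝ ξ ((2⁻¹ : ℝ) • (y + reflIso u z)) = _
  rw [inner_smul_right, inner_add_right, hz]
  ring

lemma Tame.alphaSupport_symm_le (hu : ‖u‖ = 1) (hf : Tame p f) (ξ : E n) :
    alphaSupport p (symm p u f) ξ ≤ ((2⁻¹ : ℝ) : EReal) * alphaSupport p f ξ +
      ((2⁻¹ : ℝ) : EReal) * alphaSupport p f (reflIso u ξ) := by
  refine alphaSupport_le (hf.tame_symm hu).finite fun x hx => ?_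
  obtain ⟨y, hy, z, hz, rfl, hmean⟩ := hf.exists_eq hu hx
  have hmono := monotone_coe_mul (inv_nonneg.2 zero_le_two : (0 : ℝ) ≤ 2⁻¹)
  refine le_trans (le_of_eq ?_) (add_le_add (hmono (le_alphaSupport hf.finite hy ξ))
    (hmono (le_alphaSupport hf.finite hz (reflIso u ξ))))
  rw [hmean, baseVal_alphaMean half_add_half (admissible_of_mem_dom hf.finite hy)
    (admissible_of_mem_dom hf.finite hz), inner_mixPt]
  simp only [← EReal.coe_mul, ← EReal.coe_add, EReal.coe_eq_coe_iff, NNReal.coe_inv,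
    NNReal.coe_ofNat]
  ring

lemma Tame.le_alphaSupport_symm (hu : ‖u‖ = 1) (hf : Tame p f) (ξ : E n) :
    ((2⁻¹ : ℝ) : EReal) * alphaSupport p f ξ +
      ((2⁻¹ : ℝ) : EReal) * alphaSupport p f (reflIso u ξ) ≤ alphaSupport p (symm p u f) ξ := by
  have hhalf : (0 : ℝ) < 2⁻¹ := inv_pos.2 zero_lt_two
  refine EReal.add_le_of_forall_lt fun a ha b hb => ?_
  obtain ⟨y, hy, hay⟩ := exists_lt_of_lt_coe_mul_alphaSupport hf.finite hhalf ha
  obtain ⟨z, hz, hbz⟩ := exists_lt_of_lt_coe_mul_alphaSupport hf.finite hhalf hb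
  have hy' := admissible_of_mem_dom hf.finite hy
  have hz' := admissible_of_mem_dom hf.finite hz
  have hmean := hf.midMean_le_symm hu hy hz
  have hfin := (hf.tame_symm hu).finite
  have hadm : Admissible p (midMean p (f y) (f z)) :=
    ⟨(hmean.trans_lt (hfin _)).ne, fun hp => (alphaMean_pos _ half_add_half
      (pos_iff_ne_zero.2 (hy'.2 hp)) (pos_iff_ne_zero.2 (hz'.2 hp))).ne'⟩
  have hbase := baseVal_anti hadm (hfin _).ne hmean
  rw [baseVal_alphaMean half_add_half hy' hz', NNReal.coe_inv, NNReal.coe_ofNat] at hbase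
  refine (add_le_add hay.le hbz.le).trans
    (le_trans ?_ (le_alphaSupport hfin (hf.mixPt_mem_dom_symm hu hy hz) ξ))
  rw [inner_mixPt]
  norm_cast
  linarith

lemma measurable_legendre (ψ : E n → EReal) : Measurable (legendre ψ) := by
  refine (lowerSemicontinuous_iSup fun y => Continuous.lowerSemicontinuous ?_).measurable
  induction h : ψ y with
  | bot => simp only [EReal.coe_sub_bot]; exact continuous_const
  | top => simp only [EReal.sub_top]; exact continuous_const
  | coe r => simp only [← EReal.coe_sub]; exact continuous_coe_real_ereal.comp (by fun_prop)

end SupportFunction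

lemma toENNReal_add_add_neg {x y : EReal} (hx : x ≠ ⊥) (hy : y ≠ ⊥) :
    (x + y).toENNReal + ((-x).toENNReal + (-y).toENNReal) =
      (-(x + y)).toENNReal + (x.toENNReal + y.toENNReal) := by
  induction x with
  | bot => exact absurd rfl hx
  | top => simp [EReal.top_add_of_ne_bot hy]
  | coe x =>
    induction y with
    | bot => exact absurd rfl hy
    | top => simp
    | coe y =>
      have hpos (t : ℝ) : max t 0 = t + max (-t) 0 := by
        linarith [max_zero_sub_max_neg_zero_eq_self t]
      norm_cast
      simp only [EReal.toENNReal_of_ne_top (EReal.coe_ne_top _), EReal.toReal_coe]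
      rw [← ENNReal.toReal_eq_toReal_iff' (by finiteness) (by finiteness)]
      simp only [ENNReal.toReal_add, ENNReal.add_ne_top, ENNReal.ofReal_ne_top, ne_eq,
        not_false_eq_true, and_self, ENNReal.toReal_ofReal']
      linarith [hpos (x + y), hpos x, hpos y]

lemma toENNReal_half_mul (x : EReal) :
    (((2⁻¹ : ℝ) : EReal) * x).toENNReal = 2⁻¹ * x.toENNReal := by
  rw [EReal.toENNReal_mul (by norm_num), EReal.toENNReal_of_ne_top (EReal.coe_ne_top _),
    EReal.toReal_coe, ENNReal.ofReal_inv_of_pos zero_lt_two, ENNReal.ofReal_ofNat]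

lemma coe_half_mul_ne_bot {x : EReal} (hx : x ≠ ⊥) : ((2⁻¹ : ℝ) : EReal) * x ≠ ⊥ := by
  have hhalf : (0 : ℝ) < 2⁻¹ := inv_pos.2 zero_lt_two
  induction x with
  | bot => exact absurd rfl hx
  | top => rw [EReal.coe_mul_top_of_pos hhalf]; exact top_ne_bot
  | coe x => exact mod_cast EReal.coe_ne_bot _

/-- The mean of `h` and `h ∘ R`. -/
def halfSum {X : Type*} (R : X → X) (h : X → EReal) (x : X) : EReal :=
  ((2⁻¹ : ℝ) : EReal) * h x + ((2⁻¹ : ℝ) : EReal) * h (R x)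

section HalfSum

variable {X : Type*} [MeasurableSpace X] {μ : Measure X} {R : X → X} {h : X → EReal}

lemma lintegral_half_add_half_comp (hR : MeasurePreserving R μ μ) {F : X → ℝ≥0∞}
    (hF : Measurable F) : ∫⁻ x, (2⁻¹ * F x + 2⁻¹ * F (R x)) ∂μ = ∫⁻ x, F x ∂μ := by
  rw [lintegral_add_left (hF.const_mul _), lintegral_const_mul _ hF,
    lintegral_const_mul (f := fun x => F (R x)) _ (hF.comp hR.measurable),
    hR.lintegral_comp hF, ← add_mul, ENNReal.inv_two_add_inv_two, one_mul]

lemma measurable_halfSum (hR : Measurable R) (hm : Measurable h) : Measurable (halfSum R h) := by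
  have hhalf : Measurable fun x => ((2⁻¹ : ℝ) : EReal) * h x :=
    (continuous_coe_mul (inv_ne_zero two_ne_zero)).measurable.comp hm
  exact hhalf.add (hhalf.comp hR)

lemma lintegral_halfSum_add (hR : MeasurePreserving R μ μ) (hm : Measurable h)
    (hbot : ∀ x, h x ≠ ⊥) :
    ∫⁻ x, (halfSum R h x).toENNReal ∂μ + ∫⁻ x, (-h x).toENNReal ∂μ =
      ∫⁻ x, (-halfSum R h x).toENNReal ∂μ + ∫⁻ x, (h x).toENNReal ∂μ := by
  have hm' := measurable_halfSum hR.measurable hm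
  rw [← lintegral_half_add_half_comp hR (F := fun x => (-h x).toENNReal) (by fun_prop),
    ← lintegral_half_add_half_comp hR (F := fun x => (h x).toENNReal) (by fun_prop),
    ← lintegral_add_left (by fun_prop), ← lintegral_add_left (by fun_prop)]
  refine lintegral_congr fun x => ?_
  simp only [← toENNReal_half_mul, mul_neg]
  exact toENNReal_add_add_neg (coe_half_mul_ne_bot (hbot x)) (coe_half_mul_ne_bot (hbot (R x)))

lemma lintegral_halfSum_le (hR : MeasurePreserving R μ μ) (hm : Measurable h) :
    ∫⁻ x, (halfSum R h x).toENNReal ∂μ ≤ ∫⁻ x, (h x).toENNReal ∂μ := by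
  rw [← lintegral_half_add_half_comp hR (F := fun x => (h x).toENNReal) (by fun_prop)]
  simp only [← toENNReal_half_mul]
  exact lintegral_mono fun x => EReal.toENNReal_add_le

end HalfSum

lemma extIntegral_halfSum {μ : Measure (E n)} {R : E n → E n} {h : E n → EReal}
    (hR : MeasurePreserving R μ μ) (hm : Measurable h) (hbot : ∀ x, h x ≠ ⊥)
    (htop : ∫⁻ x, (h x).toENNReal ∂μ = ∞ → ∫⁻ x, (halfSum R h x).toENNReal ∂μ = ∞) :
    extIntegral μ (halfSum R h) = extIntegral μ h := by
  have hid := lintegral_halfSum_add hR hm hbot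
  have hle := lintegral_halfSum_le hR hm
  unfold extIntegral
  generalize ∫⁻ x, (halfSum R h x).toENNReal ∂μ = P' at *
  generalize ∫⁻ x, (h x).toENNReal ∂μ = P at *
  generalize ∫⁻ x, (-halfSum R h x).toENNReal ∂μ = N' at *
  generalize ∫⁻ x, (-h x).toENNReal ∂μ = N at *
  by_cases hP : P = ∞
  · rw [if_pos hP, if_pos (htop hP)]
  · have hP' : P' ≠ ∞ := (hle.trans_lt (lt_top_iff_ne_top.2 hP)).ne
    rw [if_neg hP, if_neg hP']
    by_cases hN : N = ∞
    · have hN' : N' = ∞ := by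
        rw [hN, add_top] at hid
        exact (ENNReal.add_eq_top.1 hid.symm).resolve_right hP
      rw [hN, hN', EReal.coe_ennreal_top, EReal.sub_top, EReal.sub_top]
    · have hN' : N' ≠ ∞ := by
        rintro rfl
        rw [top_add] at hid
        exact (ENNReal.add_ne_top.2 ⟨hP', hN⟩) hid
      lift P to ℝ≥0 using hP
      lift P' to ℝ≥0 using hP'
      lift N to ℝ≥0 using hN
      lift N' to ℝ≥0 using hN'
      have hdiff : (P' - N' : ℝ) = P - N := by
        have hid' : (P' : ℝ) + N = N' + P := mod_cast hid
        linarith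
      simpa only [EReal.coe_nnreal_eq_coe_real, ← EReal.coe_sub] using congrArg Real.toEReal hdiff

lemma le_halfSum_of_le {F : Type*} [NormedAddCommGroup F] [InnerProductSpace ℝ F]
    {R : F ≃ₗᵢ[ℝ] F} {h : F → EReal} {y : F} {c C : ℝ}
    (hlow : ∀ x, ((inner ℝ x y + c * ‖x‖ - C : ℝ) : EReal) ≤ h x) (x : F) :
    ((inner ℝ x ((2⁻¹ : ℝ) • (y + R.symm y)) + c * ‖x‖ - C : ℝ) : EReal) ≤ halfSum R h x := by
  have hmono := monotone_coe_mul (inv_nonneg.2 zero_le_two : (0 : ℝ) ≤ 2⁻¹)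
  refine le_trans (le_of_eq ?_) (add_le_add (hmono (hlow x)) (hmono (hlow (R x))))
  have hinner : inner ℝ (R x) y = inner ℝ x (R.symm y) := by
    rw [← R.inner_map_map x, R.apply_symm_apply]
  rw [hinner, R.norm_map, inner_smul_right, inner_add_right]
  simp only [← EReal.coe_mul, ← EReal.coe_add, EReal.coe_eq_coe_iff]
  ring

section NormGrowth

variable {F : Type*} [NormedAddCommGroup F] [MeasurableSpace F] [BorelSpace F] {μ : Measure F}

lemma lintegral_ofReal_mul_norm_add_lt_top (hball : ∀ r, μ (Metric.closedBall 0 r) < ∞) {c C : ℝ}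
    (hc : 0 < c) (hfin : ∫⁻ x, ENNReal.ofReal (c * ‖x‖ - C) ∂μ < ∞) (a b : ℝ) :
    ∫⁻ x, ENNReal.ofReal (a * ‖x‖ + b) ∂μ < ∞ := by
  set r := 2 * (|C| + 1) / c with hr
  set A := 2 * |a| / c + |b| with hA
  have hbound : ∀ x : F, ENNReal.ofReal (a * ‖x‖ + b) ≤ ENNReal.ofReal A *
      ENNReal.ofReal (c * ‖x‖ - C) +
      (Metric.closedBall 0 r).indicator (fun _ => ENNReal.ofReal (|a| * r + |b|)) x := by
    intro x
    have hlin : a * ‖x‖ + b ≤ |a| * ‖x‖ + |b| := by gcongr <;> exact le_abs_self _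
    by_cases hx : x ∈ Metric.closedBall (0 : F) r
    · rw [indicator_of_mem hx]
      rw [mem_closedBall_zero_iff] at hx
      refine le_add_of_nonneg_of_le zero_le (ENNReal.ofReal_le_ofReal (hlin.trans ?_))
      gcongr
    · rw [indicator_of_notMem hx, add_zero, ← ENNReal.ofReal_mul (by positivity)]
      rw [mem_closedBall_zero_iff, not_le, hr, div_lt_iff₀ hc] at hx
      have hbig : c * ‖x‖ / 2 + 1 ≤ c * ‖x‖ - C := by linarith [le_abs_self C]
      refine ENNReal.ofReal_le_ofReal ?_
      calc a * ‖x‖ + b ≤ |a| * ‖x‖ + |b| := hlin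
        _ ≤ A * (c * ‖x‖ / 2 + 1) := by
          have hcancel : 2 * |a| / c * (c * ‖x‖ / 2) = |a| * ‖x‖ := by field_simp
          have hrest : 0 ≤ 2 * |a| / c + |b| * (c * ‖x‖ / 2) := by positivity
          rw [hA]
          linarith [hcancel, hrest]
        _ ≤ A * (c * ‖x‖ - C) := by gcongr
  refine (lintegral_mono hbound).trans_lt ?_
  rw [lintegral_add_left (by fun_prop), lintegral_const_mul _ (by fun_prop),
    lintegral_indicator_const Metric.isClosed_closedBall.measurableSet]
  exact ENNReal.add_lt_top.2 ⟨ENNReal.mul_lt_top ENNReal.ofReal_lt_top hfin,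
    ENNReal.mul_lt_top ENNReal.ofReal_lt_top (hball r)⟩

variable [InnerProductSpace ℝ F] [SecondCountableTopology F]

lemma lintegral_ofReal_mul_norm_sub_le (hneg : MeasurePreserving (fun x : F => -x) μ μ) (y : F)
    (c C : ℝ) : ∫⁻ x, ENNReal.ofReal (c * ‖x‖ - C) ∂μ ≤
      2 * ∫⁻ x, ENNReal.ofReal (inner ℝ x y + c * ‖x‖ - C) ∂μ := by
  have hmeas : Measurable fun x : F => ENNReal.ofReal (inner ℝ x y + c * ‖x‖ - C) := by fun_prop
  nth_rewrite 1 [two_mul, ← hneg.lintegral_comp hmeas]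
  rw [← lintegral_add_right _ hmeas]
  refine lintegral_mono fun x => ?_
  rcases le_total 0 (inner ℝ x y) with hx | hx
  · exact le_add_of_nonneg_of_le zero_le (ENNReal.ofReal_le_ofReal (by linarith))
  · refine le_add_of_le_of_nonneg (ENNReal.ofReal_le_ofReal ?_) zero_le
    rw [inner_neg_left, norm_neg]
    linarith

/-- Averaging `h` with its reflection cannot make an infinite positive part finite: if it did, the
linear growth of `h` would make the norm integrable, so the negative part of `h` would be finite,
against the additivity of the integral. -/
lemma lintegral_halfSum_eq_top {R : F ≃ₗᵢ[ℝ] F} {h : F → EReal} (hR : MeasurePreserving R μ μ)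
    (hneg : MeasurePreserving (fun x : F => -x) μ μ) (hball : ∀ r, μ (Metric.closedBall 0 r) < ∞)
    (hm : Measurable h) {y : F} {c C : ℝ} (hc : 0 < c)
    (hlow : ∀ x, ((inner ℝ x y + c * ‖x‖ - C : ℝ) : EReal) ≤ h x)
    (htop : ∫⁻ x, (h x).toENNReal ∂μ = ∞) : ∫⁻ x, (halfSum R h x).toENNReal ∂μ = ∞ := by
  by_contra hfin
  have hbot : ∀ x, h x ≠ ⊥ := fun x hx => (EReal.bot_lt_coe _).not_ge (hx ▸ hlow x)
  have hgrowth : ∫⁻ x, ENNReal.ofReal (c * ‖x‖ - C) ∂μ < ∞ := by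
    refine (lintegral_ofReal_mul_norm_sub_le hneg ((2⁻¹ : ℝ) • (y + R.symm y)) c C).trans_lt
      (ENNReal.mul_lt_top ENNReal.ofNat_lt_top
        ((lintegral_mono fun x => ?_).trans_lt (lt_top_iff_ne_top.2 hfin)))
    simpa only [EReal.toENNReal_of_ne_top (EReal.coe_ne_top _), EReal.toReal_coe] using
      EReal.toENNReal_le_toENNReal (le_halfSum_of_le (R := R) hlow x)
  have hnegPart : ∫⁻ x, (-h x).toENNReal ∂μ < ∞ := by
    refine (lintegral_mono fun x => ?_).trans_lt
      (lintegral_ofReal_mul_norm_add_lt_top hball hc hgrowth (‖y‖ + |c|) C)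
    have hle : -h x ≤ (((‖y‖ + |c|) * ‖x‖ + C : ℝ) : EReal) := by
      rw [EReal.neg_le]
      refine le_trans ?_ (hlow x)
      norm_cast
      have hxy := neg_le_of_abs_le (abs_real_inner_le_norm x y)
      have hcx : -(|c| * ‖x‖) ≤ c * ‖x‖ := by rw [← neg_mul]; gcongr; exact neg_abs_le c
      linarith [hxy, hcx]
    simpa only [EReal.toENNReal_of_ne_top (EReal.coe_ne_top _), EReal.toReal_coe] using
      EReal.toENNReal_le_toENNReal hle
  have hid := lintegral_halfSum_add hR hm hbot
  rw [htop, add_top] at hid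
  exact (ENNReal.add_ne_top.2 ⟨hfin, hnegPart.ne⟩) hid

end NormGrowth

section LowerBounds

variable {α : EReal} {f : E n → ℝ≥0∞}

lemma AlphaConcave.convex_le (hf : AlphaConcave α f) {δ : ℝ≥0∞} (hδ : 0 < δ) :
    Convex ℝ {x | δ ≤ f x} := by
  intro x (hx : δ ≤ f x) y (hy : δ ≤ f y) a b ha hb hab
  lift a to ℝ≥0 using ha
  lift b to ℝ≥0 using hb
  have hab' : a + b = 1 := mod_cast hab
  exact (le_alphaMean α hab' hx hy).trans (hf.2 x (hδ.trans_le hx) y (hδ.trans_le hy) a b hab')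

lemma AlphaConcave.exists_closedBall (hf : AlphaConcave α f) (hdim : affineSpan ℝ (supp f) = ⊤) :
    ∃ y₀ : E n, ∃ c > 0, ∃ δ > 0, ∀ y ∈ Metric.closedBall y₀ c, δ ≤ f y := by
  obtain ⟨s, hs, b, hb⟩ := AffineBasis.exists_affine_subbasis hdim
  have : Finite s := b.finite
  have : Fintype s := Fintype.ofFinite s
  have : Nonempty s := b.nonempty
  obtain ⟨i₀, hi₀⟩ := Finite.exists_min fun i : s => f i
  have hδ : 0 < f i₀ := hs i₀.2
  have hsub : convexHull ℝ (range b) ⊆ {x | f i₀ ≤ f x} := by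
    refine convexHull_min ?_ (hf.convex_le hδ)
    rintro _ ⟨i, rfl⟩
    rw [hb]
    exact hi₀ i
  have hint := interior_mono hsub b.centroid_mem_interior_convexHull
  obtain ⟨c, hc, hball⟩ := Metric.nhds_basis_closedBall.mem_iff.1 (mem_interior_iff_mem_nhds.1 hint)
  exact ⟨_, c, hc, _, hδ, fun y hy => hball hy⟩

lemma MemC.exists_le_alphaSupport {p : ℝ} (hf : MemC p f) : ∃ y₀ : E n, ∃ c > 0, ∃ C : ℝ, ∀ ξ,
    ((inner ℝ ξ y₀ + c * ‖ξ‖ - C : ℝ) : EReal) ≤ alphaSupport p f ξ := by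
  obtain ⟨y₀, c, hc, δ, hδ, hball⟩ := hf.alphaConcave.exists_closedBall hf.full_dim
  refine ⟨y₀, c, hc, baseVal p δ, fun ξ => ?_⟩
  set y := y₀ + (c * ‖ξ‖⁻¹) • ξ with hy
  have hyball : y ∈ Metric.closedBall y₀ c := by
    rw [hy, mem_closedBall_iff_norm, add_sub_cancel_left, norm_smul,
      Real.norm_of_nonneg (by positivity), mul_assoc]
    exact mul_le_of_le_one_right hc.le inv_mul_le_one
  have hδy := hball y hyball
  have hbase : baseVal p (f y) ≤ baseVal p δ :=
    baseVal_anti ⟨(hδy.trans_lt (hf.finite y)).ne, fun _ => hδ.ne'⟩ (hf.finite y).ne hδy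
  have hinner : inner ℝ ξ y = inner ℝ ξ y₀ + c * ‖ξ‖ := by
    rw [hy, inner_add_right, inner_smul_right, real_inner_self_eq_norm_sq]
    rcases eq_or_ne ‖ξ‖ 0 with h | _
    · simp [h]
    · field_simp
  refine le_trans ?_ (le_alphaSupport hf.finite (supp_subset_dom _ _ (hδ.trans_le hδy)) ξ)
  norm_cast
  rw [hinner]
  linarith

end LowerBounds

section Weights

lemma measurePreserving_withDensity {X : Type*} [MeasurableSpace X] {μ : Measure X} {W : X → ℝ≥0∞}
    (hW : Measurable W) {T : X → X} (hT : MeasurePreserving T μ μ) (hWT : ∀ x, W (T x) = W x) :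
    MeasurePreserving T (μ.withDensity W) (μ.withDensity W) := by
  refine ⟨hT.measurable, Measure.ext fun s hs => ?_⟩
  rw [Measure.map_apply hT.measurable hs, withDensity_apply _ (hT.measurable hs),
    withDensity_apply _ hs, ← hT.setLIntegral_comp_preimage hs hW]
  simp only [hWT]

lemma MemC.extIntegral_alphaSupport_symm {p : ℝ} {u : E n} (hu : ‖u‖ = 1) {f : E n → ℝ≥0∞}
    (hf : MemC p f) {W : E n → ℝ≥0∞} (hW : Measurable W) (hrad : ∀ x y, ‖x‖ = ‖y‖ → W x = W y)
    (hball : ∀ r, (volume.withDensity W) (Metric.closedBall 0 r) < ∞) :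
    extIntegral (volume.withDensity W) (alphaSupport p (symm p u f)) =
      extIntegral (volume.withDensity W) (alphaSupport p f) := by
  have hsymm : alphaSupport p (symm p u f) = halfSum (reflIso u) (alphaSupport p f) :=
    funext fun ξ =>
      (hf.tame.alphaSupport_symm_le hu ξ).antisymm (hf.tame.le_alphaSupport_symm hu ξ)
  have hR := measurePreserving_withDensity hW (reflIso u).measurePreserving
    fun x => hrad _ _ ((reflIso u).norm_map x)
  have hneg := measurePreserving_withDensity hW
    (Measure.measurePreserving_neg (volume : Measure (E n))) fun x => hrad _ _ (norm_neg x)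
  obtain ⟨y, c, hc, C, hlow⟩ := hf.exists_le_alphaSupport
  have hm : Measurable (alphaSupport p f) := measurable_legendre _
  rw [hsymm]
  exact extIntegral_halfSum hR hm (fun x hx => (EReal.bot_lt_coe _).not_ge (hx ▸ hlow x))
    (lintegral_halfSum_eq_top hR hneg hball hm hc hlow)

lemma withDensity_closedBall_lt_top {X : Type*} [PseudoMetricSpace X] [ProperSpace X]
    [MeasurableSpace X] {μ : Measure X} [IsFiniteMeasureOnCompacts μ] [SFinite μ] {W : X → ℝ≥0∞}
    {C : ℝ≥0∞} (hC : C ≠ ∞) (h : ∀ x, W x ≤ C) (x : X) (r : ℝ) :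
    (μ.withDensity W) (Metric.closedBall x r) < ∞ := by
  rw [withDensity_apply']
  refine (lintegral_mono h).trans_lt ?_
  rw [lintegral_const, Measure.restrict_apply_univ]
  exact ENNReal.mul_lt_top hC.lt_top measure_closedBall_lt_top

lemma measurable_weight (α : ℝ) : Measurable (weight (n := n) α) := by
  unfold weight
  refine Measurable.ite (measurableSet_lt measurable_const (by fun_prop)) ?_ measurable_const
  exact ENNReal.measurable_ofReal.comp (Measurable.pow_const (by fun_prop) _)

lemma weight_le_one {α : ℝ} (hα0 : α ≠ 0) (hα : α ≤ 1) (x : E n) : weight α x ≤ 1 := by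
  unfold weight
  split_ifs with hx
  · rw [ENNReal.ofReal_le_one]
    rcases lt_or_gt_of_ne hα0 with hneg | hpos
    · refine Real.rpow_le_one_of_one_le_of_nonpos ?_
        (div_nonpos_of_nonneg_of_nonpos (sub_nonneg.2 hα) hneg.le)
      nlinarith [sq_nonneg ‖x‖]
    · refine Real.rpow_le_one hx.le ?_ (div_nonneg (sub_nonneg.2 hα) hpos.le)
      nlinarith [sq_nonneg ‖x‖]
  · exact zero_le

lemma integrableOn_rpow_sub {ρ s : ℝ} (hρ : 0 ≤ ρ) (hs : -1 < s) :
    IntegrableOn (fun r => (ρ - r) ^ s) (Ioo 0 ρ) := by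
  have h := (intervalIntegral.intervalIntegrable_rpow' hs (a := 0) (b := ρ)).comp_sub_left ρ
  rw [sub_zero, sub_self] at h
  rw [← integrableOn_Ioc_iff_integrableOn_Ioo, ← intervalIntegrable_iff_integrableOn_Ioc_of_le hρ]
  exact h.symm

lemma rpow_one_sub_sq_le {ρ r s : ℝ} (hs : s ≤ 0) (hr : r ∈ Ioo 0 ρ) :
    (1 - (r / ρ) ^ 2) ^ s ≤ ρ ^ (-s) * (ρ - r) ^ s := by
  have hρ := hr.1.trans hr.2
  have hsub := sub_pos.2 hr.2
  have hle : (ρ - r) / ρ ≤ 1 - (r / ρ) ^ 2 := by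
    have hlt : r / ρ < 1 := (div_lt_one hρ).2 hr.2
    rw [sub_div, div_self hρ.ne']
    nlinarith [div_pos hr.1 hρ]
  refine (Real.rpow_le_rpow_of_nonpos (div_pos hsub hρ) hle hs).trans_eq ?_
  rw [Real.div_rpow hsub.le hρ.le, Real.rpow_neg hρ.le, div_eq_inv_mul]

lemma integrableOn_pow_mul_rpow_one_sub_sq {ρ s : ℝ} (hρ : 0 ≤ ρ) (hs : -1 < s) (hs0 : s ≤ 0)
    (k : ℕ) : IntegrableOn (fun r => r ^ k * (1 - (r / ρ) ^ 2) ^ s) (Ioo 0 ρ) := by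
  have hdom : IntegrableOn (fun r => ρ ^ k * (ρ ^ (-s) * (ρ - r) ^ s)) (Ioo 0 ρ) :=
    ((integrableOn_rpow_sub hρ hs).const_mul _).const_mul _
  refine Integrable.mono' hdom (by fun_prop) ((ae_restrict_iff' measurableSet_Ioo).2 ?_)
  refine ae_of_all _ fun r hr => ?_
  have hlt : (r / ρ) ^ 2 ≤ 1 :=
    pow_le_one₀ (div_nonneg hr.1.le hρ) (div_le_one_of_le₀ hr.2.le hρ)
  have hnonneg := Real.rpow_nonneg (sub_nonneg.2 hlt) s
  rw [Real.norm_of_nonneg (mul_nonneg (pow_nonneg hr.1.le _) hnonneg)]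
  exact mul_le_mul (pow_le_pow_left₀ hr.1.le hr.2.le _) (rpow_one_sub_sq_le hs0 hr) hnonneg
    (pow_nonneg hρ _)

lemma weight_eq_indicator {α : ℝ} (hα : 0 < α) (x : E n) :
    weight α x = ENNReal.ofReal ((Iio √(2 / α)).indicator
      (fun r => (1 - (r / √(2 / α)) ^ 2) ^ ((1 - α) / α)) ‖x‖) := by
  have hsq : 1 - (‖x‖ / √(2 / α)) ^ 2 = 1 - α * ‖x‖ ^ 2 / 2 := by
    rw [div_pow, Real.sq_sqrt (by positivity)]
    field_simp
  have hiff : 0 < 1 - α * ‖x‖ ^ 2 / 2 ↔ ‖x‖ < √(2 / α) := by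
    rw [← hsq, sub_pos, sq_lt_one_iff₀ (by positivity), div_lt_one (by positivity)]
  simp only [weight, indicator, mem_Iio, hiff, hsq]
  split_ifs <;> simp only [ENNReal.ofReal_zero]

lemma lintegral_weight_lt_top [Nontrivial (E n)] {α : ℝ} (hα : 1 < α) :
    ∫⁻ x : E n, weight α x < ∞ := by
  have hα0 : 0 < α := zero_lt_one.trans hα
  have hs : -1 < (1 - α) / α := by rw [lt_div_iff₀ hα0]; linarith
  have hs0 : (1 - α) / α ≤ 0 := div_nonpos_of_nonpos_of_nonneg (sub_nonpos.2 hα.le) hα0.le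
  simp only [weight_eq_indicator hα0]
  refine Integrable.lintegral_lt_top ?_
  rw [integrable_fun_norm_addHaar, IntegrableOn]
  simp only [smul_eq_mul]
  refine (integrable_congr (ae_of_all _ fun r => indicator_mul_right _ (· ^ _) _)).1 ?_
  rw [integrable_indicator_iff measurableSet_Iio, IntegrableOn,
    Measure.restrict_restrict measurableSet_Iio, inter_comm, Ioi_inter_Iio]
  exact integrableOn_pow_mul_rpow_one_sub_sq (Real.sqrt_nonneg _) hs hs0 _

lemma MemC.alphaMeanWidth_symm_zero {u : E n} (hu : ‖u‖ = 1) {f : E n → ℝ≥0∞} (hf : MemC 0 f) :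
    alphaMeanWidth 0 (symm 0 u f) = alphaMeanWidth 0 f := by
  simp only [alphaMeanWidth, EReal.zero_ne_bot, EReal.zero_ne_top, if_false, if_true]
  congr 1
  refine hf.extIntegral_alphaSupport_symm hu (by fun_prop) (fun x y h => by rw [h])
    (withDensity_closedBall_lt_top
      (C := ENNReal.ofReal ((2 * Real.pi) ^ (-(n : ℝ) / 2))) ENNReal.ofReal_ne_top (fun x => ?_) 0)
  refine ENNReal.ofReal_le_ofReal (mul_le_of_le_one_right (by positivity) ?_)
  exact Real.exp_le_one_iff.2 (by linarith [sq_nonneg ‖x‖])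

lemma MemC.alphaMeanWidth_symm_coe {p : ℝ} (hp : p ≠ 0) {u : E n} (hu : ‖u‖ = 1)
    {f : E n → ℝ≥0∞} (hf : MemC p f) : alphaMeanWidth p (symm p u f) = alphaMeanWidth p f := by
  have : Nontrivial (E n) := ⟨u, 0, norm_ne_zero_iff.1 (hu ▸ one_ne_zero)⟩
  simp only [alphaMeanWidth, EReal.coe_ne_bot, EReal.coe_ne_top, EReal.coe_eq_zero, hp, if_false,
    EReal.toReal_coe]
  refine hf.extIntegral_alphaSupport_symm hu (measurable_weight p)
    (fun x y h => by simp only [weight, h]) ?_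
  rcases le_or_gt p 1 with hp1 | hp1
  · exact withDensity_closedBall_lt_top ENNReal.one_ne_top (weight_le_one hp hp1) 0
  · refine fun r => (measure_mono (subset_univ _)).trans_lt ?_
    rw [withDensity_apply _ MeasurableSet.univ, setLIntegral_univ]
    exact lintegral_weight_lt_top hp1

end Weights

section MeanWidthOfSets

variable {u : E n} {K : Set (E n)}

/-- The action of a linear isometry on the unit sphere. -/
def sphereMap (R : E n ≃ₗᵢ[ℝ] E n) (v : Metric.sphere (0 : E n) 1) : Metric.sphere (0 : E n) 1 :=
  ⟨R v, by simp⟩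

lemma continuous_sphereMap (R : E n ≃ₗᵢ[ℝ] E n) : Continuous (sphereMap R) := by
  unfold sphereMap; fun_prop

lemma measurePreserving_sphereMap (R : E n ≃ₗᵢ[ℝ] E n) :
    MeasurePreserving (sphereMap R) (volume : Measure (E n)).toSphere
      (volume : Measure (E n)).toSphere := by
  refine ⟨(continuous_sphereMap R).measurable, Measure.ext fun s hs => ?_⟩
  have hsurj : Function.Surjective (sphereMap R) := fun v =>
    ⟨sphereMap R.symm v, Subtype.ext (R.apply_symm_apply v)⟩
  have hcone : Ioo (0 : ℝ) 1 • Subtype.val '' s =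
      R.symm ⁻¹' (Ioo (0 : ℝ) 1 • Subtype.val '' (sphereMap R ⁻¹' s)) := by
    rw [← show R '' _ = R.symm ⁻¹' _ from R.toEquiv.image_eq_preimage_symm _, ← image2_smul, ←
      image2_smul,
      image_image2_distrib_right (f' := (· • ·)) (g' := R) fun r x => R.map_smul r x, image_image]
    conv_lhs => rw [← image_preimage_eq s hsurj, image_image]
    rfl
  rw [Measure.map_apply (continuous_sphereMap R).measurable hs,
    Measure.toSphere_apply' _ ((continuous_sphereMap R).measurable hs),
    Measure.toSphere_apply' _ hs, hcone]
  congr 1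
  exact (R.symm.measurePreserving.measure_preimage_equiv
    (f := R.symm.toMeasurableEquiv) _).symm

lemma suppFun_eq_of_isMaxOn {v x : E n} (hx : x ∈ K) (h : IsMaxOn (fun y => inner ℝ y v) K x) :
    suppFun K v = inner ℝ x v :=
  IsGreatest.csSup_eq ⟨mem_image_of_mem _ hx, forall_mem_image.2 h⟩

lemma suppFun_symmSet (hu : ‖u‖ = 1) (hK : IsCompact K) (v : E n) :
    suppFun (symmSet u K) v = 2⁻¹ * suppFun K v + 2⁻¹ * suppFun K (reflIso u v) := by
  rcases K.eq_empty_or_nonempty with rfl | hne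
  · simp [symmSet, suppFun]
  have hmax (v : E n) : ∃ x ∈ K, IsMaxOn (fun x => inner ℝ x v) K x :=
    hK.exists_isMaxOn hne (by fun_prop)
  obtain ⟨x, hx, hxmax⟩ := hmax v
  obtain ⟨z, hz, hzmax⟩ := hmax (reflIso u v)
  have hinner (z : E n) : inner ℝ (reflIso u z) v = inner ℝ z (reflIso u v) := by
    rw [← (reflIso u).inner_map_map z, reflIso_reflIso]
  rw [suppFun_eq_of_isMaxOn hx hxmax, suppFun_eq_of_isMaxOn hz hzmax, symmSet, reflPt_eq hu,
    suppFun_eq_of_isMaxOn (x := (1 / 2 : ℝ) • x + (1 / 2 : ℝ) • reflIso u z)]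
  · rw [inner_add_left, real_inner_smul_left, real_inner_smul_left, hinner, one_div]
  · exact add_mem_add (smul_mem_smul_set hx) (smul_mem_smul_set (mem_image_of_mem _ hz))
  · rintro _ ⟨_, ⟨y, hy, rfl⟩, _, ⟨_, ⟨y', hy', rfl⟩, rfl⟩, rfl⟩
    have hyx : inner ℝ y v ≤ inner ℝ x v := hxmax hy
    have hyz : inner ℝ y' (reflIso u v) ≤ inner ℝ z (reflIso u v) := hzmax hy'
    simp only [mem_ofPred_eq, inner_add_left, real_inner_smul_left, hinner]
    linarith

lemma meanWidth_symmSet (hu : ‖u‖ = 1) (hK : IsCompact K) :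
    meanWidth (symmSet u K) = meanWidth K := by
  set σ := (volume : Measure (E n)).toSphere
  have hcont : Continuous (suppFun K) :=
    hK.continuous_sSup (f := fun (v : E n) x => inner ℝ x v) (continuous_snd.inner continuous_fst)
  have hint {F : Metric.sphere (0 : E n) 1 → ℝ} (hF : Continuous F) : Integrable F σ := by
    rw [← integrableOn_univ]
    exact hF.continuousOn.integrableOn_compact isCompact_univ
  have hrefl : ∫ v : Metric.sphere (0 : E n) 1, suppFun K (reflIso u v) ∂σ =
      ∫ v : Metric.sphere (0 : E n) 1, suppFun K v ∂σ := by
    have hmp : MeasurePreserving (sphereMap (reflIso u)) σ σ := measurePreserving_sphereMap _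
    conv_rhs => rw [← hmp.map_eq]
    exact (integral_map hmp.measurable.aemeasurable
      (hcont.comp continuous_subtype_val).aestronglyMeasurable).symm
  simp only [meanWidth, suppFun_symmSet hu hK, average_eq]
  rw [integral_add ((hint (by fun_prop)).const_mul _) ((hint (by fun_prop)).const_mul _),
    integral_const_mul, integral_const_mul, hrefl, ← add_mul]
  norm_num [σ]

lemma MemC.alphaMeanWidth_symm_bot (hu : ‖u‖ = 1) {f : E n → ℝ≥0∞} (hf : MemC ⊥ f) :
    alphaMeanWidth ⊥ (symm ⊥ u f) = alphaMeanWidth ⊥ f := by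
  simp only [alphaMeanWidth, if_true]
  congr 1
  refine setLIntegral_congr_fun measurableSet_Ioi fun t (ht : 0 < t) => ?_
  have hcompact : IsCompact (superlevel t f) := isCompact_le_of_tendsto_zero hf.usc
    hf.tendsto_zero (ENNReal.ofReal_pos.2 ht)
  rw [superlevel_symm_bot hu hf.tame ht, meanWidth_symmSet hu hcompact]

end MeanWidthOfSets

lemma MemC.alphaMeanWidth_symm {α : EReal} (hα : α ≠ ⊤) {u : E n} (hu : ‖u‖ = 1)
    {f : E n → ℝ≥0∞} (hf : MemC α f) : alphaMeanWidth α (symm α u f) = alphaMeanWidth α f := by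
  induction α using exponent_cases with
  | hbot => exact hf.alphaMeanWidth_symm_bot hu
  | htop => exact absurd rfl hα
  | hzero => exact hf.alphaMeanWidth_symm_zero hu
  | hcoe p hp => exact hf.alphaMeanWidth_symm_coe hp hu

/-! ### The mass inequality -/

section Mass

lemma lintegral_toLp (f : E n → ℝ≥0∞) :
    ∫⁻ x : Fin n → ℝ, f (WithLp.toLp 2 x) = ∫⁻ x, f x :=
  (EuclideanSpace.volume_preserving_symm_measurableEquiv_toLp (Fin n)).symm.lintegral_comp_emb
    (MeasurableEquiv.measurableEmbedding _) f

lemma lintegral_comp_linearIsometryEquiv (R : E n ≃ₗᵢ[ℝ] E n) (f : E n → ℝ≥0∞) :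
    ∫⁻ x, f (R x) = ∫⁻ x, f x :=
  R.measurePreserving.lintegral_comp_emb R.toHomeomorph.measurableEmbedding f

lemma borell_brascamp_lieb_euclidean {p : ℝ} (hp0 : p ≤ 0) (hnp : 0 ≤ 1 + n * p) {s t : ℝ≥0}
    (hs : s ≠ 0) (ht : t ≠ 0) (hst : s + t = 1) {f g h : E n → ℝ≥0∞} (hf : Measurable f)
    (hg : Measurable g) (hh : Measurable h)
    (hle : ∀ x y, alphaMean p s t (f x) (g y) ≤ h ((s : ℝ) • x + (t : ℝ) • y)) :
    alphaMean (marginalExponent n p) s t (∫⁻ x, f x) (∫⁻ x, g x) ≤ ∫⁻ x, h x := by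
  have htoLp : Measurable fun x : Fin n → ℝ => (WithLp.toLp 2 x : E n) := WithLp.measurable_toLp 2 _
  rw [← lintegral_toLp f, ← lintegral_toLp g, ← lintegral_toLp h]
  exact borell_brascamp_lieb hp0 hnp hs ht hst (hf.comp htoLp) (hg.comp htoLp) (hh.comp htoLp)
    fun x y => hle _ _

variable {α : EReal} {u : E n} {f : E n → ℝ≥0∞}

namespace Tame

lemma alphaMean_le_symm_of_nonpos (hu : ‖u‖ = 1) (hf : Tame α f) {β : EReal} (hβ : β ≤ 0)
    (hβα : β ≤ α) (y z : E n) :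
    midMean β (f y) (f (reflIso u z)) ≤ symm α u f ((2⁻¹ : ℝ) • y + (2⁻¹ : ℝ) • z) := by
  have h2 : (2⁻¹ : ℝ≥0) ≠ 0 := by norm_num
  rcases eq_or_ne (f y) 0 with hy | hy
  · rw [hy, alphaMean_zero_left hβ h2]
    exact zero_le
  rcases eq_or_ne (f (reflIso u z)) 0 with hz | hz
  · rw [hz, alphaMean_zero_right hβ h2]
    exact zero_le
  have h := midMean_le_symm hu hf (supp_subset_dom _ _ (pos_iff_ne_zero.2 hy))
    (supp_subset_dom _ _ (pos_iff_ne_zero.2 hz))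
  rw [mixPt, reflIso_reflIso, smul_add] at h
  exact (alphaMean_mono_exponent hβα half_add_half (hf.finite _).ne (hf.finite _).ne).trans h

lemma mass_le_mass_symm (hu : ‖u‖ = 1) (hf : Tame α f)
    (hα : ((-(1 / (n : ℝ)) : ℝ) : EReal) ≤ α) : mass f ≤ mass (symm α u f) := by
  have hn : (n : ℝ) ≠ 0 := by
    rintro hn
    obtain rfl := Nat.cast_eq_zero.1 hn
    rw [Subsingleton.elim u 0, norm_zero] at hu
    exact zero_ne_one hu
  have hp : -(1 / (n : ℝ)) ≤ 0 := neg_nonpos.2 (by positivity)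
  have hnp : 1 + n * -(1 / (n : ℝ)) = 0 := by field_simp; ring
  have h := borell_brascamp_lieb_euclidean hp hnp.ge (by norm_num) (by norm_num) half_add_half
    hf.usc.measurable (hf.usc.measurable.comp (reflIso u).continuous.measurable)
    (hf.tame_symm hu).usc.measurable
    fun y z => hf.alphaMean_le_symm_of_nonpos hu (EReal.coe_nonpos.2 hp) hα y z
  simp only [Function.comp_apply] at h
  rwa [lintegral_comp_linearIsometryEquiv, alphaMean_self _ half_add_half] at h

end Tame

end Mass

/-! ### Equality in the Prékopa–Leindler inequality -/

section LogConcave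

/-- Log-concavity of a function with values in `[0, ∞]` on a real vector space. -/
def LogConcave {V : Type*} [AddCommGroup V] [Module ℝ V] (F : V → ℝ≥0∞) : Prop :=
  ∀ x y, ∀ s t : ℝ≥0, s + t = 1 →
    alphaMean 0 s t (F x) (F y) ≤ F ((s : ℝ) • x + (t : ℝ) • y)

lemma LogConcave.convex_pos {V : Type*} [AddCommGroup V] [Module ℝ V] {F : V → ℝ≥0∞}
    (hF : LogConcave F) : Convex ℝ {x | 0 < F x} := by
  intro x hx y hy s t hs ht hst
  lift s to ℝ≥0 using hs
  lift t to ℝ≥0 using ht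
  have hst' : s + t = 1 := mod_cast hst
  exact (alphaMean_pos 0 hst' hx hy).trans_le (hF x y s t hst')

lemma LogConcave.concaveOn_log {V : Type*} [AddCommGroup V] [Module ℝ V] {F : V → ℝ≥0∞}
    (hF : LogConcave F) (hfin : ∀ x, F x < ∞) {S : Set V} (hS : Convex ℝ S)
    (hpos : ∀ x ∈ S, 0 < F x) : ConcaveOn ℝ S fun x => Real.log (F x).toReal := by
  have hpos' : ∀ x ∈ S, 0 < (F x).toReal := fun x hx =>
    ENNReal.toReal_pos (hpos x hx).ne' (hfin x).ne
  refine ⟨hS, fun x hx y hy s t hs ht hst => ?_⟩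
  lift s to ℝ≥0 using hs
  lift t to ℝ≥0 using ht
  have h := ENNReal.toReal_mono (hfin _).ne (hF x y s t (mod_cast hst))
  rw [alphaMean_zero, ENNReal.toReal_mul, ← ENNReal.toReal_rpow, ← ENNReal.toReal_rpow] at h
  have hx' := Real.rpow_pos_of_pos (hpos' x hx) s
  have hy' := Real.rpow_pos_of_pos (hpos' y hy) t
  have hlog := Real.log_le_log (mul_pos hx' hy') h
  rwa [Real.log_mul hx'.ne' hy'.ne', Real.log_rpow (hpos' x hx), Real.log_rpow (hpos' y hy)] at hlog

variable {F : ℝ → ℝ≥0∞}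

lemma LogConcave.lt_top (hF : LogConcave F) (h0 : ∫⁻ x, F x ≠ 0) (hI : ∫⁻ x, F x ≠ ∞) (x : ℝ) :
    F x < ∞ := by
  by_contra! hx
  rw [top_le_iff] at hx
  obtain ⟨y, hy, hxy⟩ : ∃ y, F y ≠ 0 ∧ y ≠ x := by
    by_contra! h
    refine h0 (lintegral_eq_zero_of_ae_eq_zero ?_)
    filter_upwards [Measure.ae_ne volume x] with y hy
    exact not_imp_comm.1 (h y) hy
  have htop : ∀ z ∈ openSegment ℝ x y, F z = ∞ := by
    rintro z ⟨s, t, hs, ht, hst, rfl⟩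
    lift s to ℝ≥0 using hs.le
    lift t to ℝ≥0 using ht.le
    have h := hF x y s t (mod_cast hst)
    rwa [alphaMean_zero, hx, ENNReal.top_rpow_of_pos hs,
      ENNReal.top_mul (ENNReal.rpow_pos_of_nonneg (pos_iff_ne_zero.2 hy) t.coe_nonneg).ne',
      top_le_iff] at h
  rw [openSegment_eq_Ioo' hxy.symm] at htop
  refine hI (top_le_iff.1 ?_)
  have hvol : volume (Ioo (min x y) (max x y)) ≠ 0 := by
    simpa using fun h : y ≤ x => lt_of_le_of_ne h hxy
  calc ∞ = ∫⁻ _ in Ioo (min x y) (max x y), ∞ := by rw [setLIntegral_const, ENNReal.top_mul hvol]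
    _ = ∫⁻ z in Ioo (min x y) (max x y), F z :=
      setLIntegral_congr_fun measurableSet_Ioo fun z hz => (htop z hz).symm
    _ ≤ ∫⁻ z, F z := setLIntegral_le_lintegral _ _

lemma LogConcave.continuousAt (hF : LogConcave F) (hfin : ∀ x, F x < ∞) {x a b : ℝ} (ha : 0 < F a)
    (hb : 0 < F b) (hx : x ∈ Ioo a b) : ContinuousAt F x := by
  have hpos : ∀ y ∈ Ioo a b, 0 < F y := fun y hy =>
    hF.convex_pos.ordConnected.out ha hb (Ioo_subset_Icc_self hy)
  have hc := ((hF.concaveOn_log hfin (convex_Ioo a b) hpos).continuousOn isOpen_Ioo).continuousAt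
    (isOpen_Ioo.mem_nhds hx)
  refine (ENNReal.continuous_ofReal.continuousAt.comp
    (Real.continuous_exp.continuousAt.comp hc)).congr ?_
  filter_upwards [isOpen_Ioo.mem_nhds hx] with y hy
  rw [Function.comp_apply, Function.comp_apply,
    Real.exp_log (ENNReal.toReal_pos (hpos y hy).ne' (hfin y).ne),
    ENNReal.ofReal_toReal (hfin y).ne]

end LogConcave

section DistributionFunction

variable {φ : ℝ → ℝ}

lemma integral_Iic_eq_add (hφ : Integrable φ) (s : ℝ) :
    ∫ r in Iic s, φ r = (∫ r in (0)..s, φ r) + ∫ r in Iic 0, φ r := by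
  rw [← intervalIntegral.integral_Iic_sub_Iic hφ.integrableOn hφ.integrableOn, sub_add_cancel]

lemma exists_integral_Iic_eq (hφ : Integrable φ) {p : ℝ} (hp : p ∈ Ioo 0 (∫ r, φ r)) :
    ∃ s, ∫ r in Iic s, φ r = p := by
  have hcont : Continuous fun s => ∫ r in Iic s, φ r := by
    rw [funext (integral_Iic_eq_add hφ)]
    exact (intervalIntegral.continuous_primitive (fun a b => hφ.intervalIntegrable) 0).add_const _
  have htop : Tendsto (fun s => ∫ r in Iic s, φ r) atTop (𝓝 (∫ r, φ r)) :=
    (aecover_Iic tendsto_id).integral_tendsto_of_countably_generated hφ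
  exact mem_range_of_exists_le_of_exists_ge hcont
    ((tendsto_integral_Iic_zero tendsto_id).eventually_le_const hp.1).exists
    (htop.eventually_const_le hp.2).exists

lemma hasDerivAt_integral_Iic (hφ : Integrable φ) {s : ℝ} (hc : ContinuousAt φ s) :
    HasDerivAt (fun s => ∫ r in Iic s, φ r) (φ s) s := by
  rw [funext (integral_Iic_eq_add hφ)]
  exact (intervalIntegral.integral_hasDerivAt_right hφ.intervalIntegrable
    hφ.aestronglyMeasurable.stronglyMeasurableAtFilter hc).add_const _

lemma hasDerivAt_of_rightInverse_of_monotone {Φ x : ℝ → ℝ} {φ' p : ℝ} (hΦ : Monotone Φ)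
    (hx : ∀ᶠ q in 𝓝 p, Φ (x q) = q) (hd : HasDerivAt Φ φ' (x p)) (hφ' : 0 < φ') :
    HasDerivAt x φ'⁻¹ p := by
  have hp : Φ (x p) = p := hx.self_of_nhds
  have hslope := (hasDerivAt_iff_tendsto_slope.1 hd).eventually (lt_mem_nhds hφ')
  have hbelow : ∀ c < x p, Φ c < p := fun c hc => by
    obtain ⟨r, hr, hcr⟩ := ((hslope.filter_mono (nhdsLT_le_nhdsNE _)).and
      (Ioo_mem_nhdsLT hc)).exists
    rw [slope_comm, slope_pos_iff hcr.2, hp] at hr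
    exact (hΦ hcr.1.le).trans_lt hr
  have habove : ∀ c, x p < c → p < Φ c := fun c hc => by
    obtain ⟨r, hr, hcr⟩ := ((hslope.filter_mono (nhdsGT_le_nhdsNE _)).and
      (Ioo_mem_nhdsGT hc)).exists
    rw [slope_pos_iff hcr.1, hp] at hr
    exact hr.trans_le (hΦ hcr.2.le)
  refine HasDerivAt.of_local_left_inverse (tendsto_order.2 ⟨fun c hc => ?_, fun c hc => ?_⟩) hd
    hφ'.ne' hx
  · filter_upwards [hx, lt_mem_nhds (hbelow c hc)] with q hq hcq
    exact hΦ.reflect_lt (hcq.trans_eq hq.symm)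
  · filter_upwards [hx, gt_mem_nhds (habove c hc)] with q hq hqc
    exact hΦ.reflect_lt (hq.trans_lt hqc)

end DistributionFunction

section Quantile

variable {F G : ℝ → ℝ≥0∞} {I : ℝ}

/-- The quantile function `x` of a density `F` on the line of total mass `I`, in the regular case
where `F` is continuous and positive at every quantile `x p`, `0 < p < I`. -/
structure IsRegularQuantile (F : ℝ → ℝ≥0∞) (I : ℝ) (x : ℝ → ℝ) : Prop where
  lintegral_Iic : ∀ p ∈ Ioo 0 I, ∫⁻ r in Iic (x p), F r = ENNReal.ofReal p
  density_pos : ∀ p ∈ Ioo 0 I, 0 < F (x p)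
  density_lt_top : ∀ p ∈ Ioo 0 I, F (x p) < ∞
  continuousAt_density : ∀ p ∈ Ioo 0 I, ContinuousAt F (x p)
  hasDerivAt : ∀ p ∈ Ioo 0 I, HasDerivAt x (F (x p)).toReal⁻¹ p

lemma exists_lt_lt_of_lintegral_Iic (hF : Measurable F) (hint : ∫⁻ x, F x = ENNReal.ofReal I)
    {p s : ℝ} (hp : p ∈ Ioo 0 I) (hs : ∫⁻ r in Iic s, F r = ENNReal.ofReal p) :
    ∃ a b, s ∈ Ioo a b ∧ 0 < F a ∧ 0 < F b := by
  have hleft : 0 < ∫⁻ r in Iio s, F r := by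
    rw [setLIntegral_congr Iio_ae_eq_Iic, hs]
    exact ENNReal.ofReal_pos.2 hp.1
  have hright : 0 < ∫⁻ r in Ioi s, F r := by
    by_contra! h
    have hsplit := lintegral_add_compl (μ := volume) F (measurableSet_Iic (a := s))
    rw [compl_Iic, hs, nonpos_iff_eq_zero.1 h, add_zero, hint,
      ENNReal.ofReal_eq_ofReal_iff hp.1.le (hp.1.trans hp.2).le] at hsplit
    exact hp.2.ne hsplit
  rw [setLIntegral_pos_iff hF] at hleft hright
  obtain ⟨a, ha, has⟩ := nonempty_of_measure_ne_zero hleft.ne'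
  obtain ⟨b, hb, hsb⟩ := nonempty_of_measure_ne_zero hright.ne'
  exact ⟨a, b, ⟨has, hsb⟩, pos_iff_ne_zero.2 ha, pos_iff_ne_zero.2 hb⟩

lemma LogConcave.exists_isRegularQuantile (hFc : LogConcave F) (hF : Measurable F) (hI : 0 < I)
    (hint : ∫⁻ x, F x = ENNReal.ofReal I) : ∃ x, IsRegularQuantile F I x := by
  have hIt : ∫⁻ x, F x ≠ ∞ := hint ▸ ENNReal.ofReal_ne_top
  have hfin := hFc.lt_top (hint ▸ (ENNReal.ofReal_pos.2 hI).ne') hIt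
  have hφ : Integrable fun r => (F r).toReal :=
    integrable_toReal_of_lintegral_ne_top hF.aemeasurable hIt
  have htot : ∫ r, (F r).toReal = I := by
    rw [integral_toReal hF.aemeasurable (.of_forall hfin), hint, ENNReal.toReal_ofReal hI.le]
  choose! x hx using fun p hp => exists_integral_Iic_eq (p := p) hφ (htot.symm ▸ hp)
  have hmass : ∀ p ∈ Ioo 0 I, ∫⁻ r in Iic (x p), F r = ENNReal.ofReal p := fun p hp => by
    rw [← ENNReal.ofReal_toReal ((setLIntegral_le_lintegral _ _).trans_lt hIt.lt_top).ne,
      ← integral_toReal hF.aemeasurable (.of_forall hfin), hx p hp]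
  have hinterior : ∀ p ∈ Ioo 0 I, ∃ a b, x p ∈ Ioo a b ∧ 0 < F a ∧ 0 < F b := fun p hp =>
    exists_lt_lt_of_lintegral_Iic hF hint hp (hmass p hp)
  have hpos : ∀ p ∈ Ioo 0 I, 0 < F (x p) := fun p hp => by
    obtain ⟨a, b, hab, ha, hb⟩ := hinterior p hp
    exact hFc.convex_pos.ordConnected.out ha hb (Ioo_subset_Icc_self hab)
  have hcont : ∀ p ∈ Ioo 0 I, ContinuousAt F (x p) := fun p hp => by
    obtain ⟨a, b, hab, ha, hb⟩ := hinterior p hp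
    exact hFc.continuousAt hfin ha hb hab
  have hmono : Monotone fun s => ∫ r in Iic s, (F r).toReal := fun a b hab =>
    setIntegral_mono_set hφ.integrableOn (.of_forall fun _ => ENNReal.toReal_nonneg)
      (Iic_subset_Iic.2 hab).eventuallyLE
  refine ⟨x, hmass, hpos, fun p _ => hfin _, hcont, fun p hp => ?_⟩
  refine hasDerivAt_of_rightInverse_of_monotone hmono ?_ (hasDerivAt_integral_Iic hφ ?_)
    (ENNReal.toReal_pos (hpos p hp).ne' (hfin _).ne)
  · filter_upwards [isOpen_Ioo.mem_nhds hp] with q hq using hx q hq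
  · exact (ENNReal.tendsto_toReal (hfin _).ne).comp (hcont p hp)

namespace IsRegularQuantile

variable {x y : ℝ → ℝ}

lemma lintegral_Ioi (hx : IsRegularQuantile F I x) (hint : ∫⁻ x, F x = ENNReal.ofReal I) {p : ℝ}
    (hp : p ∈ Ioo 0 I) : ∫⁻ r in Ioi (x p), F r = ENNReal.ofReal (I - p) := by
  have hsplit := lintegral_add_compl (μ := volume) F (measurableSet_Iic (a := x p))
  rw [compl_Iic, hx.lintegral_Iic p hp, hint] at hsplit
  rw [ENNReal.ofReal_sub _ hp.1.le, ← hsplit,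
    ENNReal.add_sub_cancel_left ENNReal.ofReal_ne_top]

lemma strictMonoOn (hx : IsRegularQuantile F I x) : StrictMonoOn x (Ioo 0 I) := by
  intro p hp q hq hpq
  by_contra! h
  have hle : ∫⁻ r in Iic (x q), F r ≤ ∫⁻ r in Iic (x p), F r :=
    lintegral_mono_set (Iic_subset_Iic.2 h)
  rw [hx.lintegral_Iic p hp, hx.lintegral_Iic q hq, ENNReal.ofReal_le_ofReal_iff hp.1.le] at hle
  exact hpq.not_ge hle

lemma eventually_mul_le (hx : IsRegularQuantile F I x) {p : ℝ} (hp : p ∈ Ioo 0 I) {θ : ℝ≥0∞}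
    (hθ : θ < 1) : ∀ᶠ q in 𝓝[>] p, ∀ r ∈ Icc (x p) (x q), θ * F (x p) ≤ F r := by
  have hlt : θ * F (x p) < F (x p) := by
    simpa using ENNReal.mul_lt_mul_left (hx.density_pos p hp).ne' (hx.density_lt_top p hp).ne hθ
  obtain ⟨ε, hε, hball⟩ := Metric.eventually_nhds_iff.1
    ((hx.continuousAt_density p hp).eventually (lt_mem_nhds hlt))
  have hxq : ∀ᶠ q in 𝓝 p, x q < x p + ε :=
    (hx.hasDerivAt p hp).continuousAt.eventually (gt_mem_nhds (by linarith))
  filter_upwards [nhdsWithin_le_nhds hxq] with q hq r hr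
  refine (hball ?_).le
  rw [Real.dist_eq, abs_of_nonneg (sub_nonneg.2 hr.1)]
  linarith [hr.2]

lemma setLIntegral_Iic_le_of_eq_add (hFI : ∫⁻ x, F x = ENNReal.ofReal I)
    (hx : IsRegularQuantile F I x) (hy : IsRegularQuantile G I y) {c : ℝ}
    (hxy : ∀ p ∈ Ioo 0 I, y p = x p + c) (a : ℝ) :
    ∫⁻ r in Iic a, F r ≤ ∫⁻ r in Iic (a + c), G r := by
  refine le_of_forall_lt fun w hw => ?_
  obtain ⟨v, hwv, hva⟩ := exists_between hw
  have hv := ENNReal.ofReal_toReal hva.ne_top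
  have hp : v.toReal ∈ Ioo 0 I := by
    refine ⟨ENNReal.toReal_pos (pos_of_gt hwv).ne' hva.ne_top, ?_⟩
    exact ENNReal.toReal_lt_of_lt_ofReal
      (hva.trans_le ((setLIntegral_le_lintegral _ _).trans_eq hFI))
  have hxa : x v.toReal < a := by
    by_contra! h
    have hle := lintegral_mono_set (μ := volume) (f := F) (Iic_subset_Iic.2 h)
    rw [hx.lintegral_Iic _ hp, hv] at hle
    exact hva.not_ge hle
  calc w < v := hwv
    _ = ∫⁻ r in Iic (y v.toReal), G r := by rw [hy.lintegral_Iic _ hp, hv]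
    _ ≤ ∫⁻ r in Iic (a + c), G r :=
      lintegral_mono_set (Iic_subset_Iic.2 (by linarith [hxy _ hp]))

end IsRegularQuantile

end Quantile

section PrekopaLeindler

variable {F G H : ℝ → ℝ≥0∞} {s t : ℝ≥0}

lemma marginalExponent_zero (n : ℕ) : marginalExponent n 0 = 0 := by
  simp [marginalExponent]

lemma prekopa_leindler_setLIntegral (hs : s ≠ 0) (ht : t ≠ 0) (hst : s + t = 1)
    (hF : Measurable F) (hG : Measurable G) (hH : Measurable H)
    (hle : ∀ x y, alphaMean 0 s t (F x) (G y) ≤ H ((s : ℝ) • x + (t : ℝ) • y)) {A B C : Set ℝ}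
    (hA : MeasurableSet A) (hB : MeasurableSet B) (hC : MeasurableSet C)
    (hABC : ∀ x ∈ A, ∀ y ∈ B, (s : ℝ) • x + (t : ℝ) • y ∈ C) :
    alphaMean 0 s t (∫⁻ x in A, F x) (∫⁻ x in B, G x) ≤ ∫⁻ x in C, H x := by
  rw [← lintegral_indicator hA, ← lintegral_indicator hB, ← lintegral_indicator hC,
    ← marginalExponent_zero 1]
  refine borell_brascamp_lieb_line (by norm_num) le_rfl hs ht hst (hF.indicator hA)
    (hG.indicator hB) (hH.indicator hC) fun x y => ?_
  rw [EReal.coe_zero]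
  by_cases hx : x ∈ A
  · by_cases hy : y ∈ B
    · rw [indicator_of_mem hx, indicator_of_mem hy, indicator_of_mem (hABC x hx y hy)]
      exact hle x y
    · rw [indicator_of_notMem hy, alphaMean_zero_right le_rfl ht]
      exact zero_le
  · rw [indicator_of_notMem hx, alphaMean_zero_left le_rfl hs]
    exact zero_le

lemma eq_of_geom_mean_mul_le_one (hs : s ≠ 0) (ht : t ≠ 0) (hst : s + t = 1) {a b : ℝ}
    (ha : 0 < a) (hb : 0 < b)
    (h : a ^ (s : ℝ) * b ^ (t : ℝ) * (s * a⁻¹ + t * b⁻¹) ≤ 1) : a = b := by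
  by_contra hab
  have hlt := (Real.geom_mean_lt_arith_mean2_weighted_iff_of_pos
    (NNReal.coe_pos.2 (pos_iff_ne_zero.2 hs)) (NNReal.coe_pos.2 (pos_iff_ne_zero.2 ht))
    (inv_nonneg.2 ha.le) (inv_nonneg.2 hb.le) (mod_cast hst)).2 (inv_injective.ne hab)
  rw [Real.inv_rpow ha.le, Real.inv_rpow hb.le, ← mul_inv] at hlt
  exact h.not_gt ((inv_lt_iff_one_lt_mul₀' (by positivity)).1 hlt)

namespace IsRegularQuantile

variable {I : ℝ} {x y : ℝ → ℝ}

lemma lintegral_Iic_add (hs : s ≠ 0) (ht : t ≠ 0) (hst : s + t = 1) (hF : Measurable F)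
    (hG : Measurable G) (hH : Measurable H)
    (hle : ∀ x y, alphaMean 0 s t (F x) (G y) ≤ H ((s : ℝ) • x + (t : ℝ) • y))
    (hFI : ∫⁻ x, F x = ENNReal.ofReal I) (hGI : ∫⁻ x, G x = ENNReal.ofReal I)
    (hHI : ∫⁻ x, H x = ENNReal.ofReal I) (hx : IsRegularQuantile F I x)
    (hy : IsRegularQuantile G I y) {p : ℝ} (hp : p ∈ Ioo 0 I) :
    ∫⁻ r in Iic (s * x p + t * y p), H r = ENNReal.ofReal p := by
  have hs' : (0 : ℝ) < s := NNReal.coe_pos.2 (pos_iff_ne_zero.2 hs)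
  have ht' : (0 : ℝ) < t := NNReal.coe_pos.2 (pos_iff_ne_zero.2 ht)
  have hIic := prekopa_leindler_setLIntegral hs ht hst hF hG hH hle measurableSet_Iic
    measurableSet_Iic measurableSet_Iic fun a (ha : a ≤ x p) b (hb : b ≤ y p) =>
      add_le_add (mul_le_mul_of_nonneg_left ha hs'.le) (mul_le_mul_of_nonneg_left hb ht'.le)
  have hIoi := prekopa_leindler_setLIntegral hs ht hst hF hG hH hle measurableSet_Ioi
    measurableSet_Ioi measurableSet_Ioi fun a (ha : x p < a) b (hb : y p < b) =>
      add_lt_add (mul_lt_mul_of_pos_left ha hs') (mul_lt_mul_of_pos_left hb ht')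
  rw [hx.lintegral_Iic p hp, hy.lintegral_Iic p hp, alphaMean_self _ hst] at hIic
  rw [hx.lintegral_Ioi hFI hp, hy.lintegral_Ioi hGI hp, alphaMean_self _ hst] at hIoi
  have hsplit := lintegral_add_compl (μ := volume) H (measurableSet_Iic (a := s * x p + t * y p))
  rw [compl_Iic, hHI] at hsplit
  refine le_antisymm ((ENNReal.add_le_add_iff_right (ENNReal.ofReal_ne_top (r := I - p))).1 ?_) hIic
  rw [← ENNReal.ofReal_add hp.1.le (sub_nonneg.2 hp.2.le), add_sub_cancel, ← hsplit]
  gcongr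

lemma eventually_mul_le_of_lintegral_Iic_add (hs : s ≠ 0) (ht : t ≠ 0) (hst : s + t = 1)
    (hle : ∀ x y, alphaMean 0 s t (F x) (G y) ≤ H ((s : ℝ) • x + (t : ℝ) • y))
    (hx : IsRegularQuantile F I x) (hy : IsRegularQuantile G I y)
    (hz : ∀ p ∈ Ioo 0 I, ∫⁻ r in Iic (s * x p + t * y p), H r = ENNReal.ofReal p) {p : ℝ}
    (hp : p ∈ Ioo 0 I) {θ : ℝ≥0∞} (hθ : θ < 1) :
    ∀ᶠ q in 𝓝[>] p, θ * alphaMean 0 s t (F (x p)) (G (y p)) *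
      ENNReal.ofReal ((s * x q + t * y q) - (s * x p + t * y p)) ≤ ENNReal.ofReal (q - p) := by
  filter_upwards [hx.eventually_mul_le hp hθ, hy.eventually_mul_le hp hθ, Ioo_mem_nhdsGT hp.2]
    with q hFq hGq hq
  have hqI : q ∈ Ioo 0 I := ⟨hp.1.trans hq.1, hq.2⟩
  have hxq := (hx.strictMonoOn hp hqI hq.1).le
  have hyq := (hy.strictMonoOn hp hqI hq.1).le
  have hzq : s * x p + t * y p ≤ s * x q + t * y q := by gcongr
  have hlow : ∀ r ∈ Ioc (s * x p + t * y p) (s * x q + t * y q),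
      θ * alphaMean 0 s t (F (x p)) (G (y p)) ≤ H r := by
    intro r hr
    obtain ⟨k, l, hk, hl, hkl, rfl⟩ : r ∈ segment ℝ (s * x p + t * y p) (s * x q + t * y q) := by
      rw [segment_eq_Icc hzq]
      exact Ioc_subset_Icc_self hr
    have hF := hFq _ (convex_Icc _ _ (left_mem_Icc.2 hxq) (right_mem_Icc.2 hxq) hk hl hkl)
    have hG := hGq _ (convex_Icc _ _ (left_mem_Icc.2 hyq) (right_mem_Icc.2 hyq) hk hl hkl)
    have hsum : k • (s * x p + t * y p) + l • (s * x q + t * y q) =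
        (s : ℝ) • (k • x p + l • x q) + (t : ℝ) • (k • y p + l • y q) := by
      simp only [smul_eq_mul]
      ring
    rw [← alphaMean_mul 0 hst hθ.ne_top, hsum]
    exact (alphaMean_mono 0 s t hF hG).trans (hle _ _)
  have hstrip : θ * alphaMean 0 s t (F (x p)) (G (y p)) *
      ENNReal.ofReal ((s * x q + t * y q) - (s * x p + t * y p)) ≤
        ∫⁻ r in Ioc (s * x p + t * y p) (s * x q + t * y q), H r := by
    rw [← Real.volume_Ioc, ← setLIntegral_const]
    exact setLIntegral_mono' measurableSet_Ioc hlow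
  have hunion := lintegral_union (μ := volume) (f := H) measurableSet_Ioc
    (Iic_disjoint_Ioc (c := s * x q + t * y q) (le_refl (s * x p + t * y p)))
  rw [Iic_union_Ioc_eq_Iic hzq, hz p hp, hz q hqI] at hunion
  rwa [ENNReal.ofReal_sub _ hp.1.le, hunion, ENNReal.add_sub_cancel_left ENNReal.ofReal_ne_top]

lemma density_eq (hs : s ≠ 0) (ht : t ≠ 0) (hst : s + t = 1)
    (hle : ∀ x y, alphaMean 0 s t (F x) (G y) ≤ H ((s : ℝ) • x + (t : ℝ) • y))
    (hx : IsRegularQuantile F I x) (hy : IsRegularQuantile G I y)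
    (hz : ∀ p ∈ Ioo 0 I, ∫⁻ r in Iic (s * x p + t * y p), H r = ENNReal.ofReal p) {p : ℝ}
    (hp : p ∈ Ioo 0 I) : (F (x p)).toReal = (G (y p)).toReal := by
  have ha := ENNReal.toReal_pos (hx.density_pos p hp).ne' (hx.density_lt_top p hp).ne
  have hb := ENNReal.toReal_pos (hy.density_pos p hp).ne' (hy.density_lt_top p hp).ne
  have hM := alphaMean_lt_top 0 hst (hx.density_lt_top p hp) (hy.density_lt_top p hp)
  set a := (F (x p)).toReal
  set b := (G (y p)).toReal
  refine eq_of_geom_mean_mul_le_one hs ht hst ha hb ?_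
  have hMab : a ^ (s : ℝ) * b ^ (t : ℝ) = (alphaMean 0 s t (F (x p)) (G (y p))).toReal := by
    rw [alphaMean_zero, ENNReal.toReal_mul, ← ENNReal.toReal_rpow, ← ENNReal.toReal_rpow]
  have hslope : Tendsto (slope (fun q => s * x q + t * y q) p) (𝓝[>] p)
      (𝓝 (s * a⁻¹ + t * b⁻¹)) :=
    (hasDerivAt_iff_tendsto_slope.1 (((hx.hasDerivAt p hp).const_mul (s : ℝ)).add
      ((hy.hasDerivAt p hp).const_mul (t : ℝ)))).mono_left (nhdsGT_le_nhdsNE p)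
  have hbound : ∀ θ ∈ Ioo (0 : ℝ) 1,
      θ * (a ^ (s : ℝ) * b ^ (t : ℝ)) * (s * a⁻¹ + t * b⁻¹) ≤ 1 := by
    intro θ hθ
    refine le_of_tendsto (hslope.const_mul _) ?_
    filter_upwards [eventually_mul_le_of_lintegral_Iic_add hs ht hst hle hx hy hz hp
      (ENNReal.ofReal_lt_one.2 hθ.2), self_mem_nhdsWithin] with q hq hpq
    rw [← ENNReal.ofReal_toReal hM.ne, ← hMab, ← ENNReal.ofReal_mul hθ.1.le,
      ← ENNReal.ofReal_mul (mul_nonneg hθ.1.le (by positivity)),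
      ENNReal.ofReal_le_ofReal_iff (sub_pos.2 hpq).le] at hq
    rwa [slope_def_field, ← mul_div_assoc, div_le_one (sub_pos.2 hpq)]
  have hlim : Tendsto (fun θ : ℝ => θ * (a ^ (s : ℝ) * b ^ (t : ℝ)) * (s * a⁻¹ + t * b⁻¹))
      (𝓝[<] 1) (𝓝 (1 * (a ^ (s : ℝ) * b ^ (t : ℝ)) * (s * a⁻¹ + t * b⁻¹))) :=
    (Continuous.tendsto (by fun_prop) 1).mono_left nhdsWithin_le_nhds
  rw [one_mul] at hlim
  exact le_of_tendsto hlim (mem_of_superset (Ioo_mem_nhdsLT one_pos) hbound)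

end IsRegularQuantile

lemma exists_map_add_eq_withDensity_line (hs : s ≠ 0) (ht : t ≠ 0) (hst : s + t = 1)
    (hF : Measurable F) (hG : Measurable G) (hH : Measurable H) (hFc : LogConcave F)
    (hGc : LogConcave G)
    (hle : ∀ x y, alphaMean 0 s t (F x) (G y) ≤ H ((s : ℝ) • x + (t : ℝ) • y)) {I : ℝ} (hI : 0 < I)
    (hFI : ∫⁻ x, F x = ENNReal.ofReal I) (hGI : ∫⁻ x, G x = ENNReal.ofReal I)
    (hHI : ∫⁻ x, H x = ENNReal.ofReal I) :
    ∃ c : ℝ, (volume.withDensity F).map (· + c) = volume.withDensity G := by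
  obtain ⟨x, hx⟩ := hFc.exists_isRegularQuantile hF hI hFI
  obtain ⟨y, hy⟩ := hGc.exists_isRegularQuantile hG hI hGI
  have hder : ∀ p ∈ Ioo 0 I, HasDerivAt (fun p => y p - x p) 0 p := fun p hp => by
    have hd := (hy.hasDerivAt p hp).sub (hx.hasDerivAt p hp)
    rwa [hx.density_eq hs ht hst hle hy
      (fun q hq => hx.lintegral_Iic_add hs ht hst hF hG hH hle hFI hGI hHI hy hq) hp,
      sub_self] at hd
  obtain ⟨c, hc⟩ := isOpen_Ioo.exists_is_const_of_deriv_eq_zero isPreconnected_Ioo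
    (fun p hp => (hder p hp).differentiableAt.differentiableWithinAt)
    (fun p hp => (hder p hp).deriv)
  have hxy : ∀ p ∈ Ioo 0 I, y p = x p + c := fun p hp => by linarith [hc p hp]
  have hyx : ∀ p ∈ Ioo 0 I, x p = y p + -c := fun p hp => by linarith [hc p hp]
  have : IsFiniteMeasure (volume.withDensity F) := isFiniteMeasure_withDensity (by simp [hFI])
  refine ⟨c, Measure.ext_of_Iic _ _ fun a => ?_⟩
  have hpre : (fun x : ℝ => x + c) ⁻¹' Iic a = Iic (a + -c) := by
    rw [preimage_add_const_Iic, sub_eq_add_neg]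
  rw [Measure.map_apply (by fun_prop) measurableSet_Iic, hpre,
    withDensity_apply _ measurableSet_Iic, withDensity_apply _ measurableSet_Iic]
  refine le_antisymm ?_ (hy.setLIntegral_Iic_le_of_eq_add hGI hx hyx a)
  simpa using hx.setLIntegral_Iic_le_of_eq_add hFI hy hxy (a + -c)

end PrekopaLeindler

section Marginal

variable {m : ℕ} {f g h : E (m + 1) → ℝ≥0∞} {s t : ℝ≥0}

/-- The marginal of a density on `ℝ^(m+1)` with respect to the first coordinate. -/
def marginal (f : E (m + 1) → ℝ≥0∞) (r : ℝ) : ℝ≥0∞ :=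
  ∫⁻ y : Fin m → ℝ, f (WithLp.toLp 2 (Fin.cons r y))

lemma measurable_toLp_cons :
    Measurable fun q : ℝ × (Fin m → ℝ) => (WithLp.toLp 2 (Fin.cons q.1 q.2) : E (m + 1)) :=
  (WithLp.measurable_toLp 2 _).comp measurable_cons

lemma measurable_marginal (hf : Measurable f) : Measurable (marginal f) :=
  (hf.comp measurable_toLp_cons).lintegral_prod_right'

lemma lintegral_marginal (hf : Measurable f) : ∫⁻ r, marginal f r = ∫⁻ x, f x := by
  rw [← lintegral_toLp f]
  exact (lintegral_fin_succ (f := fun x => f (WithLp.toLp 2 x))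
    (hf.comp (WithLp.measurable_toLp 2 _))).symm

lemma map_apply_zero_withDensity (hf : Measurable f) :
    (volume.withDensity f).map (fun x => x 0) = volume.withDensity (marginal f) := by
  have hcoord : Measurable fun x : E (m + 1) => x 0 := by fun_prop
  ext A hA
  rw [Measure.map_apply hcoord hA, withDensity_apply _ (hcoord hA), withDensity_apply _ hA,
    ← lintegral_indicator hA, ← lintegral_indicator (hcoord hA),
    ← lintegral_marginal (hf.indicator (hcoord hA))]
  refine lintegral_congr fun r => ?_
  by_cases hr : r ∈ A <;> simp [marginal, indicator, hr]

lemma borell_brascamp_lieb_marginal {p : ℝ} (hp0 : p ≤ 0) (hmp : 0 ≤ 1 + m * p) (hs : s ≠ 0)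
    (ht : t ≠ 0) (hst : s + t = 1) (hf : Measurable f) (hg : Measurable g) (hh : Measurable h)
    (hle : ∀ x y, alphaMean p s t (f x) (g y) ≤ h ((s : ℝ) • x + (t : ℝ) • y)) (a b : ℝ) :
    alphaMean (marginalExponent m p) s t (marginal f a) (marginal g b) ≤
      marginal h ((s : ℝ) • a + (t : ℝ) • b) := by
  have hfiber (F : E (m + 1) → ℝ≥0∞) (hF : Measurable F) (r : ℝ) :
      Measurable fun y : Fin m → ℝ => F (WithLp.toLp 2 (Fin.cons r y)) :=
    hF.comp (measurable_toLp_cons.comp measurable_prodMk_left)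
  refine borell_brascamp_lieb hp0 hmp hs ht hst (hfiber f hf a) (hfiber g hg b) (hfiber h hh _)
    fun x y => (hle _ _).trans_eq (congrArg h ?_)
  ext i
  refine Fin.cases ?_ (fun i => ?_) i <;> simp

lemma prekopa_leindler_marginal (hs : s ≠ 0) (ht : t ≠ 0) (hst : s + t = 1) (hf : Measurable f)
    (hg : Measurable g) (hh : Measurable h)
    (hle : ∀ x y, alphaMean 0 s t (f x) (g y) ≤ h ((s : ℝ) • x + (t : ℝ) • y)) (a b : ℝ) :
    alphaMean 0 s t (marginal f a) (marginal g b) ≤ marginal h ((s : ℝ) • a + (t : ℝ) • b) := by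
  have hbbl := borell_brascamp_lieb_marginal le_rfl (by simp) hs ht hst hf hg hh hle a b
  rwa [marginalExponent_zero] at hbbl

namespace LogConcave

lemma marginal (hfc : LogConcave f) (hf : Measurable f) : LogConcave (marginal f) := by
  intro a b s t hst
  rcases eq_or_ne s 0 with rfl | hs
  · obtain rfl : t = 1 := by simpa using hst
    simp [alphaMean_zero]
  rcases eq_or_ne t 0 with rfl | ht
  · obtain rfl : s = 1 := by simpa using hst
    simp [alphaMean_zero]
  exact prekopa_leindler_marginal hs ht hst hf hf hf (fun x y => hfc x y s t hst) a b

lemma comp_affineMap {V W : Type*} [AddCommGroup V] [Module ℝ V] [AddCommGroup W] [Module ℝ W]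
    {F : W → ℝ≥0∞} (hF : LogConcave F) (A : V →ᵃ[ℝ] W) : LogConcave fun x => F (A x) := by
  intro x y s t hst
  have hA : A ((s : ℝ) • x + (t : ℝ) • y) = (s : ℝ) • A x + (t : ℝ) • A y :=
    Convex.combo_affine_apply (mod_cast hst)
  simpa only [hA] using hF (A x) (A y) s t hst

end LogConcave

end Marginal

section EqualityCase

/-- A Cramér–Wold device for translates: the barycenters determine the translation. -/
lemma exists_map_add_eq_of_forall_dual {V : Type*} [NormedAddCommGroup V] [NormedSpace ℝ V]
    [CompleteSpace V] [SecondCountableTopology V] [MeasurableSpace V] [BorelSpace V]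
    {μ ν : Measure V} [IsFiniteMeasure μ] [IsFiniteMeasure ν] (hμ : Integrable id μ)
    (hν : Integrable id ν)
    (h : ∀ L : StrongDual ℝ V, ∃ c : ℝ, (μ.map L).map (· + c) = ν.map L) :
    ∃ b : V, μ.map (· + b) = ν := by
  rcases eq_zero_or_neZero μ with rfl | _
  · obtain ⟨c, hc⟩ := h 0
    rw [Measure.map_zero, Measure.map_zero, eq_comm, Measure.map_eq_zero_iff (by fun_prop)] at hc
    exact ⟨0, by rw [Measure.map_zero, hc]⟩
  set b : V := (μ.real univ)⁻¹ • ((∫ x, x ∂ν) - ∫ x, x ∂μ) with hb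
  refine ⟨b, Measure.ext_of_charFunDual (funext fun L => ?_)⟩
  obtain ⟨c, hc⟩ := h L
  have hmean : ∫ x, L x + c ∂μ = ∫ x, L x ∂ν := by
    have hid := congrArg (fun ρ : Measure ℝ => ∫ r, r ∂ρ) hc
    rwa [Measure.map_map (by fun_prop) (by fun_prop), integral_map (by fun_prop) (by fun_prop),
      integral_map (by fun_prop) (by fun_prop)] at hid
  have hcb : c = L b := by
    have hμL : ∫ x, L x ∂μ = L (∫ x, x ∂μ) := L.integral_comp_comm hμ
    have hνL : ∫ x, L x ∂ν = L (∫ x, x ∂ν) := L.integral_comp_comm hν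
    have hLint : Integrable (fun x => L x) μ := L.integrable_comp hμ
    rw [integral_add hLint (integrable_const c), integral_const, hμL, hνL] at hmean
    rw [hb, map_smul, map_sub, ← hmean, add_sub_cancel_left, smul_eq_mul, smul_eq_mul,
      inv_mul_cancel_left₀ measureReal_univ_ne_zero]
  rw [charFunDual_eq_charFun_map_one, charFunDual_eq_charFun_map_one, ← hc, hcb,
    Measure.map_map (by fun_prop) (by fun_prop), Measure.map_map (by fun_prop) (by fun_prop)]
  congr 2
  ext x
  simp

variable {m : ℕ} {f g h : E (m + 1) → ℝ≥0∞} {s t : ℝ≥0}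

lemma exists_linearIsometryEquiv_dual_apply (L : StrongDual ℝ (E (m + 1))) :
    ∃ (T : E (m + 1) ≃ₗᵢ[ℝ] E (m + 1)) (r : ℝ), ∀ x, L (T x) = r * x 0 := by
  obtain ⟨w, rfl⟩ := (InnerProductSpace.toDual ℝ (E (m + 1))).surjective L
  set e : E (m + 1) := ‖w‖ • EuclideanSpace.single 0 1 with he
  have hnorm : ‖e‖ = ‖w‖ := by simp [he, norm_smul]
  refine ⟨(Submodule.span ℝ {e - w})ᗮ.reflection, ‖w‖, fun x => ?_⟩
  have hT : (Submodule.span ℝ {e - w})ᗮ.reflection e = w := Submodule.reflection_sub hnorm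
  rw [InnerProductSpace.toDual_apply_apply]
  nth_rw 1 [← hT]
  rw [LinearIsometryEquiv.inner_map_map, he, real_inner_smul_left,
    EuclideanSpace.inner_single_left]
  simp

lemma map_withDensity_comp (T : E n ≃ₗᵢ[ℝ] E n) (f : E n → ℝ≥0∞) :
    (volume.withDensity fun x => f (T x)).map T = volume.withDensity f := by
  ext A hA
  have hT : Measurable T := T.continuous.measurable
  rw [Measure.map_apply hT hA, withDensity_apply _ (hT hA), withDensity_apply _ hA]
  exact T.measurePreserving.setLIntegral_comp_preimage_emb T.toHomeomorph.measurableEmbedding f A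

lemma map_dual_withDensity (hf : Measurable f) {L : StrongDual ℝ (E (m + 1))}
    {T : E (m + 1) ≃ₗᵢ[ℝ] E (m + 1)} {r : ℝ} (hL : ∀ x, L (T x) = r * x 0) :
    (volume.withDensity f).map L =
      (volume.withDensity (marginal fun x => f (T x))).map (r * ·) := by
  have hT : Measurable T := T.continuous.measurable
  rw [← map_withDensity_comp T f, Measure.map_map (by fun_prop) hT,
    ← map_apply_zero_withDensity (f := fun x => f (T x)) (hf.comp hT),
    Measure.map_map (by fun_prop) (by fun_prop)]
  congr 1
  exact funext hL

theorem exists_map_add_eq_withDensity (hs : s ≠ 0) (ht : t ≠ 0) (hst : s + t = 1)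
    (hf : Measurable f) (hg : Measurable g) (hh : Measurable h) (hfc : LogConcave f)
    (hgc : LogConcave g)
    (hle : ∀ x y, alphaMean 0 s t (f x) (g y) ≤ h ((s : ℝ) • x + (t : ℝ) • y)) {I : ℝ} (hI : 0 < I)
    (hfI : ∫⁻ x, f x = ENNReal.ofReal I) (hgI : ∫⁻ x, g x = ENNReal.ofReal I)
    (hhI : ∫⁻ x, h x = ENNReal.ofReal I) (hf1 : Integrable id (volume.withDensity f))
    (hg1 : Integrable id (volume.withDensity g)) :
    ∃ b : E (m + 1), (volume.withDensity f).map (· + b) = volume.withDensity g := by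
  have : IsFiniteMeasure (volume.withDensity f) := isFiniteMeasure_withDensity (by simp [hfI])
  have : IsFiniteMeasure (volume.withDensity g) := isFiniteMeasure_withDensity (by simp [hgI])
  refine exists_map_add_eq_of_forall_dual hf1 hg1 fun L => ?_
  obtain ⟨T, r, hL⟩ := exists_linearIsometryEquiv_dual_apply L
  have hcomp {F : E (m + 1) → ℝ≥0∞} (hF : Measurable F) : Measurable fun x => F (T x) :=
    hF.comp T.continuous.measurable
  have hmass {F : E (m + 1) → ℝ≥0∞} (hF : Measurable F) (hFI : ∫⁻ x, F x = ENNReal.ofReal I) :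
      ∫⁻ a, marginal (fun x => F (T x)) a = ENNReal.ofReal I := by
    rw [lintegral_marginal (hcomp hF), lintegral_comp_linearIsometryEquiv, hFI]
  obtain ⟨c, hc⟩ := exists_map_add_eq_withDensity_line hs ht hst (measurable_marginal (hcomp hf))
    (measurable_marginal (hcomp hg)) (measurable_marginal (hcomp hh))
    ((hfc.comp_affineMap T.toAffineIsometryEquiv.toAffineEquiv.toAffineMap).marginal (hcomp hf))
    ((hgc.comp_affineMap T.toAffineIsometryEquiv.toAffineEquiv.toAffineMap).marginal (hcomp hg))
    (prekopa_leindler_marginal hs ht hst (hcomp hf) (hcomp hg) (hcomp hh)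
      fun x y => by simpa using hle (T x) (T y))
    hI (hmass hf hfI) (hmass hg hgI) (hmass hh hhI)
  refine ⟨r * c, ?_⟩
  rw [map_dual_withDensity hf hL, map_dual_withDensity hg hL, ← hc,
    Measure.map_map (by fun_prop) (by fun_prop), Measure.map_map (by fun_prop) (by fun_prop)]
  congr 1
  ext a
  simp [mul_add]

end EqualityCase

section LogConcaveClosure

lemma tendsto_rpow_one_sub_mul_rpow {a d : ℝ≥0} (ha : a ≠ 0) (hd : d ≠ 0) :
    Tendsto (fun l : ℝ => (a : ℝ≥0∞) ^ (1 - l) * (d : ℝ≥0∞) ^ l) (𝓝[>] 0) (𝓝 a) := by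
  have hcont : Continuous fun l : ℝ => a ^ (1 - l) * d ^ l := by
    refine .mul ?_ ?_ <;> refine continuous_iff_continuousAt.2 fun l => ?_
    · exact continuousAt_const.nnrpow (continuousAt_const.sub continuousAt_id) (.inl ha)
    · exact continuousAt_const.nnrpow continuousAt_id (.inl hd)
  have hlim' := ENNReal.tendsto_coe.2 (hcont.tendsto 0)
  simp only [ENNReal.coe_mul, ENNReal.coe_rpow_of_ne_zero ha, ENNReal.coe_rpow_of_ne_zero hd,
    sub_zero, ENNReal.rpow_one, ENNReal.rpow_zero, mul_one] at hlim'
  exact hlim'.mono_left nhdsWithin_le_nhds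

variable {V : Type*} [AddCommGroup V] [Module ℝ V] {f g : V → ℝ≥0∞}

lemma AlphaConcave.logConcave {f : E n → ℝ≥0∞} (hf : AlphaConcave 0 f) : LogConcave f := by
  intro x y s t hst
  rcases eq_or_ne s 0 with rfl | hs
  · obtain rfl : t = 1 := by simpa using hst
    simp [alphaMean_zero]
  rcases eq_or_ne t 0 with rfl | ht
  · obtain rfl : s = 1 := by simpa using hst
    simp [alphaMean_zero]
  rcases eq_or_ne (f x) 0 with hx | hx
  · simp [hx, alphaMean_zero_left le_rfl hs]
  rcases eq_or_ne (f y) 0 with hy | hy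
  · simp [hy, alphaMean_zero_right le_rfl ht]
  exact hf.2 x (pos_iff_ne_zero.2 hx) y (pos_iff_ne_zero.2 hy) s t hst

namespace LogConcave

variable [TopologicalSpace V] [IsTopologicalAddGroup V] [ContinuousSMul ℝ V]

/- Near the end `x` of the segment towards an interior point of `{δ ≤ f}`, homothetic copies of
`{δ ≤ f}` lie in `{k < f}`. -/
lemma mem_closure_interior_lt (hf : LogConcave f) {δ : ℝ≥0∞} (hδ : 0 < δ)
    (hint : (interior {y | δ ≤ f y}).Nonempty) {x : V} {k : ℝ≥0∞} (hk : k < f x) :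
    x ∈ closure (interior {y | k < f y}) := by
  obtain ⟨a, hka, hax⟩ := exists_between hk
  obtain ⟨d, hd0, hdδ⟩ := exists_between hδ
  lift a to ℝ≥0 using ne_top_of_lt hax
  lift d to ℝ≥0 using ne_top_of_lt hdδ
  have ha : a ≠ 0 := mod_cast (pos_of_gt hka).ne'
  have hd : d ≠ 0 := mod_cast hd0.ne'
  obtain ⟨y, hy⟩ := hint
  have hmem : ∀ᶠ l : ℝ in 𝓝[>] 0, AffineMap.homothety x l y ∈ interior {y | k < f y} := by
    filter_upwards [(tendsto_rpow_one_sub_mul_rpow ha hd).eventually (lt_mem_nhds hka),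
      Ioo_mem_nhdsGT (zero_lt_one' ℝ)] with l hkl ⟨hl0, hl1⟩
    refine interior_maximal ?_
      (AffineMap.homothety_isOpenMap x l hl0.ne' _ isOpen_interior) (mem_image_of_mem _ hy)
    rintro _ ⟨z, hz, rfl⟩
    lift l to ℝ≥0 using hl0.le
    have hl : l ≤ 1 := mod_cast hl1.le
    have hcomb := hf x z (1 - l) l (tsub_add_cancel_of_le hl)
    rw [alphaMean_zero, NNReal.coe_sub hl, NNReal.coe_one] at hcomb
    have hz' : d ≤ f z := hdδ.le.trans (interior_subset hz : z ∈ {y | δ ≤ f y})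
    calc k < a ^ (1 - (l : ℝ)) * d ^ (l : ℝ) := hkl
      _ ≤ f x ^ (1 - (l : ℝ)) * f z ^ (l : ℝ) :=
        mul_le_mul' (ENNReal.rpow_le_rpow hax.le (sub_nonneg.2 hl1.le))
          (ENNReal.rpow_le_rpow hz' hl0.le)
      _ ≤ f ((1 - (l : ℝ)) • x + (l : ℝ) • z) := hcomb
      _ = f (AffineMap.homothety x (l : ℝ) z) := by
        rw [AffineMap.homothety_eq_lineMap, AffineMap.lineMap_apply_module]
  have hx : Tendsto (fun l : ℝ => AffineMap.homothety x l y) (𝓝[>] 0) (𝓝 x) := by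
    have hcont : Continuous fun l : ℝ => AffineMap.homothety x l y := by
      simp only [AffineMap.homothety_apply]
      fun_prop
    simpa using (hcont.tendsto 0).mono_left nhdsWithin_le_nhds
  exact mem_closure_of_tendsto hx hmem

variable [MeasurableSpace V] {μ : Measure V} [μ.IsOpenPosMeasure]

lemma le_of_ae_eq (hf : LogConcave f) {δ : ℝ≥0∞} (hδ : 0 < δ)
    (hint : (interior {y | δ ≤ f y}).Nonempty) (hg : UpperSemicontinuous g) (hfg : f =ᵐ[μ] g) :
    f ≤ g := by
  intro x
  by_contra! hlt
  obtain ⟨k, hgk, hkf⟩ := exists_between hlt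
  have hnear : (interior {y | k < f y} ∩ g ⁻¹' Iio k).Nonempty := by
    rw [inter_comm]
    exact mem_closure_iff.1 (hf.mem_closure_interior_lt hδ hint hkf) _ (hg.isOpen_preimage k) hgk
  obtain ⟨w, ⟨hw, hgw⟩, hfw⟩ := (Measure.dense_of_ae hfg).inter_open_nonempty _
    (isOpen_interior.inter (hg.isOpen_preimage k))
    hnear
  have hkw : w ∈ {y | k < f y} := interior_subset hw
  exact (LT.lt.trans_eq hkw hfw).not_gt hgw

lemma eq_of_ae_eq (hf : LogConcave f) (hg : LogConcave g) {δ : ℝ≥0∞} (hδ : 0 < δ)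
    (hint : (interior {y | δ ≤ f y}).Nonempty) (hfusc : UpperSemicontinuous f)
    (hgusc : UpperSemicontinuous g) (hfg : f =ᵐ[μ] g) : f = g := by
  have hle := hf.le_of_ae_eq hδ hint hgusc hfg
  exact hle.antisymm (hg.le_of_ae_eq hδ
    (hint.mono (interior_mono fun x (hx : δ ≤ f x) => hx.trans (hle x))) hfusc hfg.symm)

end LogConcave

end LogConcaveClosure

section Decay

variable {V : Type*} [NormedAddCommGroup V] [NormedSpace ℝ V] {f : V → ℝ≥0∞} {x₀ : V}

namespace LogConcave

/- Log-concavity on the segment `[x₀, x]`, which crosses the sphere of radius `r`. -/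
lemma toReal_le_mul_exp (hf : LogConcave f) (hfin : ∀ x, f x < ∞) (hx₀ : 0 < f x₀) {r : ℝ}
    (hr : 0 < r) (hhalf : ∀ x, ‖x - x₀‖ = r → (f x).toReal ≤ (f x₀).toReal / 2) {x : V}
    (hx : r ≤ ‖x - x₀‖) :
    (f x).toReal ≤ (f x₀).toReal * Real.exp (-(Real.log 2 / r * ‖x - x₀‖)) := by
  have ha : 0 < (f x₀).toReal := ENNReal.toReal_pos hx₀.ne' (hfin x₀).ne
  rcases eq_or_ne (f x) 0 with h0 | h0
  · rw [h0, ENNReal.toReal_zero]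
    positivity
  have hfx : 0 < (f x).toReal := ENNReal.toReal_pos h0 (hfin x).ne
  have hρ : 0 < ‖x - x₀‖ := hr.trans_le hx
  set l := r / ‖x - x₀‖ with hl
  have hl0 : 0 < l := by positivity
  have hl1 : l ≤ 1 := (div_le_one hρ).2 hx
  have hsphere : ‖AffineMap.lineMap x₀ x l - x₀‖ = r := by
    rw [AffineMap.lineMap_apply, vsub_eq_sub, vadd_eq_add, add_sub_cancel_right, norm_smul,
      Real.norm_of_nonneg hl0.le, hl, div_mul_cancel₀ _ hρ.ne']
  have hconc : (1 - l) * Real.log (f x₀).toReal + l * Real.log (f x).toReal ≤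
      Real.log (f (AffineMap.lineMap x₀ x l)).toReal := by
    rw [AffineMap.lineMap_apply_module]
    exact (hf.concaveOn_log hfin hf.convex_pos fun _ h => h).2 hx₀ (pos_iff_ne_zero.2 h0)
      (sub_nonneg.2 hl1) hl0.le (sub_add_cancel _ _)
  have hmid : 0 < (f (AffineMap.lineMap x₀ x l)).toReal :=
    ENNReal.toReal_pos (hf.convex_pos.lineMap_mem hx₀ (pos_iff_ne_zero.2 h0) ⟨hl0.le, hl1⟩).ne'
      (hfin _).ne
  have hdrop : Real.log (f (AffineMap.lineMap x₀ x l)).toReal ≤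
      Real.log (f x₀).toReal - Real.log 2 := by
    rw [← Real.log_div ha.ne' two_ne_zero]
    exact Real.log_le_log hmid (hhalf _ hsphere)
  have hlog : Real.log (f x).toReal ≤ Real.log (f x₀).toReal + -(Real.log 2 / r * ‖x - x₀‖) := by
    have hscale : l * (Real.log 2 / r * ‖x - x₀‖) = Real.log 2 := by
      rw [hl]
      field_simp
    nlinarith
  calc (f x).toReal = Real.exp (Real.log (f x).toReal) := (Real.exp_log hfx).symm
    _ ≤ Real.exp (Real.log (f x₀).toReal + -(Real.log 2 / r * ‖x - x₀‖)) := Real.exp_le_exp.2 hlog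
    _ = _ := by rw [Real.exp_add, Real.exp_log ha]

variable [ProperSpace V] {M : ℝ≥0∞}

lemma exists_exp_decay (hf : LogConcave f) (hM : M < ∞) (hfM : ∀ x, f x ≤ M)
    (h0 : Tendsto f (cocompact V) (𝓝 0)) (hx₀ : 0 < f x₀) :
    ∃ C > 0, ∃ κ > 0, ∀ x, (f x).toReal ≤ C * Real.exp (-(κ * ‖x - x₀‖)) := by
  have hfin x : f x < ∞ := (hfM x).trans_lt hM
  have ha : 0 < (f x₀).toReal := ENNReal.toReal_pos hx₀.ne' (hfin x₀).ne
  have haM : (f x₀).toReal ≤ M.toReal := ENNReal.toReal_mono hM.ne (hfM x₀)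
  obtain ⟨r, hr, hhalf⟩ : ∃ r > 0, ∀ x, ‖x - x₀‖ = r → (f x).toReal ≤ (f x₀).toReal / 2 := by
    have hev : ∀ᶠ x in cocompact V, f x < ENNReal.ofReal ((f x₀).toReal / 2) :=
      h0.eventually_lt_const (by simpa using ha)
    rw [← Metric.cobounded_eq_cocompact] at hev
    obtain ⟨r, -, hr⟩ := (Metric.hasBasis_cobounded_compl_closedBall x₀).eventually_iff.1 hev
    refine ⟨max r 0 + 1, by positivity, fun x hx => ?_⟩
    refine ENNReal.toReal_le_of_le_ofReal (by positivity) (hr ?_).le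
    rw [mem_compl_iff, mem_closedBall_iff_norm, not_le, hx]
    exact (le_max_left r 0).trans_lt (lt_add_one _)
  set κ := Real.log 2 / r
  have hκ0 : 0 < κ := div_pos (Real.log_pos one_lt_two) hr
  refine ⟨M.toReal * Real.exp (κ * r), mul_pos (ha.trans_le haM) (Real.exp_pos _), κ, hκ0,
    fun x => ?_⟩
  have hinit : M.toReal ≤ M.toReal * Real.exp (κ * r) :=
    le_mul_of_one_le_right ENNReal.toReal_nonneg (Real.one_le_exp (by positivity))
  rcases le_total ‖x - x₀‖ r with hx | hx
  · calc (f x).toReal ≤ M.toReal := ENNReal.toReal_mono hM.ne (hfM x)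
      _ ≤ M.toReal * Real.exp (κ * r + -(κ * ‖x - x₀‖)) :=
        le_mul_of_one_le_right ENNReal.toReal_nonneg (Real.one_le_exp (by nlinarith))
      _ = _ := by rw [Real.exp_add, mul_assoc]
  · calc (f x).toReal ≤ (f x₀).toReal * Real.exp (-(κ * ‖x - x₀‖)) :=
        hf.toReal_le_mul_exp hfin hx₀ hr hhalf hx
      _ ≤ _ := mul_le_mul_of_nonneg_right (haM.trans hinit) (Real.exp_pos _).le

lemma exists_norm_pow_mul_le (hf : LogConcave f) (hM : M < ∞) (hfM : ∀ x, f x ≤ M)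
    (h0 : Tendsto f (cocompact V) (𝓝 0)) (hx₀ : 0 < f x₀) (k : ℕ) :
    ∃ C, ∀ x, ‖x‖ ^ k * (f x).toReal ≤ C := by
  obtain ⟨C, _, κ, hκ, hdecay⟩ := hf.exists_exp_decay hM hfM h0 hx₀
  refine ⟨k.factorial / κ ^ k * Real.exp (κ * ‖x₀‖) * C, fun x => ?_⟩
  have hpow : ‖x‖ ^ k ≤ k.factorial / κ ^ k * Real.exp (κ * ‖x‖) := by
    have hexp := Real.pow_div_factorial_le_exp (κ * ‖x‖) (by positivity) k
    rw [mul_pow, div_le_iff₀ (by positivity)] at hexp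
    rw [div_mul_eq_mul_div, le_div_iff₀ (by positivity)]
    linarith
  have htri : ‖x‖ ≤ ‖x₀‖ + ‖x - x₀‖ := norm_le_norm_add_norm_sub' x x₀
  have hexp : Real.exp (κ * ‖x‖) ≤ Real.exp (κ * ‖x₀‖) * Real.exp (κ * ‖x - x₀‖) := by
    rw [← Real.exp_add, ← mul_add]
    gcongr
  calc ‖x‖ ^ k * (f x).toReal
      ≤ k.factorial / κ ^ k * (Real.exp (κ * ‖x₀‖) * Real.exp (κ * ‖x - x₀‖)) *
          (C * Real.exp (-(κ * ‖x - x₀‖))) := by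
        gcongr
        · exact hpow.trans (by gcongr)
        · exact hdecay x
    _ = k.factorial / κ ^ k * Real.exp (κ * ‖x₀‖) * C *
          (Real.exp (κ * ‖x - x₀‖) * Real.exp (-(κ * ‖x - x₀‖))) := by ring
    _ = _ := by rw [← Real.exp_add, add_neg_cancel, Real.exp_zero, mul_one]

end LogConcave

end Decay

section Moments

variable {f : E n → ℝ≥0∞}

lemma MemC.integrable_norm_pow_mul (hf : MemC 0 f) (k : ℕ) :
    Integrable fun x => ‖x‖ ^ k * (f x).toReal := by
  obtain ⟨x₀, hx₀⟩ := hf.proper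
  obtain ⟨M, hM, hfM⟩ := exists_forall_le_of_tendsto_zero hf.finite hf.usc hf.tendsto_zero
  obtain ⟨C, hC⟩ := hf.alphaConcave.logConcave.exists_norm_pow_mul_le hM hfM hf.tendsto_zero hx₀
    (k + (volume : Measure (E n)).integrablePower)
  have hint := integrable_of_le_of_pow_mul_le (f := fun x => (f x).toReal) (μ := volume)
    (C₁ := M.toReal) (C₂ := C) (k := k)
    (fun x => by simpa using ENNReal.toReal_mono hM.ne (hfM x)) (fun x => by simpa using hC x)
    hf.usc.measurable.ennreal_toReal.aestronglyMeasurable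
  simpa using hint

lemma MemC.lintegral_ne_top (hf : MemC 0 f) : ∫⁻ x, f x ≠ ∞ := by
  have hint := (hf.integrable_norm_pow_mul 0).lintegral_lt_top
  simp only [pow_zero, one_mul, ENNReal.ofReal_toReal (hf.finite _).ne] at hint
  exact hint.ne

lemma MemC.integrable_id_withDensity (hf : MemC 0 f) : Integrable id (volume.withDensity f) := by
  rw [integrable_withDensity_iff_integrable_smul' hf.usc.measurable (.of_forall hf.finite)]
  refine (hf.integrable_norm_pow_mul 1).mono'
    (hf.usc.measurable.ennreal_toReal.aestronglyMeasurable.smul aestronglyMeasurable_id)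
    (.of_forall fun x => ?_)
  rw [pow_one, norm_smul, Real.norm_of_nonneg ENNReal.toReal_nonneg, mul_comm]
  rfl

lemma MemC.exists_nonempty_interior_le {α : EReal} (hf : MemC α f) :
    ∃ δ > 0, (interior {x | δ ≤ f x}).Nonempty := by
  obtain ⟨y, c, hc, δ, hδ, hball⟩ := hf.alphaConcave.exists_closedBall hf.full_dim
  exact ⟨δ, hδ, y, mem_interior_iff_mem_nhds.2
    (mem_of_superset (Metric.closedBall_mem_nhds y hc) hball)⟩

lemma MemC.lintegral_ne_zero {α : EReal} (hf : MemC α f) : ∫⁻ x, f x ≠ 0 := by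
  obtain ⟨δ, hδ, hint⟩ := hf.exists_nonempty_interior_le
  refine (pos_iff_ne_zero.2 ?_ |>.trans_le (mul_meas_ge_le_lintegral hf.usc.measurable δ)).ne'
  exact mul_ne_zero hδ.ne' (Measure.measure_pos_of_nonempty_interior _ hint).ne'

end Moments

/-! ### The equality case for the exponent zero -/

section EqualityZero

variable {u : E n} {f : E n → ℝ≥0∞}

lemma map_add_withDensity (hf : Measurable f) (b : E n) :
    (volume.withDensity f).map (· + b) = volume.withDensity fun x => f (x - b) := by
  ext A hA
  have hadd : Measurable fun x : E n => x + b := by fun_prop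
  rw [Measure.map_apply hadd hA, withDensity_apply _ (hadd hA), withDensity_apply _ hA,
    ← (measurePreserving_add_right volume b).setLIntegral_comp_preimage hA (by fun_prop)]
  simp

lemma integrable_id_withDensity_comp (T : E n ≃ₗᵢ[ℝ] E n)
    (hf : Integrable id (volume.withDensity f)) :
    Integrable id (volume.withDensity fun x => f (T x)) := by
  have hT : Measurable T := T.continuous.measurable
  rw [← map_withDensity_comp T f,
    integrable_map_measure aestronglyMeasurable_id hT.aemeasurable] at hf
  exact hf.congr' aestronglyMeasurable_id (.of_forall fun x => by simp)

lemma MemC.exists_map_add_eq_of_mass_symm_eq (hu : ‖u‖ = 1) (hf : MemC 0 f)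
    (hmass : mass (symm 0 u f) = mass f) :
    ∃ b : E n, (volume.withDensity f).map (· + b) =
      volume.withDensity fun x => f (reflIso u x) := by
  obtain ⟨m, rfl⟩ : ∃ m, n = m + 1 := Nat.exists_eq_succ_of_ne_zero <| by
    rintro rfl
    simp [Subsingleton.elim u 0] at hu
  have hfm := hf.usc.measurable
  have hfc := hf.alphaConcave.logConcave
  have hI : ∫⁻ x, f x = ENNReal.ofReal (∫⁻ x, f x).toReal :=
    (ENNReal.ofReal_toReal hf.lintegral_ne_top).symm
  exact exists_map_add_eq_withDensity (inv_ne_zero two_ne_zero) (inv_ne_zero two_ne_zero)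
    half_add_half hfm (hfm.comp (reflIso u).continuous.measurable)
    (hf.tame.tame_symm hu).usc.measurable hfc
    (hfc.comp_affineMap (reflIso u).toAffineIsometryEquiv.toAffineEquiv.toAffineMap)
    (hf.tame.alphaMean_le_symm_of_nonpos hu le_rfl le_rfl)
    (ENNReal.toReal_pos hf.lintegral_ne_zero hf.lintegral_ne_top) hI
    ((lintegral_comp_linearIsometryEquiv _ f).trans hI) (hmass.trans hI)
    hf.integrable_id_withDensity (integrable_id_withDensity_comp _ hf.integrable_id_withDensity)

lemma MemC.exists_translate_of_mass_symm_eq (hu : ‖u‖ = 1) (hf : MemC 0 f)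
    (hmass : mass (symm 0 u f) = mass f) : ∃ x₀, ∀ x, f x = refl u f (x - x₀) := by
  have hfm := hf.usc.measurable
  have hfc := hf.alphaConcave.logConcave
  have hR : Continuous (reflIso u) := (reflIso u).continuous
  obtain ⟨b, hb⟩ := hf.exists_map_add_eq_of_mass_symm_eq hu hmass
  have hae : (fun x => f (x - b)) =ᵐ[volume] fun x => f (reflIso u x) := by
    refine (withDensity_eq_iff (by fun_prop) (hfm.comp hR.measurable).aemeasurable ?_).1
      ((map_add_withDensity hfm b).symm.trans hb)
    rw [lintegral_sub_right_eq_self]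
    exact hf.lintegral_ne_top
  obtain ⟨δ, hδ, hint⟩ := hf.exists_nonempty_interior_le
  have hint' : (interior {x | δ ≤ f (x - b)}).Nonempty := by
    have hpre := hint.preimage (Homeomorph.subRight b).surjective
    rwa [(Homeomorph.subRight b).preimage_interior] at hpre
  have htrans : LogConcave fun x => f (x - b) := by
    simpa [sub_eq_neg_add] using
      hfc.comp_affineMap (AffineEquiv.constVAdd ℝ (E n) (-b)).toAffineMap
  have heq := htrans.eq_of_ae_eq
    (hfc.comp_affineMap (reflIso u).toAffineIsometryEquiv.toAffineEquiv.toAffineMap) hδ hint'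
    (hf.usc.comp (continuous_sub_right b)) (hf.usc.comp hR) hae
  refine ⟨-b, fun x => ?_⟩
  rw [refl_eq hu, Function.comp_apply, sub_neg_eq_add]
  simpa using congrFun heq (x + b)

lemma Tame.mass_symm_eq_of_translate (hu : ‖u‖ = 1) (hf : Tame 0 f) (hlc : LogConcave f) {x₀ : E n}
    (h : ∀ x, f x = refl u f (x - x₀)) : mass (symm 0 u f) = mass f := by
  refine le_antisymm ?_ (hf.mass_le_mass_symm hu ?_)
  · have hle : ∀ x, symm 0 u f x ≤ f (x + (2⁻¹ : ℝ) • x₀) := fun x =>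
      hf.symm_le hu fun y _ z _ hx => by
        have hz : f (reflIso u z + x₀) = f z := by
          rw [h, add_sub_cancel_right, refl_eq hu, Function.comp_apply, reflIso_reflIso]
        calc midMean 0 (f y) (f z) = midMean 0 (f y) (f (reflIso u z + x₀)) := by rw [hz]
          _ ≤ f ((2⁻¹ : ℝ) • y + (2⁻¹ : ℝ) • (reflIso u z + x₀)) := by
            exact_mod_cast hlc y (reflIso u z + x₀) 2⁻¹ 2⁻¹ half_add_half
          _ = f (x + (2⁻¹ : ℝ) • x₀) := by rw [← hx, mixPt]; congr 1; module
    calc mass (symm 0 u f) ≤ ∫⁻ x, f (x + (2⁻¹ : ℝ) • x₀) := lintegral_mono hle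
      _ = mass f := lintegral_add_right_eq_self f _
  · exact_mod_cast neg_nonpos.2 (by positivity : (0 : ℝ) ≤ 1 / n)

end EqualityZero

end MinkSymm

end

open MinkSymm in
theorem proposition3p4 (n : ℕ) (α : EReal) (u : EuclideanSpace ℝ (Fin n)) (hu : ‖u‖ = 1)
    (f g : EuclideanSpace ℝ (Fin n) → ℝ≥0∞) (hf : MemC α f) (hg : MemC α g) :
    -- preservation of the mean width
    (α ≠ ⊤ → alphaMeanWidth α (symm α u f) = alphaMeanWidth α f) ∧
    -- monotonicity
    ((∀ x, f x ≤ g x) → ∀ x, symm α u f x ≤ symm α u g x) ∧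
    -- symmetry
    refl u (symm α u f) = symm α u f ∧
    -- idempotence
    symm α u (symm α u f) = symm α u f ∧
    -- invariance on symmetric functions
    (∀ f' : EuclideanSpace ℝ (Fin n) → ℝ≥0∞, MemC α f' → refl u f' = f' → symm α u f' = f') ∧
    -- projection invariance
    proj u (symm α u f) = proj u f ∧
    -- the total mass does not decrease, with the equality case for the exponent zero
    (((-(1 / (n : ℝ)) : ℝ) : EReal) ≤ α →
      ∀ φ : EuclideanSpace ℝ (Fin n) → ℝ≥0∞, (MemC α φ ∨ (α ≤ 0 ∧ MemLCc φ)) →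
        mass φ ≤ mass (symm α u φ)) ∧
    (α = 0 → (mass (symm α u f) = mass f ↔ ∃ x₀, ∀ x, f x = refl u f (x - x₀))) ∧
    -- superlevel sets
    (∀ t : ℝ, 0 < t → superlevel t (symm ⊥ u f) = symmSet u (superlevel t f)) := by
  refine ⟨fun hα => hf.alphaMeanWidth_symm hα hu, symm_mono hu hf.tame hg.tame,
    refl_symm hu hf.tame, symm_symm hu hf.tame hf.midConcave,
    fun f' hf' hR => symm_eq_self hu hf'.tame hf'.midConcave hR,
    proj_symm hu hf.tame hf.midConcave, ?_, ?_,
    fun t ht => superlevel_symm_bot hu (.of_nonpos bot_le hf.finite hf.usc hf.tendsto_zero) ht⟩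
  · rintro hα φ (hφ | ⟨hα0, hφ⟩)
    · exact hφ.tame.mass_le_mass_symm hu hα
    · exact (Tame.of_nonpos hα0 hφ.finite hφ.usc hφ.tendsto_zero).mass_le_mass_symm hu hα
  · rintro rfl
    exact ⟨hf.exists_translate_of_mass_symm_eq hu,
      fun ⟨_, h⟩ => hf.tame.mass_symm_eq_of_translate hu hf.alphaConcave.logConcave h⟩
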